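/- Let $(M,\mu)$ be a $\sigma$-finite measure space, $L^\infty=L^\infty(M,\mu;\mathbb C)$, $L^1=L^1(M,\mu;\mathbb C)$, $\langle f,g\rangle=\int f\bar g\,d\mu$. Let $(T_t)_{t\ge0}$ be a semigroup of positive, weak*-continuous contractions on $L^\infty$ with $T_0=\mathrm{id}$ and $\langle T_tf,g\rangle\to\langle f,g\rangle$ as $t\to0^+$ for all $f\in L^\infty$, $g\in L^1$, with negative generator $L$. Assume the $\Gamma^2\ge0$ criterion: for all $t,u>0$ and $f\in L^\infty$, almost everywhere, $$T_t|T_uf|^2-|T_tT_uf|^2\le T_u\big(T_t|f|^2-|T_tf|^2\big).$$ For $0<\alpha<1$ let $\phi_{t,\alpha}$ be the function on $(0,\infty)$ with Laplace transform $e^{-tz^\alpha}$, let $T_{t,\alpha}f=\int_0^\infty T_uf\,\phi_{t,\alpha}(u)\,du$ (a weak* integral), and let $L^\alpha$ be the negative generator of $(T_{t,\alpha})_{t\ge 0}$; it is defined on $T_{t,\alpha}L^\infty$ for $t>0$. For $f\in L^\infty$ put $$\|f\|_{bmo(L^\alpha)}=\sup_{t>0}\big\|T_{t,\alpha}|f|^2-|T_{t,\alpha}f|^2\big\|_\infty^{1/2},\qquad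 \|f\|_{BMO(L^\alpha)}=\sup_{t>0}\big\|T_{t,\alpha}|f-T_{t,\alpha}f|^2\big\|_\infty^{1/2}.$$ For $g\in L^1$ let $\|g\|_{H^1(L^\alpha)}=\sup\{|\langle f,g\rangle|: f\in L^\infty,\ \|f\|_{BMO(L^\alpha)},\|\bar f\|_{BMO(L^\alpha)}\le1\}$, let $H^1(L^\alpha)$ be the set of $g\in L^1$ for which this is finite, and let $BMO(L^\alpha)$ be the space of bounded functionals on $H^1(L^\alpha)$ that are weak* limits (tested on $H^1(L^\alpha)$) of nets of functionals $\langle f,\cdot\rangle$ with $f\in L^\infty$, with the dual norm. Let $a:(0,\infty)\to\mathbb C$ be measurable and $c_a\ge0$ with $s\int_s^\infty|a(v-s)|^2v^{-2}\,dv\le c_a^2$ for all $s>0$. There is an absolute constant $c$ such that the following hold. (i) If $a$ is supported on a compact subset of $(0,\infty)$, then for every $f\in L^\infty$ the integral $M_af=\int_0^\infty a(t)L^\alpha T_{t,\alpha}f\,dt$ converges in $L^\infty$ and $$\|M_af\|_{bmo(L^\alpha)}\le\frac{c\,c_a}{(1-\alpha)^2}\|f\|_{bmo(L^\alpha)},\qquad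 \|M_af\|_{BMO(L^\alpha)}\le\frac{c\,c_a}{(1-\alpha)^2}\|f\|_{L^\infty}.$$ (ii) For general $a$ and $f\in L^\infty$, the functionals $\big\langle\int_\varepsilon^N a(t)L^\alpha T_{t,\alpha}f\,dt,\cdot\big\rangle$ converge weak* in $BMO(L^\alpha)$ as $\varepsilon\to0^+$, $N\to\infty$. The limit $M_af$ satisfies $\|M_af\|_{BMO(L^\alpha)}\le\frac{c\,c_a}{(1-\alpha)^2}\|f\|_{L^\infty}$, and $M_a$ extends to a weak*-continuous bounded operator on $BMO(L^\alpha)$ of norm at most $\frac{c\,c_a}{(1-\alpha)^2}$. -/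

import Mathlib

open MeasureTheory Filter Set Topology
open scoped ENNReal ComplexOrder ComplexConjugate

noncomputable section

/-! ### The space `L^∞(M)`, its duality with `L^1(M)`, and its weak* topology -/

/-- Complex valued essentially bounded functions. -/
abbrev Linfty {M : Type*} [MeasurableSpace M] (μ : Measure M) := Lp ℂ ∞ μ

section

variable {M : Type*} [MeasurableSpace M] {μ : Measure M}

/-- `⟨f, g⟩ = ∫ f g^*`. -/
def pairing (f : Linfty μ) (g : Lp ℂ 1 μ) : ℂ := ∫ x, f x * conj (g x) ∂μ

/-- The weak* topology of `L^∞` as the dual of `L^1`. -/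
@[reducible] def weakStar (μ : Measure M) : TopologicalSpace (Linfty μ) :=
  TopologicalSpace.induced (fun f (g : Lp ℂ 1 μ) => pairing f g) Pi.topologicalSpace

/-- `f` is real and nonnegative almost everywhere. -/
def IsNonneg (f : Linfty μ) : Prop := ∀ᵐ x ∂μ, 0 ≤ f x

/-- The function `|f|^2 = f^* f`, again an element of `L^∞`. -/
def absSq (f : Linfty μ) : Linfty μ := (star f : Linfty μ) • f

/-- `h` is the weak* integral over `(0, ∞)` of the family `F`. -/
def HasWeakStarIntegral (F : ℝ → Linfty μ) (h : Linfty μ) : Prop :=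
  ∀ g : Lp ℂ 1 μ, IntegrableOn (fun u => pairing (F u) g) (Ioi 0) ∧
    ∫ u in Ioi 0, pairing (F u) g = pairing h g

open Classical in
/-- The weak* integral over `(0, ∞)` (and `0` if it does not exist). -/
def weakStarIntegral (F : ℝ → Linfty μ) : Linfty μ :=
  if h : ∃ k, HasWeakStarIntegral F k then h.choose else 0

/-! ### Semigroups, subordination, generators -/

/-- `(T t)`, `t ≥ 0`, is a weak* continuous semigroup of positive, weak* continuous contractions on
`L^∞`.  The values `T t` with `t < 0` play no role. -/
structure IsPositiveContractionSemigroup (T : ℝ → Linfty μ →L[ℂ] Linfty μ) : Prop where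
  zero : T 0 = ContinuousLinearMap.id ℂ (Linfty μ)
  add : ∀ s t, 0 ≤ s → 0 ≤ t → T (s + t) = (T s).comp (T t)
  contraction : ∀ t, 0 ≤ t → ‖T t‖ ≤ 1
  positive : ∀ t, 0 ≤ t → ∀ f, IsNonneg f → IsNonneg (T t f)
  weakStar_continuous : ∀ t, 0 ≤ t → Continuous[weakStar μ, weakStar μ] (T t)
  tendsto_zero : ∀ (f : Linfty μ) (g : Lp ℂ 1 μ),
    Tendsto (fun t => pairing (T t f) g) (𝓝[>] 0) (𝓝 (pairing f g))

/-- The `Γ² ≥ 0` criterion: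
`T_t |T_u f|² - |T_t T_u f|² ≤ T_u (T_t |f|² - |T_t f|²)` almost everywhere. -/
def GammaTwoNonneg (T : ℝ → Linfty μ →L[ℂ] Linfty μ) : Prop :=
  ∀ t u : ℝ, 0 < t → 0 < u → ∀ f : Linfty μ,
    IsNonneg (T u (T t (absSq f) - absSq (T t f)) -
      (T t (absSq (T u f)) - absSq (T t (T u f))))

/-- The density `φ_{s,α}` on `(0, ∞)` whose Laplace transform is `z ↦ exp (-s z^α)`, given by the
inverse Laplace transform `(2πi)⁻¹ ∫_{1 - i∞}^{1 + i∞} exp (z l) exp (-s z^α) dz`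
(an absolutely convergent integral with a real value). -/
def subordDensity (s α l : ℝ) : ℝ :=
  (∫ y : ℝ, Complex.exp ((1 + y * Complex.I) * l - s * (1 + y * Complex.I) ^ (α : ℂ))).re /
    (2 * Real.pi)

/-- The integrand `u ↦ φ_{t,α}(u) T_u f` of the subordination formula. -/
def subordIntegrand (T : ℝ → Linfty μ →L[ℂ] Linfty μ) (α t : ℝ) (f : Linfty μ) (u : ℝ) :
    Linfty μ :=
  (subordDensity t α u : ℂ) • T u f

open Classical in
/-- The subordinated semigroup `T_{t,α} f = ∫_0^∞ T_u f φ_{t,α}(u) du` for `t > 0`, and the identity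
for `t = 0`. -/
def subord (T : ℝ → Linfty μ →L[ℂ] Linfty μ) (α t : ℝ) (f : Linfty μ) : Linfty μ :=
  if 0 < t then weakStarIntegral (subordIntegrand T α t f) else f

/-- `f` lies in the domain of the negative infinitesimal generator of `S`, with value `h`: the
quotients `(f - S_y f) / y` converge weak* to `h` as `y → 0+`. -/
def HasNegGenerator (S : ℝ → Linfty μ → Linfty μ) (f h : Linfty μ) : Prop :=
  ∀ g : Lp ℂ 1 μ,
    Tendsto (fun y : ℝ => pairing ((y⁻¹ : ℂ) • (f - S y f)) g) (𝓝[>] 0) (𝓝 (pairing h g))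

open Classical in
/-- The negative infinitesimal generator of `S` (and `0` outside of its domain). -/
def negGenerator (S : ℝ → Linfty μ → Linfty μ) (f : Linfty μ) : Linfty μ :=
  if h : ∃ k, HasNegGenerator S f k then h.choose else 0

/-- `L^α T_{t,α} f`, where `L^α` is the negative generator of the semigroup `(T_{t,α})_t`. -/
def fracGenSubord (T : ℝ → Linfty μ →L[ℂ] Linfty μ) (α t : ℝ) (f : Linfty μ) : Linfty μ :=
  negGenerator (subord T α) (subord T α t f)

/-- Stein's condition `s ∫_s^∞ |a(v - s)|² v⁻² dv ≤ c_a²` for all `s > 0`. -/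
def SteinCondition (a : ℝ → ℂ) (ca : ℝ) : Prop :=
  ∀ s : ℝ, 0 < s →
    ENNReal.ofReal s * ∫⁻ v in Ioi s, ‖a (v - s)‖ₑ ^ 2 / ENNReal.ofReal (v ^ 2) ≤
      ENNReal.ofReal (ca ^ 2)

/-- `M_a f = ∫_0^∞ a(t) L^α T_{t,α} f dt`, as an integral in the Banach space `L^∞`. -/
def steinMult (T : ℝ → Linfty μ →L[ℂ] Linfty μ) (α : ℝ) (a : ℝ → ℂ) (f : Linfty μ) : Linfty μ :=
  ∫ t in Ioi (0 : ℝ), a t • fracGenSubord T α t f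

/-! ### The seminorms `bmo` and `BMO` on `L^∞` -/

/-- `sup_{t > 0} ‖ S_t |f|² - |S_t f|² ‖^{1/2}`. -/
def bmoNorm (S : ℝ → Linfty μ → Linfty μ) (f : Linfty μ) : ℝ≥0∞ :=
  ⨆ (t : ℝ) (_ : 0 < t), ‖S t (absSq f) - absSq (S t f)‖ₑ ^ (1 / 2 : ℝ)

/-- `sup_{t > 0} ‖ S_t |f - S_t f|² ‖^{1/2}`. -/
def BMONorm (S : ℝ → Linfty μ → Linfty μ) (f : Linfty μ) : ℝ≥0∞ :=
  ⨆ (t : ℝ) (_ : 0 < t), ‖S t (absSq (f - S t f))‖ₑ ^ (1 / 2 : ℝ)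

/-! ### The spaces `H^1` and `BMO` -/

lemma integrable_pairing (f : Linfty μ) (g : Lp ℂ 1 μ) :
    Integrable (fun x => f x * conj (g x)) μ := by
  have hg : MemLp (fun x => conj (g x)) 1 μ :=
    (Lp.memLp g).of_le
      (Complex.continuous_conj.comp_aestronglyMeasurable (Lp.memLp g).1) (by simp)
  exact memLp_one_iff_integrable.1 (hg.mul (r := 1) (Lp.memLp f))

lemma pairing_add_left (f f' : Linfty μ) (g : Lp ℂ 1 μ) :
    pairing (f + f') g = pairing f g + pairing f' g := by
  unfold pairing
  rw [← integral_add (integrable_pairing f g) (integrable_pairing f' g)]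
  refine integral_congr_ae ?_
  filter_upwards [Lp.coeFn_add f f'] with x hx
  rw [hx, Pi.add_apply, add_mul]

lemma pairing_smul_left (c : ℂ) (f : Linfty μ) (g : Lp ℂ 1 μ) :
    pairing (c • f) g = c * pairing f g := by
  unfold pairing
  rw [← integral_const_mul]
  refine integral_congr_ae ?_
  filter_upwards [Lp.coeFn_smul c f] with x hx
  simp [hx, mul_assoc]

lemma pairing_add_right (f : Linfty μ) (g g' : Lp ℂ 1 μ) :
    pairing f (g + g') = pairing f g + pairing f g' := by
  unfold pairing
  rw [← integral_add (integrable_pairing f g) (integrable_pairing f g')]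
  refine integral_congr_ae ?_
  filter_upwards [Lp.coeFn_add g g'] with x hx
  rw [hx, Pi.add_apply, map_add, mul_add]

lemma pairing_smul_right (c : ℂ) (f : Linfty μ) (g : Lp ℂ 1 μ) :
    pairing f (c • g) = conj c * pairing f g := by
  unfold pairing
  rw [← integral_const_mul]
  refine integral_congr_ae ?_
  filter_upwards [Lp.coeFn_smul c g] with x hx
  simp [hx]
  ring

/-- `‖g‖_{H^1} = sup {|⟨f, g⟩| : f ∈ L^∞, ‖f‖_BMO ≤ 1, ‖f^*‖_BMO ≤ 1}` for `g ∈ L^1`. -/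
def H1Norm (S : ℝ → Linfty μ → Linfty μ) (g : Lp ℂ 1 μ) : ℝ≥0∞ :=
  ⨆ (f : Linfty μ) (_ : BMONorm S f ≤ 1 ∧ BMONorm S (star f) ≤ 1), ‖pairing f g‖ₑ

lemma H1Norm_add_le (S : ℝ → Linfty μ → Linfty μ) (g g' : Lp ℂ 1 μ) :
    H1Norm S (g + g') ≤ H1Norm S g + H1Norm S g' := by
  refine iSup₂_le fun f hf => ?_
  rw [pairing_add_right]
  refine (enorm_add_le _ _).trans (add_le_add ?_ ?_)
  · exact le_iSup₂ (f := fun f (_ : BMONorm S f ≤ 1 ∧ BMONorm S (star f) ≤ 1) =>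
      ‖pairing f g‖ₑ) f hf
  · exact le_iSup₂ (f := fun f (_ : BMONorm S f ≤ 1 ∧ BMONorm S (star f) ≤ 1) =>
      ‖pairing f g'‖ₑ) f hf

lemma H1Norm_smul (S : ℝ → Linfty μ → Linfty μ) (c : ℂ) (g : Lp ℂ 1 μ) :
    H1Norm S (c • g) = ‖c‖ₑ * H1Norm S g := by
  unfold H1Norm
  simp_rw [ENNReal.mul_iSup, pairing_smul_right, enorm_mul]
  simp

/-- `H^1 = {g ∈ L^1 : ‖g‖_{H^1} < ∞}` as a subspace of `L^1`. -/
def H1Submodule (S : ℝ → Linfty μ → Linfty μ) : Submodule ℂ (Lp ℂ 1 μ) where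
  carrier := {g | H1Norm S g < ∞}
  add_mem' := fun {g g'} hg hg' =>
    (H1Norm_add_le S g g').trans_lt (ENNReal.add_lt_top.2 ⟨hg, hg'⟩)
  zero_mem' := by
    have h := H1Norm_smul S (0 : ℂ) 0
    simp only [zero_smul, enorm_zero, zero_mul] at h
    simp [h]
  smul_mem' := fun c g hg => by
    rw [mem_ofPred_eq, H1Norm_smul]
    exact ENNReal.mul_lt_top enorm_lt_top hg

/-- The space `H^1`, to be normed by `‖·‖_{H^1}` (not by the norm of `L^1`). -/
def H1 (S : ℝ → Linfty μ → Linfty μ) : Type _ := H1Submodule S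

variable {S : ℝ → Linfty μ → Linfty μ}

instance : AddCommGroup (H1 S) := inferInstanceAs (AddCommGroup (H1Submodule S))

instance : Module ℂ (H1 S) := inferInstanceAs (Module ℂ (H1Submodule S))

/-- The inclusion of `H^1` into `L^1`. -/
def H1.toL1 : H1 S →ₗ[ℂ] Lp ℂ 1 μ := (H1Submodule S).subtype

lemma H1.norm_lt_top (g : H1 S) : H1Norm S (H1.toL1 g) < ∞ := g.2

instance : Norm (H1 S) := ⟨fun g => (H1Norm S (H1.toL1 g)).toReal⟩

lemma H1.norm_def (g : H1 S) : ‖g‖ = (H1Norm S (H1.toL1 g)).toReal := rfl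

lemma H1.core : SeminormedSpace.Core ℂ (H1 S) where
  norm_nonneg := fun _ => ENNReal.toReal_nonneg
  norm_smul := fun c g => by
    rw [H1.norm_def, H1.norm_def, map_smul, H1Norm_smul, ENNReal.toReal_mul, toReal_enorm]
  norm_triangle := fun g g' => by
    rw [H1.norm_def, H1.norm_def, H1.norm_def, map_add,
      ← ENNReal.toReal_add g.norm_lt_top.ne g'.norm_lt_top.ne]
    exact ENNReal.toReal_mono (ENNReal.add_lt_top.2 ⟨g.norm_lt_top, g'.norm_lt_top⟩).ne
      (H1Norm_add_le _ _ _)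

instance : SeminormedAddCommGroup (H1 S) := SeminormedAddCommGroup.ofCore H1.core

instance : NormedSpace ℂ (H1 S) where
  norm_smul_le := fun c g => (H1.core.norm_smul c g).le

/-- The bounded functionals on `H^1`, with the dual norm `sup_{‖g‖_{H^1} ≤ 1} |F g|`.  They are
conjugate linear, as is `g ↦ ⟨f, g⟩`. -/
abbrev H1Dual (S : ℝ → Linfty μ → Linfty μ) := H1 S →L⋆[ℂ] ℂ

/-- The functional `F` is `g ↦ ⟨f, g⟩`. -/
def Represents (F : H1Dual S) (f : Linfty μ) : Prop := ∀ g : H1 S, F g = pairing f (H1.toL1 g)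

/-- The image of `L^∞` in the dual of `H^1`. -/
def LinftyImage (S : ℝ → Linfty μ → Linfty μ) : Submodule ℂ (H1Dual S) where
  carrier := {F | ∃ f, Represents F f}
  add_mem' := by
    rintro F F' ⟨f, hf⟩ ⟨f', hf'⟩
    exact ⟨f + f', fun g => by simp [pairing_add_left, hf g, hf' g]⟩
  zero_mem' := ⟨0, fun g => by
    have h := pairing_smul_left 0 (0 : Linfty μ) (H1.toL1 g)
    simp only [zero_smul, zero_mul] at h
    simp [h]⟩
  smul_mem' := by
    rintro c F ⟨f, hf⟩
    exact ⟨c • f, fun g => by simp [pairing_smul_left, hf g]⟩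

/-- Evaluation of functionals at all elements of `H^1`. -/
def H1Dual.eval : H1Dual S →ₗ[ℂ] (H1 S → ℂ) where
  toFun F g := F g
  map_add' _ _ := rfl
  map_smul' _ _ := rfl

/-- The weak* topology of the dual of `H^1`: convergence of `F g` for each `g ∈ H^1`. -/
@[reducible] def H1Dual.weakStar (S : ℝ → Linfty μ → Linfty μ) : TopologicalSpace (H1Dual S) :=
  TopologicalSpace.induced H1Dual.eval Pi.topologicalSpace

/-- The space `BMO`: all bounded functionals on `H^1` that are weak* limits of nets in (the image
of) `L^∞`, with the dual norm. -/
def BMO (S : ℝ → Linfty μ → Linfty μ) : Submodule ℂ (H1Dual S) :=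
  letI : TopologicalSpace (H1Dual S) := H1Dual.weakStar S
  haveI : ContinuousAdd (H1Dual S) := continuousAdd_induced H1Dual.eval
  haveI : ContinuousSMul ℂ (H1Dual S) := continuousSMul_induced H1Dual.eval
  (LinftyImage S).topologicalClosure

instance : SeminormedAddCommGroup (BMO S) := Submodule.seminormedAddCommGroup (BMO S)

instance : NormedSpace ℂ (BMO S) := Submodule.normedSpace (BMO S)

/-- The weak* topology of `BMO`. -/
@[reducible] def BMO.weakStar (S : ℝ → Linfty μ → Linfty μ) : TopologicalSpace (BMO S) :=
  TopologicalSpace.induced (fun F (g : H1 S) => (F : H1Dual S) g) Pi.topologicalSpace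

lemma mem_BMO_iff (F : H1Dual S) :
    F ∈ BMO S ↔ F ∈ @closure _ (H1Dual.weakStar S) {F | ∃ f, Represents F f} := Iff.rfl

end

end

/-!
# Stein multipliers of subordinated semigroups on BMO

Write `β = 1 / (1 - α)`, `P_t = T_{t,α}` and `Q_t = ∂_t P_t`. Then `L^α P_t = -Q_t`, and the multiplier
`M_a f` is an integral of `Q_v f` against the weight `-a(v)`. Of Stein's condition only the consequence
that the averages of `|a|` over `(0, ρ]` are at most `κ = 2 c_a` is used
(`SteinCondition.boundedAverages`).

**The subordination densities.** The inverse Laplace integral defining `φ_{s,α}(l)` is moved to the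
curve on which `z l - s z^α` is real. There the integrand becomes `E exp (-E)`, where `E > 0` depends on
the time through the factor `s^β` only (`subordDensity_eq`). This formula shows that `φ_{s,α}` is a
probability density, that `φ_{t,α} ≤ (t/s)^β φ_{s,α}` for `s ≤ t`, and that `|∂_s φ_{s,α}|` is at most
`2β/s` times the density at a time comparable to `s`. Hence `P` is a semigroup with `‖Q_t‖ ≤ 2β/t` and
`P_t F ≤ (t/s)^β P_s F` for `F ≥ 0`. By Jensen's inequality the `Γ²` criterion passes from `T` to `P`,
also in a version for `Q` (`IsPositiveContractionSemigroup.subordinatedSemigroup`).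

**The bmo estimate.** Let `D_t F = P_t |F|² - |P_t F|²`. The cocycle identity
`D_{s+t} F = P_s D_t F + D_s P_t F` writes `D_t F` as a sum over small steps, and by the `Γ²` criterion
its summands decrease. The defect of `P_S F` over a short time `τ` is therefore at most a fraction
`τ / S` of `P_τ D_S F` (`defect_average_le`). Consequently the defect of `Q_w f` at a time `τ` much smaller
than `w` gains a factor `(τ / w)^{1/2}`, and integration over dyadic intervals of `w` yields geometric
series. To keep the dependence on `β` quadratic, the time `t` is divided into about `4β` steps: in all
steps but the first the parameters exceed the step, and in the first one the outer times agree up to a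
factor `1 + O(1/β)`, so that the quasi-monotonicity constant stays bounded
(`norm_defect_weightedDeriv_le`).

**The BMO estimate.** The seminorm `BMO` is comparable to `bmo + sup ‖P_t F - P_{2t} F‖`: the estimate
of `bmo` by `BMO` follows by absorption, since `D_t P_{4t} F` is at most a quarter of `P_t D_{4t} F`. The
second term of `M_a f` is estimated directly from `‖Q_y f‖ ≲ β ‖f‖_BMO / y`
(`norm_oscillation_weightedDeriv_le`).

**The extension to BMO.** For `g ∈ H^1` the estimates hold uniformly for all truncations of all weights
`θ a` with `|θ| ≤ 1`, so that `a(v) ⟨Q_v f, g⟩` is absolutely integrable and the truncations converge.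
Since `L^1` is weakly sequentially complete (`exists_pairing_of_tendsto`), the limit is of the form
`⟨f, R g⟩` with `R g ∈ L^1`, and the `BMO` estimate bounds `R` on `H^1`. The transpose of `R` is the weak*
continuous extension (`exists_extension`).
-/

noncomputable section

/-! ### The stable density as an integral of positive functions -/

section StableDensity

open Complex (I)

/-- The phase `z l - s z^α` of the inverse Laplace integral in the coordinate `w = log z`, in which
it is entire. -/
def stablePhase (α s l : ℝ) (w : ℂ) : ℂ := l * Complex.exp w - s * Complex.exp (α * w)

/-- The factor of Zolotarev's exponent that depends on the angle only. -/
def stableProfile (α θ : ℝ) : ℝ :=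
  Real.sin ((1 - α) * θ) / Real.sin (α * θ) *
    (Real.sin (α * θ) / Real.sin θ) ^ (1 / (1 - α))

/-- The value of `s z^α - z l` at the point of argument `θ` of the curve on which it is real. -/
def stableExponent (α s l θ : ℝ) : ℝ := l * (s / l) ^ (1 / (1 - α)) * stableProfile α θ

/-- The logarithm of the modulus of the point of argument `θ` on the curve where `s z^α - z l` is
real. -/
def stableRadius (α s l θ : ℝ) : ℝ :=
  1 / (1 - α) * Real.log (s * Real.sin (α * θ) / (l * Real.sin θ))

variable {α s l : ℝ}

lemma sin_mul_pos (h0 : 0 < α) (h1 : α < 1) {θ : ℝ} (hθ : θ ∈ Ioo 0 Real.pi) :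
    0 < Real.sin (α * θ) :=
  Real.sin_pos_of_pos_of_lt_pi (mul_pos h0 hθ.1) (by nlinarith [hθ.1, hθ.2])

lemma stableProfile_pos (h0 : 0 < α) (h1 : α < 1) {θ : ℝ} (hθ : θ ∈ Ioo 0 Real.pi) :
    0 < stableProfile α θ := by
  have := sin_mul_pos h0 h1 hθ
  have := sin_mul_pos (sub_pos.2 h1) (by linarith) hθ
  have := Real.sin_pos_of_pos_of_lt_pi hθ.1 hθ.2
  unfold stableProfile; positivity

lemma stableExponent_pos (h0 : 0 < α) (h1 : α < 1) (hs : 0 < s) (hl : 0 < l) {θ : ℝ}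
    (hθ : θ ∈ Ioo 0 Real.pi) : 0 < stableExponent α s l θ := by
  have := stableProfile_pos h0 h1 hθ
  unfold stableExponent; positivity

lemma exp_stableRadius (h0 : 0 < α) (h1 : α < 1) (hs : 0 < s) (hl : 0 < l) {θ : ℝ}
    (hθ : θ ∈ Ioo 0 Real.pi) :
    Real.exp (stableRadius α s l θ) =
      (s * Real.sin (α * θ) / (l * Real.sin θ)) ^ (1 / (1 - α)) := by
  have := sin_mul_pos h0 h1 hθ
  have := Real.sin_pos_of_pos_of_lt_pi hθ.1 hθ.2
  rw [stableRadius, Real.rpow_def_of_pos (by positivity), mul_comm]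

lemma exp_mul_stableRadius (h0 : 0 < α) (h1 : α < 1) (hs : 0 < s) (hl : 0 < l) {θ : ℝ}
    (hθ : θ ∈ Ioo 0 Real.pi) :
    s * Real.exp (α * stableRadius α s l θ) * Real.sin (α * θ) =
      l * Real.exp (stableRadius α s l θ) * Real.sin θ := by
  have h2 := sin_mul_pos h0 h1 hθ
  have h3 := Real.sin_pos_of_pos_of_lt_pi hθ.1 hθ.2
  have h4 : Real.exp (stableRadius α s l θ) =
      Real.exp (α * stableRadius α s l θ) * (s * Real.sin (α * θ) / (l * Real.sin θ)) := by
    conv_rhs => rw [← Real.exp_log (show 0 < s * Real.sin (α * θ) / (l * Real.sin θ) by positivity)]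
    rw [← Real.exp_add, stableRadius]
    congr 1
    have : 1 - α ≠ 0 := by linarith
    field_simp
    ring
  rw [h4]
  field_simp

/-- On the curve the phase is real and equals minus the exponent. -/
lemma stablePhase_curve (h0 : 0 < α) (h1 : α < 1) (hs : 0 < s) (hl : 0 < l) {θ : ℝ}
    (hθ : θ ∈ Ioo 0 Real.pi) :
    stablePhase α s l (stableRadius α s l θ + θ * I) = -(stableExponent α s l θ : ℂ) := by
  have h2 := sin_mul_pos h0 h1 hθ
  have h3 := Real.sin_pos_of_pos_of_lt_pi hθ.1 hθ.2
  have h4 := exp_mul_stableRadius h0 h1 hs hl hθ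
  have h5 : stableExponent α s l θ = l * Real.exp (stableRadius α s l θ) *
      (Real.sin ((1 - α) * θ) / Real.sin (α * θ)) := by
    rw [exp_stableRadius h0 h1 hs hl hθ, stableExponent, stableProfile, mul_div_mul_comm,
      Real.mul_rpow (by positivity) (by positivity)]
    ring
  have h6 : Real.sin ((1 - α) * θ) =
      Real.sin θ * Real.cos (α * θ) - Real.cos θ * Real.sin (α * θ) := by
    rw [← Real.sin_sub]; congr 1; ring
  rw [h5, h6]
  set ρ := stableRadius α s l θ
  have e1 : (α : ℂ) * (ρ + θ * I) = (α * ρ : ℝ) + (α * θ : ℝ) * I := by push_cast; ring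
  rw [stablePhase, e1]
  apply Complex.ext
  · simp only [Complex.sub_re, Complex.exp_re, Complex.add_re,
      Complex.ofReal_re, Complex.mul_re, Complex.I_re, Complex.ofReal_im, Complex.I_im,
      Complex.add_im, Complex.mul_im, Complex.neg_re]
    simp only [mul_zero, zero_mul, sub_zero, add_zero, zero_add, mul_one]
    field_simp
    linear_combination (-Real.cos (α * θ)) * h4
  · simp only [Complex.sub_im, Complex.exp_im, Complex.add_re,
      Complex.ofReal_re, Complex.mul_re, Complex.I_re, Complex.ofReal_im, Complex.I_im,
      Complex.add_im, Complex.mul_im, Complex.neg_im]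
    simp only [mul_zero, zero_mul, sub_zero, add_zero, zero_add, mul_one, neg_zero]
    linear_combination -h4

lemma hasDerivAt_stablePhase (w : ℂ) :
    HasDerivAt (stablePhase α s l)
      (l * Complex.exp w - s * (α * Complex.exp (α * w))) w := by
  unfold stablePhase
  refine ((Complex.hasDerivAt_exp w).const_mul _).sub (HasDerivAt.const_mul _ ?_)
  have := ((hasDerivAt_id w).const_mul (α : ℂ)).cexp
  simpa [mul_comm] using this

lemma HasDerivAt.complex_im {f : ℝ → ℂ} {f' : ℂ} {x : ℝ} (h : HasDerivAt f f' x) :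
    HasDerivAt (fun x => (f x).im) f'.im x :=
  Complex.imCLM.hasFDerivAt.comp_hasDerivAt x h

/-- A primitive of `exp (w + stablePhase w)`, real on the real axis. -/
lemma exists_stablePrimitive (α s l : ℝ) :
    ∃ U : ℂ → ℂ, (∀ w, HasDerivAt U (Complex.exp (w + stablePhase α s l w)) w) ∧
      ∀ x : ℝ, (U x).im = 0 := by
  have hd : Differentiable ℂ (fun w => Complex.exp (w + stablePhase α s l w)) := fun w =>
    ((hasDerivAt_id w).add (hasDerivAt_stablePhase w)).cexp.differentiableAt
  obtain ⟨U, hU0, hU⟩ := hd.isExactOn_univ.with_val_at 0 0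
  refine ⟨U, fun w => hU w (mem_univ _), fun x => ?_⟩
  have h1 : ∀ x : ℝ, HasDerivAt (fun x : ℝ => (U x).im) 0 x := fun x => by
    have h3 := (hU x (mem_univ _)).comp_ofReal.complex_im
    have e : Complex.exp (x + stablePhase α s l x) =
        (Real.exp (x + (l * Real.exp x - s * Real.exp (α * x))) : ℝ) := by
      simp [stablePhase]
    rwa [e, Complex.ofReal_im] at h3
  have h4 := is_const_of_deriv_eq_zero (fun x => (h1 x).differentiableAt)
    (fun x => (h1 x).deriv) x 0
  simpa [hU0] using h4

/-- The derivative of a primitive along the line `1 + i y`. -/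
lemma hasDerivAt_primitive_line {U : ℂ → ℂ}
    (hU : ∀ w, HasDerivAt U (Complex.exp (w + stablePhase α s l w)) w) (y : ℝ) :
    HasDerivAt (fun y : ℝ => (U (Complex.log (1 + y * I))).im)
      (Complex.exp ((1 + y * I) * l - s * (1 + y * I) ^ (α : ℂ))).re y := by
  have hz : (1 + y * I : ℂ) ∈ Complex.slitPlane := by
    left; simp
  have hz0 : (1 + y * I : ℂ) ≠ 0 := Complex.slitPlane_ne_zero hz
  have h1 : HasDerivAt (fun y : ℝ => (1 + y * I : ℂ)) I y := by
    simpa using ((Complex.ofRealCLM.hasDerivAt (x := y)).mul_const I).const_add 1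
  have h3 := ((hU (Complex.log (1 + y * I))).comp y (h1.clog_real hz)).complex_im
  convert! h3 using 1
  rw [Complex.exp_add, Complex.exp_log hz0, stablePhase, Complex.exp_log hz0,
    Complex.cpow_def_of_ne_zero hz0]
  have : (1 + y * I) * Complex.exp (l * (1 + y * I) - s * Complex.exp (α * Complex.log (1 + y * I)))
      * (I / (1 + y * I)) =
      I * Complex.exp ((1 + y * I) * l - s * Complex.exp (Complex.log (1 + y * I) * α)) := by
    field_simp
  rw [this]
  simp

/-- Along the curve the imaginary part of the primitive has a positive derivative. -/
lemma hasDerivAt_primitive_curve (h0 : 0 < α) (h1 : α < 1) (hs : 0 < s) (hl : 0 < l) {U : ℂ → ℂ}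
    (hU : ∀ w, HasDerivAt U (Complex.exp (w + stablePhase α s l w)) w) {θ : ℝ}
    (hθ : θ ∈ Ioo 0 Real.pi) :
    HasDerivAt (fun θ : ℝ => (U (stableRadius α s l θ + θ * I)).im)
      (α / ((1 - α) * l) * (stableExponent α s l θ * Real.exp (-stableExponent α s l θ))) θ := by
  have h2 := sin_mul_pos h0 h1 hθ
  have h3 := Real.sin_pos_of_pos_of_lt_pi hθ.1 hθ.2
  have hα : (1 - α : ℂ) ≠ 0 := by
    exact_mod_cast (sub_pos.2 h1).ne'
  have hlc : (l : ℂ) ≠ 0 := by exact_mod_cast hl.ne'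
  -- the difference of the primitive and a multiple of `exp ∘ phase`, which is real on the curve
  set V : ℂ → ℂ := fun w => U w - Complex.exp (stablePhase α s l w) / ((1 - α) * l) with hV
  have hVd : ∀ w, HasDerivAt V (α / ((1 - α) * l) *
      (-stablePhase α s l w * Complex.exp (stablePhase α s l w))) w := fun w => by
    convert! (hU w).sub ((hasDerivAt_stablePhase w).cexp.div_const ((1 - α) * l)) using 1
    rw [Complex.exp_add]
    field_simp
    rw [stablePhase]
    ring
  obtain ⟨ρ', hρ⟩ : ∃ ρ', HasDerivAt (stableRadius α s l) ρ' θ := by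
    have : DifferentiableAt ℝ (stableRadius α s l) θ := by
      unfold stableRadius
      refine DifferentiableAt.const_mul (DifferentiableAt.log ?_ (by positivity)) _
      exact DifferentiableAt.div (by fun_prop) (by fun_prop) (by positivity)
    exact ⟨_, this.hasDerivAt⟩
  have hγ : HasDerivAt (fun θ : ℝ => (stableRadius α s l θ + θ * I : ℂ)) (ρ' + I) θ := by
    simpa [Function.comp_def] using! hρ.ofReal_comp.add
      ((Complex.ofRealCLM.hasDerivAt (x := θ)).mul_const I)
  have h4 := ((hVd _).comp θ hγ).complex_im
  have h5 : HasDerivAt (fun θ : ℝ => (V (stableRadius α s l θ + θ * I)).im)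
      (α / ((1 - α) * l) * (stableExponent α s l θ * Real.exp (-stableExponent α s l θ))) θ := by
    convert! h4 using 1
    rw [stablePhase_curve h0 h1 hs hl hθ]
    have : (α / ((1 - α) * l) * (- -(stableExponent α s l θ : ℂ) *
        Complex.exp (-(stableExponent α s l θ : ℂ))) * (ρ' + I)) =
        ((α / ((1 - α) * l) *
          (stableExponent α s l θ * Real.exp (-stableExponent α s l θ)) : ℝ) : ℂ) * (ρ' + I) := by
      push_cast; ring
    rw [this, Complex.im_ofReal_mul]
    simp
  refine h5.congr_of_eventuallyEq ?_
  filter_upwards [isOpen_Ioo.mem_nhds hθ] with x hx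
  rw [hV]
  simp only [stablePhase_curve h0 h1 hs hl hx]
  have : Complex.exp (-(stableExponent α s l x : ℂ)) / ((1 - α) * l) =
      ((Real.exp (-stableExponent α s l x) / ((1 - α) * l) : ℝ) : ℂ) := by push_cast; rfl
  rw [this, Complex.sub_im, Complex.ofReal_im, sub_zero]

end StableDensity

section StableDensity

open Complex (I)
variable {α s l : ℝ}

/-! ### Decay of the inverse Laplace integrand -/

/-- The exponential of `- s z ^ α` decays in the right half plane. -/
lemma norm_exp_neg_mul_cpow_le (h0 : 0 < α) (h1 : α < 1) (hs : 0 < s) {z : ℂ} (hz : 0 < z.re) :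
    ‖Complex.exp (-(s * z ^ (α : ℂ)))‖ ≤
      Real.exp (-(s * Real.cos (α * (Real.pi / 2)) * ‖z‖ ^ α)) := by
  rw [Complex.norm_exp, Real.exp_le_exp, Complex.neg_re, neg_le_neg_iff, Complex.re_ofReal_mul,
    mul_assoc]
  refine mul_le_mul_of_nonneg_left ?_ hs.le
  have hz0 : z ≠ 0 := fun h => by simp [h] at hz
  have harg : |z.arg| ≤ Real.pi / 2 := Complex.abs_arg_le_pi_div_two_iff.2 hz.le
  rw [Complex.cpow_def_of_ne_zero hz0, mul_comm (Complex.log z), Complex.exp_re,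
    Complex.re_ofReal_mul, Complex.im_ofReal_mul, Complex.log_re, Complex.log_im,
    Real.rpow_def_of_pos (norm_pos_iff.2 hz0), mul_comm, mul_comm (Real.log _) α]
  refine mul_le_mul_of_nonneg_left ?_ (Real.exp_pos _).le
  rw [← Real.cos_abs (α * z.arg), abs_mul, abs_of_pos h0]
  exact Real.cos_le_cos_of_nonneg_of_le_pi (by positivity) (by nlinarith [Real.pi_pos])
    (mul_le_mul_of_nonneg_left harg h0.le)

lemma cos_mul_pi_div_two_pos (h0 : 0 < α) (h1 : α < 1) : 0 < Real.cos (α * (Real.pi / 2)) :=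
  Real.cos_pos_of_mem_Ioo ⟨by nlinarith [Real.pi_pos], by nlinarith [Real.pi_pos]⟩

lemma integrable_exp_neg_mul_abs_rpow (h0 : 0 < α) {b : ℝ} (hb : 0 < b) :
    Integrable (fun y : ℝ => Real.exp (-(b * |y| ^ α))) := by
  have h := integrableOn_rpow_mul_exp_neg_mul_rpow (s := 0) (p := α) (b := b) (by norm_num) h0 hb
  have h2 : IntegrableOn (fun y : ℝ => Real.exp (-(b * y ^ α))) (Ioi 0) := by simpa using h
  have h3 : IntegrableOn (fun y : ℝ => Real.exp (-(b * |y| ^ α))) (Ioi 0) :=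
    h2.congr_fun (fun y hy => by simp only [abs_of_pos (show 0 < y from hy)]) measurableSet_Ioi
  have h4 : IntegrableOn (fun y : ℝ => Real.exp (-(b * |y| ^ α))) (Iio 0) := by
    have := IntegrableOn.comp_neg_Iio (c := 0) (f := fun y : ℝ => Real.exp (-(b * |y| ^ α)))
      (by simpa using h3)
    simpa using this
  rw [← integrableOn_univ, ← Iic_union_Ioi (a := (0 : ℝ))]
  exact ((integrableOn_Iic_iff_integrableOn_Iio (by simp)).2 h4).union h3

lemma continuous_one_add_mul_I_cpow :
    Continuous (fun y : ℝ => (1 + y * I : ℂ) ^ (α : ℂ)) := by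
  refine Continuous.cpow (by fun_prop) continuous_const fun y => ?_
  left; simp

/-- The function `exp (- s z ^ α)` on the line `Re z = 1` is integrable. -/
lemma integrable_exp_neg_mul_cpow (h0 : 0 < α) (h1 : α < 1) (hs : 0 < s) :
    Integrable (fun y : ℝ => Complex.exp (-(s * (1 + y * I : ℂ) ^ (α : ℂ)))) := by
  refine (integrable_exp_neg_mul_abs_rpow h0
    (mul_pos hs (cos_mul_pi_div_two_pos h0 h1))).mono' ?_ ?_
  · exact (Complex.continuous_exp.comp
      (continuous_const.mul continuous_one_add_mul_I_cpow).neg).aestronglyMeasurable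
  · refine Eventually.of_forall fun y => (norm_exp_neg_mul_cpow_le h0 h1 hs (by simp)).trans ?_
    rw [Real.exp_le_exp, neg_le_neg_iff]
    refine mul_le_mul_of_nonneg_left ?_ (mul_pos hs (cos_mul_pi_div_two_pos h0 h1)).le
    refine Real.rpow_le_rpow (abs_nonneg _) ?_ h0.le
    simpa using Complex.abs_im_le_norm (1 + y * I)

lemma integrable_inverse_laplace (h0 : 0 < α) (h1 : α < 1) (hs : 0 < s) (l : ℝ) :
    Integrable (fun y : ℝ =>
      Complex.exp ((1 + y * I) * l - s * (1 + y * I : ℂ) ^ (α : ℂ))) := by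
  have h : ∀ y : ℝ, Complex.exp ((1 + y * I) * l - s * (1 + y * I : ℂ) ^ (α : ℂ)) =
      Complex.exp ((1 + y * I) * l) * Complex.exp (-(s * (1 + y * I : ℂ) ^ (α : ℂ))) := fun y => by
    rw [← Complex.exp_add, sub_eq_add_neg]
  simp_rw [h]
  refine (integrable_exp_neg_mul_cpow h0 h1 hs).bdd_mul (c := Real.exp l)
    (by fun_prop) (Eventually.of_forall fun y => ?_)
  rw [Complex.norm_exp]
  simp

lemma inverse_laplace_neg (y : ℝ) :
    (Complex.exp ((1 + (-y : ℝ) * I) * l - s * (1 + (-y : ℝ) * I : ℂ) ^ (α : ℂ))).re =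
      (Complex.exp ((1 + y * I) * l - s * (1 + y * I : ℂ) ^ (α : ℂ))).re := by
  have harg : (1 + y * I : ℂ).arg ≠ Real.pi := by
    intro h
    rw [Complex.arg_eq_pi_iff] at h
    simp at h
    linarith
  have h1 : (1 + (-y : ℝ) * I : ℂ) = conj (1 + y * I : ℂ) := by simp
  have h2 : (conj (1 + y * I : ℂ)) ^ (α : ℂ) = conj ((1 + y * I : ℂ) ^ (α : ℂ)) := by
    have := Complex.conj_cpow (1 + y * I) α harg
    simpa using this
  rw [h1, h2]
  have h3 : conj (1 + y * I : ℂ) * l - s * conj ((1 + y * I : ℂ) ^ (α : ℂ)) =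
      conj ((1 + y * I : ℂ) * l - s * (1 + y * I : ℂ) ^ (α : ℂ)) := by simp
  rw [h3, Complex.exp_conj, Complex.conj_re]

lemma subordDensity_eq_Ioi (h0 : 0 < α) (h1 : α < 1) (hs : 0 < s) (l : ℝ) :
    subordDensity s α l = (∫ y in Ioi (0 : ℝ),
      (Complex.exp ((1 + y * I) * l - s * (1 + y * I : ℂ) ^ (α : ℂ))).re) / Real.pi := by
  have h : (∫ y : ℝ, Complex.exp ((1 + y * I) * l - s * (1 + y * I : ℂ) ^ (α : ℂ))).re =
      ∫ y : ℝ, (Complex.exp ((1 + y * I) * l - s * (1 + y * I : ℂ) ^ (α : ℂ))).re :=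
    (integral_re (integrable_inverse_laplace h0 h1 hs l)).symm
  have h2 := integral_comp_abs (f := fun y : ℝ =>
    (Complex.exp ((1 + y * I) * l - s * (1 + y * I : ℂ) ^ (α : ℂ))).re)
  have h3 : ∀ y : ℝ, (Complex.exp ((1 + (|y| : ℝ) * I) * l -
      s * (1 + (|y| : ℝ) * I : ℂ) ^ (α : ℂ))).re =
      (Complex.exp ((1 + y * I) * l - s * (1 + y * I : ℂ) ^ (α : ℂ))).re := fun y => by
    rcases abs_choice y with hy | hy
    · rw [hy]
    · rw [hy, inverse_laplace_neg]
  simp_rw [h3] at h2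
  rw [subordDensity, h, h2]
  rw [mul_div_mul_left _ _ two_ne_zero]

/-- Far to the right, the primitive varies little on vertical segments between the line
`Re z = 1` and the negative real axis. -/
lemma exists_primitive_vertical_bound (h0 : 0 < α) (h1 : α < 1) (hs : 0 < s) (hl : 0 < l)
    {U : ℂ → ℂ} (hU : ∀ w, HasDerivAt U (Complex.exp (w + stablePhase α s l w)) w) :
    ∃ b : ℝ → ℝ, Tendsto b atTop (𝓝 0) ∧ ∀ R : ℝ, 0 ≤ R →
      ∀ θ₁ ∈ Icc (Real.arccos (Real.exp (-R))) Real.pi,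
      ∀ θ₂ ∈ Icc (Real.arccos (Real.exp (-R))) Real.pi,
        ‖U (R + θ₂ * I) - U (R + θ₁ * I)‖ ≤ b R := by
  -- for angles up to `π / 2 + η` the term `s z ^ α` provides the decay, beyond it the term `z l`
  set η : ℝ := (1 - α) * (Real.pi / 4) with hη
  have hπ := Real.pi_pos
  have hη0 : 0 < η := by have := sub_pos.2 h1; positivity
  have hη1 : η < Real.pi / 2 := by nlinarith
  have hsin : 0 < Real.sin η := Real.sin_pos_of_pos_of_lt_pi hη0 (by linarith)
  set C : ℝ → ℝ := fun R => Real.exp (R + (l - s * Real.sin η * Real.exp (α * R))) +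
    Real.exp (R + (s * Real.exp (α * R) - l * Real.sin η * Real.exp R)) with hC
  refine ⟨fun R => C R * Real.pi, ?_, fun R hR θ₁ h₁ θ₂ h₂ => ?_⟩
  · have t1 : Tendsto (fun R : ℝ => R * Real.exp (-α * R)) atTop (𝓝 0) := by
      simpa using tendsto_rpow_mul_exp_neg_mul_atTop_nhds_zero 1 α h0
    have t2 : Tendsto (fun R : ℝ => Real.exp (-α * R)) atTop (𝓝 0) := by
      simpa using tendsto_rpow_mul_exp_neg_mul_atTop_nhds_zero 0 α h0
    have t3 : Tendsto (fun R : ℝ => R * Real.exp (-1 * R)) atTop (𝓝 0) := by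
      simpa using tendsto_rpow_mul_exp_neg_mul_atTop_nhds_zero 1 1 one_pos
    have t4 : Tendsto (fun R : ℝ => Real.exp (-(1 - α) * R)) atTop (𝓝 0) := by
      simpa using tendsto_rpow_mul_exp_neg_mul_atTop_nhds_zero 0 (1 - α) (by linarith)
    have e1 : Tendsto (fun R : ℝ => Real.exp (α * R)) atTop atTop :=
      Real.tendsto_exp_atTop.comp (tendsto_id.const_mul_atTop h0)
    have m1 : Tendsto (fun R : ℝ => R * Real.exp (-α * R) + l * Real.exp (-α * R) -
        s * Real.sin η) atTop (𝓝 (0 + l * 0 - s * Real.sin η)) :=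
      (t1.add (t2.const_mul l)).sub_const _
    have m2 : Tendsto (fun R : ℝ => R * Real.exp (-1 * R) + s * Real.exp (-(1 - α) * R) -
        l * Real.sin η) atTop (𝓝 (0 + s * 0 - l * Real.sin η)) :=
      (t3.add (t4.const_mul s)).sub_const _
    have n1 := e1.atTop_mul_neg (by simp; positivity) m1
    have n2 := Real.tendsto_exp_atTop.atTop_mul_neg (by simp; positivity) m2
    have f1 : Tendsto (fun R : ℝ => R + (l - s * Real.sin η * Real.exp (α * R))) atTop atBot := by
      refine n1.congr fun R => ?_
      have : Real.exp (α * R) * Real.exp (-α * R) = 1 := by rw [← Real.exp_add]; simp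
      linear_combination (R + l) * this
    have f2 : Tendsto (fun R : ℝ => R + (s * Real.exp (α * R) - l * Real.sin η * Real.exp R))
        atTop atBot := by
      refine n2.congr fun R => ?_
      have g1 : Real.exp R * Real.exp (-1 * R) = 1 := by rw [← Real.exp_add]; simp
      have g2 : Real.exp R * Real.exp (-(1 - α) * R) = Real.exp (α * R) := by
        rw [← Real.exp_add]; congr 1; ring
      linear_combination R * g1 + s * g2
    simpa using ((Real.tendsto_exp_atBot.comp f1).add (Real.tendsto_exp_atBot.comp f2)).mul_const
      Real.pi
  · have hd : ∀ θ ∈ Icc (Real.arccos (Real.exp (-R))) Real.pi, HasDerivWithinAt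
        (fun θ : ℝ => U (R + θ * I))
        (Complex.exp ((R + θ * I) + stablePhase α s l (R + θ * I)) * I)
        (Icc (Real.arccos (Real.exp (-R))) Real.pi) θ := fun θ _ => by
      have := (Complex.ofRealCLM.hasDerivAt (x := θ)).mul_const I |>.const_add (R : ℂ)
      refine HasDerivAt.hasDerivWithinAt ?_
      simpa [Function.comp_def] using! (hU (R + θ * I)).comp θ this
    have hb : ∀ θ ∈ Icc (Real.arccos (Real.exp (-R))) Real.pi,
        ‖Complex.exp ((R + θ * I) + stablePhase α s l (R + θ * I)) * I‖ ≤ C R := fun θ hθ => by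
      have hθ0 : 0 ≤ θ := (Real.arccos_nonneg _).trans hθ.1
      have hcos : Real.cos θ ≤ Real.exp (-R) := by
        have := Real.cos_le_cos_of_nonneg_of_le_pi (Real.arccos_nonneg _) hθ.2 hθ.1
        rwa [Real.cos_arccos (by linarith [Real.exp_pos (-R)])
          (Real.exp_le_one_iff.2 (by linarith))] at this
      have hre : (stablePhase α s l (R + θ * I)).re =
          l * (Real.exp R * Real.cos θ) - s * (Real.exp (α * R) * Real.cos (α * θ)) := by
        have e1 : (α : ℂ) * (R + θ * I) = (α * R : ℝ) + (α * θ : ℝ) * I := by push_cast; ring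
        rw [stablePhase, e1]
        simp [Complex.exp_re]
      rw [norm_mul, Complex.norm_I, mul_one, Complex.norm_exp, Complex.add_re, hre]
      have hR' : (R + θ * I : ℂ).re = R := by simp
      rw [hR']
      have hE := Real.exp_pos R
      have hEa := Real.exp_pos (α * R)
      rcases le_total θ (Real.pi / 2 + η) with h | h
      · refine le_trans ?_ (le_add_of_nonneg_right (Real.exp_pos _).le)
        rw [Real.exp_le_exp]
        have h3 : Real.sin η ≤ Real.cos (α * θ) := by
          rw [← Real.cos_pi_div_two_sub]
          refine Real.cos_le_cos_of_nonneg_of_le_pi (by positivity) (by linarith) ?_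
          calc α * θ ≤ α * (Real.pi / 2 + η) := mul_le_mul_of_nonneg_left h h0.le
            _ ≤ Real.pi / 2 - η := by rw [hη]; nlinarith
        have h4 : Real.exp R * Real.cos θ ≤ 1 := by
          calc Real.exp R * Real.cos θ ≤ Real.exp R * Real.exp (-R) := by gcongr
            _ = 1 := by rw [← Real.exp_add]; simp
        have h5 : Real.exp (α * R) * Real.sin η ≤ Real.exp (α * R) * Real.cos (α * θ) := by
          gcongr
        nlinarith
      · refine le_trans ?_ (le_add_of_nonneg_left (Real.exp_pos _).le)
        rw [Real.exp_le_exp]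
        have h3 : Real.cos θ ≤ -Real.sin η := by
          have : -Real.sin η = Real.cos (Real.pi / 2 + η) := by
            rw [add_comm, Real.cos_add_pi_div_two]
          rw [this]
          exact Real.cos_le_cos_of_nonneg_of_le_pi (by positivity) hθ.2 h
        have h4 : Real.exp R * Real.cos θ ≤ Real.exp R * -Real.sin η := by gcongr
        have h5 : Real.exp (α * R) * -1 ≤ Real.exp (α * R) * Real.cos (α * θ) := by
          gcongr; exact Real.neg_one_le_cos _
        nlinarith
    refine ((convex_Icc _ _).norm_image_sub_le_of_norm_hasDerivWithin_le hd hb h₁ h₂).trans ?_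
    have hC0 : 0 ≤ C R := by positivity
    refine mul_le_mul_of_nonneg_left ?_ hC0
    rw [Real.norm_eq_abs, abs_le]
    have := Real.arccos_nonneg (Real.exp (-R))
    constructor <;> linarith [h₁.1, h₁.2, h₂.1, h₂.2]

end StableDensity

section StableDensity

open Complex (I)
variable {α s l : ℝ}

/-! ### Zolotarev's formula -/

lemma mul_exp_neg_le_one {x : ℝ} (hx : 0 ≤ x) : x * Real.exp (-x) ≤ 1 := by
  have h := Real.add_one_le_exp x
  have h2 : Real.exp x * Real.exp (-x) = 1 := by rw [← Real.exp_add]; simp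
  nlinarith [Real.exp_pos (-x)]

lemma measurable_stableProfile : Measurable (stableProfile α) := by
  unfold stableProfile; fun_prop

lemma measurable_stableExponent : Measurable (stableExponent α s l) :=
  measurable_stableProfile.const_mul _

lemma integrableOn_stableExponent (h0 : 0 < α) (h1 : α < 1) (hs : 0 < s) (hl : 0 < l) :
    IntegrableOn (fun θ => stableExponent α s l θ * Real.exp (-stableExponent α s l θ))
      (Ioo 0 Real.pi) := by
  refine Integrable.mono' (g := fun _ => (1 : ℝ)) (integrableOn_const (by simp)) ?_ ?_
  · exact (measurable_stableExponent.mul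
      (Real.measurable_exp.comp measurable_stableExponent.neg)).aestronglyMeasurable
  · filter_upwards [ae_restrict_mem measurableSet_Ioo] with θ hθ
    have := (stableExponent_pos h0 h1 hs hl hθ).le
    rw [Real.norm_of_nonneg (mul_nonneg this (Real.exp_pos _).le)]
    exact mul_exp_neg_le_one this

/-- The radius of the curve has a limit where the curve leaves the positive real axis. -/
lemma tendsto_stableRadius_zero (h0 : 0 < α) (hs : 0 < s) (hl : 0 < l) :
    Tendsto (stableRadius α s l) (𝓝[>] 0) (𝓝 (1 / (1 - α) * Real.log (s * α / l))) := by
  have hd : ∀ c : ℝ, Tendsto (fun θ : ℝ => Real.sin (c * θ) / θ) (𝓝[>] 0) (𝓝 c) := fun c => by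
    have h : HasDerivAt (fun θ : ℝ => Real.sin (c * θ)) c 0 := by
      simpa using ((hasDerivAt_id (0 : ℝ)).const_mul c).sin
    have := (hasDerivAt_iff_tendsto_slope.1 h).mono_left
      (nhdsWithin_mono 0 (fun x (hx : 0 < x) => hx.ne'))
    refine this.congr fun θ => ?_
    simp [slope_def_field]
  have h2 : Tendsto (fun θ : ℝ => s * Real.sin (α * θ) / (l * Real.sin θ)) (𝓝[>] 0)
      (𝓝 (s * α / (l * 1))) := by
    have h3 := ((hd α).const_mul s).div ((hd 1).const_mul l) (by simpa using hl.ne')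
    refine h3.congr' ?_
    filter_upwards [self_mem_nhdsWithin] with θ hθ
    have : θ ≠ 0 := (show 0 < θ from hθ).ne'
    simp only [one_mul, Pi.div_apply]
    field_simp
  rw [mul_one] at h2
  exact ((Real.continuousAt_log (by positivity)).tendsto.comp h2).const_mul _

/-- The curve runs to infinity along the negative real axis. -/
lemma tendsto_stableRadius_pi (h0 : 0 < α) (h1 : α < 1) (hs : 0 < s) (hl : 0 < l) :
    Tendsto (stableRadius α s l) (𝓝[<] Real.pi) atTop := by
  refine Tendsto.const_mul_atTop (by have := sub_pos.2 h1; positivity)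
    (Real.tendsto_log_atTop.comp ?_)
  have h2 : Tendsto (fun θ : ℝ => s * Real.sin (α * θ)) (𝓝[<] Real.pi)
      (𝓝 (s * Real.sin (α * Real.pi))) :=
    (Continuous.tendsto (by fun_prop) _).mono_left nhdsWithin_le_nhds
  have h3 : Tendsto (fun θ : ℝ => l * Real.sin θ) (𝓝[<] Real.pi) (𝓝[>] 0) := by
    refine tendsto_nhdsWithin_iff.2 ⟨?_, ?_⟩
    · have : Tendsto (fun θ : ℝ => l * Real.sin θ) (𝓝 Real.pi) (𝓝 (l * Real.sin Real.pi)) :=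
        Continuous.tendsto (by fun_prop) _
      rw [Real.sin_pi, mul_zero] at this
      exact this.mono_left nhdsWithin_le_nhds
    · filter_upwards [Ioo_mem_nhdsLT Real.pi_pos] with θ hθ
      exact mul_pos hl (Real.sin_pos_of_pos_of_lt_pi hθ.1 hθ.2)
  have h4 : 0 < s * Real.sin (α * Real.pi) :=
    mul_pos hs (Real.sin_pos_of_pos_of_lt_pi (by positivity) (by nlinarith [Real.pi_pos]))
  simpa [div_eq_mul_inv] using h2.pos_mul_atTop h4 h3.inv_tendsto_nhdsGT_zero

lemma primitive_curve_im (h0 : 0 < α) (h1 : α < 1) (hs : 0 < s) (hl : 0 < l) {U : ℂ → ℂ}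
    (hU : ∀ w, HasDerivAt U (Complex.exp (w + stablePhase α s l w)) w)
    (hU0 : ∀ x : ℝ, (U x).im = 0) {θ : ℝ} (hθ : θ ∈ Ioo 0 Real.pi) :
    (U (stableRadius α s l θ + θ * I)).im = α / ((1 - α) * l) *
      ∫ x in Ioo 0 θ, stableExponent α s l x * Real.exp (-stableExponent α s l x) := by
  have hcont : Tendsto (fun θ : ℝ => (U (stableRadius α s l θ + θ * I)).im) (𝓝[>] 0) (𝓝 0) := by
    have h2 : Tendsto (fun θ : ℝ => (stableRadius α s l θ + θ * I : ℂ)) (𝓝[>] 0)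
        (𝓝 (((1 / (1 - α) * Real.log (s * α / l) : ℝ) : ℂ) + ((0 : ℝ) : ℂ) * I)) := by
      refine ((Complex.continuous_ofReal.tendsto _).comp (tendsto_stableRadius_zero h0 hs hl)).add
        (((Complex.continuous_ofReal.tendsto 0).mono_left nhdsWithin_le_nhds).mul_const I)
    rw [Complex.ofReal_zero, zero_mul, add_zero] at h2
    have h3 := (Complex.continuous_im.tendsto _).comp
      (((hU ((1 / (1 - α) * Real.log (s * α / l) : ℝ) : ℂ)).continuousAt.tendsto).comp h2)
    rwa [hU0] at h3
  have hint := (integrableOn_stableExponent h0 h1 hs hl).mono_set (Ioo_subset_Ioo_right hθ.2.le)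
  have hint' : IntervalIntegrable (fun x => α / ((1 - α) * l) *
      (stableExponent α s l x * Real.exp (-stableExponent α s l x))) volume 0 θ := by
    rw [intervalIntegrable_iff_integrableOn_Ioo_of_le hθ.1.le]
    exact hint.const_mul _
  have hc' : Tendsto (fun θ : ℝ => (U (stableRadius α s l θ + θ * I)).im) (𝓝[<] θ)
      (𝓝 (U (stableRadius α s l θ + θ * I)).im) :=
    (hasDerivAt_primitive_curve h0 h1 hs hl hU hθ).continuousAt.tendsto.mono_left
      nhdsWithin_le_nhds
  have h4 := intervalIntegral.integral_eq_sub_of_hasDerivAt_of_tendsto hθ.1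
    (fun x hx => hasDerivAt_primitive_curve h0 h1 hs hl hU ⟨hx.1, hx.2.trans hθ.2⟩) hint' hcont hc'
  rw [intervalIntegral.integral_of_le hθ.1.le, integral_Ioc_eq_integral_Ioo,
    integral_const_mul, sub_zero] at h4
  exact h4.symm

/-- **Zolotarev's formula**: on the half line the density is an integral of positive functions. -/
theorem subordDensity_eq (h0 : 0 < α) (h1 : α < 1) (hs : 0 < s) (hl : 0 < l) :
    subordDensity s α l = α / ((1 - α) * l * Real.pi) *
      ∫ θ in Ioo 0 Real.pi, stableExponent α s l θ * Real.exp (-stableExponent α s l θ) := by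
  obtain ⟨U, hU, hU0⟩ := exists_stablePrimitive α s l
  obtain ⟨b, hb, hbU⟩ := exists_primitive_vertical_bound h0 h1 hs hl hU
  set F : ℝ → ℝ := fun y => (Complex.exp ((1 + y * I) * l - s * (1 + y * I : ℂ) ^ (α : ℂ))).re
  have hF : Integrable F := (integrable_inverse_laplace h0 h1 hs l).re
  have hline : ∀ Y : ℝ, (U (Complex.log (1 + Y * I))).im = ∫ y in (0 : ℝ)..Y, F y := fun Y => by
    rw [intervalIntegral.integral_eq_sub_of_hasDerivAt
      (fun y _ => hasDerivAt_primitive_line hU y) hF.intervalIntegrable]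
    have := hU0 0
    simp only [Complex.ofReal_zero] at this
    simp [this]
  -- the point of the line `Re z = 1` with the same modulus as the point `θ` of the curve
  set Y : ℝ → ℝ := fun θ => √(Real.exp (2 * stableRadius α s l θ) - 1)
  have hρ := tendsto_stableRadius_pi h0 h1 hs hl
  have hY : Tendsto Y (𝓝[<] Real.pi) atTop := by
    refine Real.tendsto_sqrt_atTop.comp (tendsto_atTop_add_const_right _ (-1)
      (Real.tendsto_exp_atTop.comp (hρ.const_mul_atTop two_pos)))
  have t1 : Tendsto (fun θ => ∫ y in (0 : ℝ)..Y θ, F y) (𝓝[<] Real.pi)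
      (𝓝 (∫ y in Ioi (0 : ℝ), F y)) :=
    intervalIntegral_tendsto_integral_Ioi 0 hF.integrableOn hY
  have t2 : Tendsto (fun θ => α / ((1 - α) * l) * ∫ x in Ioo 0 θ,
      stableExponent α s l x * Real.exp (-stableExponent α s l x)) (𝓝[<] Real.pi)
      (𝓝 (α / ((1 - α) * l) * ∫ x in Ioo 0 Real.pi,
        stableExponent α s l x * Real.exp (-stableExponent α s l x))) := by
    refine Tendsto.const_mul _ ?_
    have hc := intervalIntegral.continuousWithinAt_primitive (μ := volume) (a := 0) (b₀ := Real.pi)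
      (b₁ := 0) (b₂ := Real.pi)
      (f := fun x => stableExponent α s l x * Real.exp (-stableExponent α s l x)) (by simp) (by
        rw [min_self, max_eq_right Real.pi_pos.le,
          intervalIntegrable_iff_integrableOn_Ioo_of_le Real.pi_pos.le]
        exact integrableOn_stableExponent h0 h1 hs hl)
    have hc2 : Tendsto _ (𝓝[Ioo 0 Real.pi] Real.pi) _ :=
      Tendsto.mono_left hc (nhdsWithin_mono _ Ioo_subset_Icc_self)
    rw [nhdsWithin_Ioo_eq_nhdsLT Real.pi_pos] at hc2
    have e : ∀ θ : ℝ, 0 ≤ θ → ∫ x in (0 : ℝ)..θ,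
        stableExponent α s l x * Real.exp (-stableExponent α s l x) = ∫ x in Ioo 0 θ,
        stableExponent α s l x * Real.exp (-stableExponent α s l x) := fun θ hθ => by
      rw [intervalIntegral.integral_of_le hθ, integral_Ioc_eq_integral_Ioo]
    rw [← e _ Real.pi_pos.le]
    refine hc2.congr' ?_
    filter_upwards [Ioo_mem_nhdsLT Real.pi_pos] with θ hθ using e θ hθ.1.le
  have t3 : Tendsto (fun θ => (∫ y in (0 : ℝ)..Y θ, F y) - α / ((1 - α) * l) * ∫ x in Ioo 0 θ,
      stableExponent α s l x * Real.exp (-stableExponent α s l x)) (𝓝[<] Real.pi) (𝓝 0) := by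
    refine squeeze_zero_norm' ?_ (hb.comp hρ)
    filter_upwards [Ioo_mem_nhdsLT (show Real.pi / 2 < Real.pi by linarith [Real.pi_pos]),
      hρ.eventually_ge_atTop 0] with θ hθ hR
    have hθ' : θ ∈ Ioo 0 Real.pi := ⟨by linarith [Real.pi_pos, hθ.1], hθ.2⟩
    set R := stableRadius α s l θ with hRdef
    have hx0 : 0 < Real.exp (-R) := Real.exp_pos _
    have hx1 : Real.exp (-R) ≤ 1 := Real.exp_le_one_iff.2 (by linarith)
    have hlog : Complex.log (1 + Y θ * I) = R + Real.arccos (Real.exp (-R)) * I := by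
      have : (1 + Y θ * I : ℂ) = Complex.exp (R + Real.arccos (Real.exp (-R)) * I) := by
        have hY' : Y θ = Real.exp R * √(1 - Real.exp (-R) ^ 2) := by
          have : Real.exp R * Real.exp (-R) = 1 := by rw [← Real.exp_add]; simp
          have h2 : Real.exp (2 * R) = Real.exp R ^ 2 := by rw [two_mul, Real.exp_add, sq]
          have h3 : Real.exp (2 * R) - 1 = Real.exp R ^ 2 * (1 - Real.exp (-R) ^ 2) := by
            rw [h2]
            linear_combination (Real.exp R * Real.exp (-R) + 1) * this
          change √(Real.exp (2 * R) - 1) = _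
          rw [h3, Real.sqrt_mul (sq_nonneg _), Real.sqrt_sq (Real.exp_pos R).le]
        apply Complex.ext
        · rw [Complex.exp_re]
          simp [Real.cos_arccos (by linarith) hx1, ← Real.exp_add]
        · rw [Complex.exp_im]
          simp [Real.sin_arccos, hY', Complex.exp_ofReal_re]
      rw [this, Complex.log_exp]
      · simp; linarith [Real.pi_pos, Real.arccos_nonneg (Real.exp (-R))]
      · simp [Real.arccos_le_pi]
    rw [← hline, ← primitive_curve_im h0 h1 hs hl hU hU0 hθ', ← hRdef, hlog, ← Complex.sub_im]
    refine (Complex.abs_im_le_norm _).trans (hbU R hR _ ?_ _ ?_)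
    · exact ⟨((Real.arccos_le_pi_div_two).2 hx0.le).trans hθ.1.le, hθ.2.le⟩
    · exact ⟨le_rfl, Real.arccos_le_pi _⟩
  have h5 := tendsto_nhds_unique (t1.sub t2) t3
  rw [subordDensity_eq_Ioi h0 h1 hs, sub_eq_zero.1 h5]
  have := Real.pi_ne_zero
  field_simp

end StableDensity

section StableDensity

open Complex (I)
variable {α s l : ℝ}

/-! ### The density as an inverse Fourier transform -/

/-- The inverse Laplace integral is real. -/
lemma integral_inverse_laplace (h0 : 0 < α) (h1 : α < 1) (hs : 0 < s) (l : ℝ) :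
    ∫ y : ℝ, Complex.exp ((1 + y * I) * l - s * (1 + y * I : ℂ) ^ (α : ℂ)) =
      ((2 * Real.pi * subordDensity s α l : ℝ) : ℂ) := by
  have him : ∀ y : ℝ,
      (Complex.exp ((1 + (-y : ℝ) * I) * l - s * (1 + (-y : ℝ) * I : ℂ) ^ (α : ℂ))).im =
      -(Complex.exp ((1 + y * I) * l - s * (1 + y * I : ℂ) ^ (α : ℂ))).im := fun y => by
    have harg : (1 + y * I : ℂ).arg ≠ Real.pi := by
      intro h
      rw [Complex.arg_eq_pi_iff] at h
      simp at h
      linarith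
    have h1 : (1 + (-y : ℝ) * I : ℂ) = conj (1 + y * I : ℂ) := by simp
    have h2 : (conj (1 + y * I : ℂ)) ^ (α : ℂ) = conj ((1 + y * I : ℂ) ^ (α : ℂ)) := by
      have := Complex.conj_cpow (1 + y * I) α harg
      simpa using this
    rw [h1, h2]
    have h3 : conj (1 + y * I : ℂ) * l - s * conj ((1 + y * I : ℂ) ^ (α : ℂ)) =
        conj ((1 + y * I : ℂ) * l - s * (1 + y * I : ℂ) ^ (α : ℂ)) := by simp
    rw [h3, Complex.exp_conj, Complex.conj_im]
  have h2 : (∫ y : ℝ, Complex.exp ((1 + y * I) * l - s * (1 + y * I : ℂ) ^ (α : ℂ))).im =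
      ∫ y : ℝ, (Complex.exp ((1 + y * I) * l - s * (1 + y * I : ℂ) ^ (α : ℂ))).im :=
    (integral_im (integrable_inverse_laplace h0 h1 hs l)).symm
  have h3 := integral_neg_eq_self
    (fun y : ℝ => (Complex.exp ((1 + y * I) * l - s * (1 + y * I : ℂ) ^ (α : ℂ))).im) volume
  simp_rw [him] at h3
  rw [integral_neg] at h3
  apply Complex.ext
  · rw [Complex.ofReal_re, subordDensity]
    generalize Complex.re _ = X
    field_simp
  · rw [h2, Complex.ofReal_im]
    linarith

/-- The density vanishes on the negative half line, since the line of integration can be moved to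
the right. -/
lemma subordDensity_of_nonpos (h0 : 0 < α) (h1 : α < 1) (hs : 0 < s) (hl : l ≤ 0) :
    subordDensity s α l = 0 := by
  set f : ℂ → ℂ := fun z => Complex.exp (z * l - s * z ^ (α : ℂ)) with hf
  set b := s * Real.cos (α * (Real.pi / 2)) with hb
  have hb0 : 0 < b := mul_pos hs (cos_mul_pi_div_two_pos h0 h1)
  have hbound : ∀ Y : ℝ, 0 ≤ Y → ∀ z : ℂ, 0 < z.re → Y ≤ ‖z‖ → ‖f z‖ ≤ Real.exp (-(b * Y ^ α)) :=
    fun Y hY z hz hYz => by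
    rw [hf]
    simp only
    rw [sub_eq_add_neg, Complex.exp_add, norm_mul]
    have e1 : ‖Complex.exp (z * l)‖ ≤ 1 := by
      rw [Complex.norm_exp, Real.exp_le_one_iff, Complex.re_mul_ofReal]
      exact mul_nonpos_of_nonneg_of_nonpos hz.le hl
    have e2 := norm_exp_neg_mul_cpow_le h0 h1 hs hz
    calc _ ≤ 1 * Real.exp (-(s * Real.cos (α * (Real.pi / 2)) * ‖z‖ ^ α)) := by gcongr
      _ ≤ _ := by
        rw [one_mul, Real.exp_le_exp, neg_le_neg_iff]
        gcongr
  have hint : Tendsto (fun Y : ℝ => ∫ y in (-Y)..Y, f (1 + y * I)) atTop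
      (𝓝 (∫ y : ℝ, f (1 + y * I))) :=
    intervalIntegral_tendsto_integral (integrable_inverse_laplace h0 h1 hs l)
      tendsto_neg_atTop_atBot tendsto_id
  have hzero : Tendsto (fun Y : ℝ => ∫ y in (-Y)..Y, f (1 + y * I)) atTop (𝓝 0) := by
    have hlim : Tendsto (fun Y : ℝ => 4 * (Y * Real.exp (-(b * Y ^ α)))) atTop (𝓝 0) := by
      have h2 := (tendsto_rpow_mul_exp_neg_mul_atTop_nhds_zero (1 / α) b hb0).comp
        (tendsto_rpow_atTop h0)
      rw [← mul_zero (4 : ℝ)]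
      refine (h2.congr' ?_).const_mul 4
      filter_upwards [eventually_ge_atTop 0] with Y hY
      simp only [Function.comp]
      rw [← Real.rpow_mul hY, mul_one_div_cancel h0.ne', Real.rpow_one, neg_mul]
    refine squeeze_zero_norm' ?_ hlim
    filter_upwards [eventually_ge_atTop 0] with Y hY
    have hrect := Complex.integral_boundary_rect_eq_zero_of_differentiableOn f
      (1 + (-Y : ℝ) * I) ((1 + Y : ℝ) + Y * I) (by
        intro z hz
        have hre : 0 < z.re := by
          have h3 := hz.1
          simp only [Complex.add_re, Complex.one_re, Complex.mul_re, Complex.ofReal_re,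
            Complex.I_re, mul_zero, Complex.ofReal_im, zero_mul, sub_zero, add_zero,
            Complex.I_im, mem_preimage] at h3
          rw [uIcc_of_le (by linarith)] at h3
          linarith [h3.1]
        refine DifferentiableAt.differentiableWithinAt ?_
        refine DifferentiableAt.cexp (DifferentiableAt.sub (by fun_prop)
          (DifferentiableAt.const_mul ?_ _))
        exact DifferentiableAt.cpow (by fun_prop) (by fun_prop) (Or.inl hre))
    simp only [Complex.add_re, Complex.one_re, Complex.mul_re, Complex.ofReal_re,
      Complex.I_re, mul_zero, Complex.ofReal_im, sub_zero, add_zero,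
      Complex.I_im, Complex.add_im, Complex.one_im, Complex.mul_im, mul_one, zero_add,
      smul_eq_mul, Complex.ofReal_one] at hrect
    set E := Real.exp (-(b * Y ^ α))
    have n1 : ‖∫ x in (1 : ℝ)..(1 + Y), f (x + (-Y : ℝ) * I)‖ ≤ E * |1 + Y - 1| := by
      refine intervalIntegral.norm_integral_le_of_norm_le_const fun x hx => ?_
      rw [uIoc_of_le (by linarith)] at hx
      refine hbound Y hY _ (by simp; linarith [hx.1]) ?_
      refine le_trans ?_ (Complex.abs_im_le_norm _)
      simp [le_abs_self]
    have n2 : ‖∫ x in (1 : ℝ)..(1 + Y), f (x + (Y : ℝ) * I)‖ ≤ E * |1 + Y - 1| := by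
      refine intervalIntegral.norm_integral_le_of_norm_le_const fun x hx => ?_
      rw [uIoc_of_le (by linarith)] at hx
      refine hbound Y hY _ (by simp; linarith [hx.1]) ?_
      refine le_trans ?_ (Complex.abs_im_le_norm _)
      simp [le_abs_self]
    have n3 : ‖∫ y in (-Y)..Y, f ((1 + Y : ℝ) + y * I)‖ ≤ E * |Y - (-Y)| := by
      refine intervalIntegral.norm_integral_le_of_norm_le_const fun x hx => ?_
      refine hbound Y hY _ (by simp; linarith) ?_
      refine le_trans ?_ (Complex.abs_re_le_norm _)
      simp
      exact le_abs.2 (Or.inl (by linarith))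
    have h5 : ∫ y in (-Y)..Y, f (1 + y * I) = -I * ((∫ x in (1 : ℝ)..(1 + Y), f (x + (-Y : ℝ) * I))
        - ∫ x in (1 : ℝ)..(1 + Y), f (x + (Y : ℝ) * I)) +
          ∫ y in (-Y)..Y, f ((1 + Y : ℝ) + y * I) := by
      linear_combination I * hrect +
        ((∫ y in (-Y)..Y, f (1 + y * I)) - ∫ y in (-Y)..Y, f ((1 + Y : ℝ) + y * I)) * Complex.I_sq
    rw [h5]
    refine (norm_add_le _ _).trans ?_
    rw [norm_mul, norm_neg, Complex.norm_I, one_mul]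
    have := norm_sub_le (∫ x in (1 : ℝ)..(1 + Y), f (x + (-Y : ℝ) * I))
      (∫ x in (1 : ℝ)..(1 + Y), f (x + (Y : ℝ) * I))
    have a1 : |1 + Y - 1| = Y := by rw [add_sub_cancel_left, abs_of_nonneg hY]
    have a2 : |Y - -Y| = 2 * Y := by rw [sub_neg_eq_add, ← two_mul, abs_of_nonneg (by linarith)]
    rw [a1] at n1 n2
    rw [a2] at n3
    linarith
  have h6 := tendsto_nhds_unique hint hzero
  have h7 := integral_inverse_laplace h0 h1 hs l
  have h8 : ((2 * Real.pi * subordDensity s α l : ℝ) : ℂ) = 0 := h7.symm.trans h6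
  have h9 : 2 * Real.pi * subordDensity s α l = 0 := by exact_mod_cast h8
  have := Real.pi_ne_zero
  simpa [this] using h9

/-- `e^{-l}` times the density is an inverse Fourier transform. -/
lemma fourierInv_exp_neg_mul_cpow (h0 : 0 < α) (h1 : α < 1) (hs : 0 < s) (l : ℝ) :
    FourierTransformInv.fourierInv
      (fun x : ℝ => Complex.exp (-(s * (1 + (2 * Real.pi * x : ℝ) * I : ℂ) ^ (α : ℂ)))) l =
      ((Real.exp (-l) * subordDensity s α l : ℝ) : ℂ) := by
  have hπ := Real.pi_pos
  rw [Real.fourierInv_eq']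
  have e : ∀ x : ℝ, Complex.exp (((2 * Real.pi * inner ℝ x l : ℝ) : ℂ) * I) •
      Complex.exp (-(s * (1 + (2 * Real.pi * x : ℝ) * I : ℂ) ^ (α : ℂ))) =
      (fun y : ℝ => Complex.exp (-l) * Complex.exp ((1 + y * I) * l -
        s * (1 + y * I : ℂ) ^ (α : ℂ))) (2 * Real.pi * x) := fun x => by
    simp only [smul_eq_mul, ← Complex.exp_add]
    congr 1
    simp
    ring
  simp_rw [e]
  rw [Measure.integral_comp_mul_left (fun y : ℝ => Complex.exp (-l) *
    Complex.exp ((1 + y * I) * l - s * (1 + y * I : ℂ) ^ (α : ℂ))), integral_const_mul,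
    integral_inverse_laplace h0 h1 hs l]
  rw [abs_of_pos (by positivity)]
  simp only [Complex.real_smul]
  push_cast
  field_simp

end StableDensity

section StableDensity

open Complex (I)
variable {α s l : ℝ}

/-! ### Positivity, mass and time dependence of the density -/

lemma measurable_subordDensity (s α : ℝ) : Measurable (subordDensity s α) := by
  have h : Measurable (Function.uncurry fun l y : ℝ =>
      Complex.exp ((1 + y * I) * l - s * (1 + y * I) ^ (α : ℂ))) := by
    unfold Function.uncurry; fun_prop
  exact (Complex.measurable_re.comp
    (h.stronglyMeasurable.integral_prod_right (ν := volume)).measurable).div_const _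

/-- The derivative of the density with respect to the time `s`. -/
def subordDensityDeriv (s α l : ℝ) : ℝ :=
  α / ((1 - α) * l * Real.pi) * ∫ θ in Ioo 0 Real.pi, 1 / (1 - α) / s *
    (1 - stableExponent α s l θ) * (stableExponent α s l θ * Real.exp (-stableExponent α s l θ))

lemma measurable_subordDensityDeriv (s α : ℝ) : Measurable (subordDensityDeriv s α) := by
  have h1 : Measurable (Function.uncurry fun l θ : ℝ => stableExponent α s l θ) := by
    unfold Function.uncurry stableExponent stableProfile
    fun_prop
  have h : Measurable (Function.uncurry fun l θ : ℝ => 1 / (1 - α) / s *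
    (1 - stableExponent α s l θ) *
      (stableExponent α s l θ * Real.exp (-stableExponent α s l θ))) := by
    unfold Function.uncurry at h1 ⊢
    fun_prop
  have h3 := (h.stronglyMeasurable.integral_prod_right
    (ν := volume.restrict (Ioo 0 Real.pi))).measurable
  unfold subordDensityDeriv
  fun_prop

lemma subordDensity_nonneg (h0 : 0 < α) (h1 : α < 1) (hs : 0 < s) (l : ℝ) :
    0 ≤ subordDensity s α l := by
  rcases le_or_gt l 0 with hl | hl
  · rw [subordDensity_of_nonpos h0 h1 hs hl]
  · rw [subordDensity_eq h0 h1 hs hl]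
    have := sub_pos.2 h1
    have := Real.pi_pos
    refine mul_nonneg (by positivity) (setIntegral_nonneg measurableSet_Ioo fun θ hθ => ?_)
    exact mul_nonneg (stableExponent_pos h0 h1 hs hl hθ).le (Real.exp_pos _).le

lemma stableExponent_eq (hs : 0 < s) (hl : 0 < l) (θ : ℝ) :
    stableExponent α s l θ =
      s ^ (1 / (1 - α)) * (l * l⁻¹ ^ (1 / (1 - α)) * stableProfile α θ) := by
  rw [stableExponent, div_eq_mul_inv, Real.mul_rpow hs.le (by positivity)]
  ring

/-- The density has total mass one: with `θ` fixed, the integrand is an exact derivative. -/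
lemma lintegral_subordDensity (h0 : 0 < α) (h1 : α < 1) (hs : 0 < s) :
    ∫⁻ u in Ioi 0, ENNReal.ofReal (subordDensity s α u) = 1 := by
  have hα := sub_pos.2 h1
  have hπ := Real.pi_pos
  have hpos : ∀ u ∈ Ioi (0 : ℝ), ∀ θ ∈ Ioo 0 Real.pi, 0 ≤ α / ((1 - α) * u) *
      (stableExponent α s u θ * Real.exp (-stableExponent α s u θ)) := fun u hu θ hθ => by
    have := stableExponent_pos h0 h1 hs hu hθ
    have : 0 < u := hu
    positivity
  have e1 : ∀ u ∈ Ioi (0 : ℝ), ENNReal.ofReal (subordDensity s α u) =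
      ∫⁻ θ in Ioo 0 Real.pi, ENNReal.ofReal (1 / Real.pi) * ENNReal.ofReal (α / ((1 - α) * u) *
        (stableExponent α s u θ * Real.exp (-stableExponent α s u θ))) := fun u hu => by
    rw [lintegral_const_mul' _ _ (by simp), ← ofReal_integral_eq_lintegral_ofReal
      ((integrableOn_stableExponent h0 h1 hs hu).const_mul _)
      ((ae_restrict_mem measurableSet_Ioo).mono fun θ hθ => hpos u hu θ hθ),
      ← ENNReal.ofReal_mul (by positivity), subordDensity_eq h0 h1 hs hu, integral_const_mul]
    congr 1
    have : u ≠ 0 := (show 0 < u from hu).ne'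
    field_simp
  have hmeas : Measurable (Function.uncurry fun u θ : ℝ => ENNReal.ofReal (1 / Real.pi) *
      ENNReal.ofReal (α / ((1 - α) * u) *
        (stableExponent α s u θ * Real.exp (-stableExponent α s u θ)))) := by
    unfold Function.uncurry stableExponent stableProfile
    fun_prop
  rw [setLIntegral_congr_fun measurableSet_Ioi e1, lintegral_lintegral_swap hmeas.aemeasurable]
  have e2 : ∀ θ ∈ Ioo 0 Real.pi, ∫⁻ u in Ioi 0, ENNReal.ofReal (1 / Real.pi) *
      ENNReal.ofReal (α / ((1 - α) * u) *
        (stableExponent α s u θ * Real.exp (-stableExponent α s u θ))) =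
      ENNReal.ofReal (1 / Real.pi) := fun θ hθ => by
    set C := s ^ (1 / (1 - α)) * stableProfile α θ with hC
    have hC0 : 0 < C := mul_pos (Real.rpow_pos_of_pos hs _) (stableProfile_pos h0 h1 hθ)
    set γ := α / (1 - α) with hγ
    have hγ0 : 0 < γ := by positivity
    have hE : ∀ u : ℝ, 0 < u → stableExponent α s u θ = C * u ^ (-γ) := fun u hu => by
      rw [stableExponent_eq hs hu, hC]
      have : u * u⁻¹ ^ (1 / (1 - α)) = u ^ (-γ) := by
        rw [Real.inv_rpow hu.le, ← Real.rpow_neg hu.le]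
        nth_rewrite 1 [← Real.rpow_one u]
        rw [← Real.rpow_add hu]
        congr 1
        rw [hγ]; field_simp; ring
      rw [this]; ring
    set g : ℝ → ℝ := fun u => if 0 < u then Real.exp (-(C * u ^ (-γ))) else 0 with hg
    have hderiv : ∀ u ∈ Ioi (0 : ℝ), HasDerivAt g (α / ((1 - α) * u) *
        (stableExponent α s u θ * Real.exp (-stableExponent α s u θ))) u := fun u hu => by
      have hu0 : 0 < u := hu
      have h3 := (((Real.hasDerivAt_rpow_const (p := -γ) (Or.inl hu0.ne')).const_mul C).neg).exp
      have h4 : HasDerivAt (fun u : ℝ => Real.exp (-(C * u ^ (-γ)))) (α / ((1 - α) * u) *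
        (stableExponent α s u θ * Real.exp (-stableExponent α s u θ))) u := by
        convert! h3 using 1
        rw [hE u hu0, Real.rpow_sub_one hu0.ne']
        simp only [hγ, Pi.neg_apply]
        field_simp
      refine h4.congr_of_eventuallyEq ?_
      filter_upwards [isOpen_Ioi.mem_nhds hu] with x hx
      exact if_pos hx
    have hg0 : g 0 = 0 := by simp [hg]
    have hcont : ContinuousWithinAt g (Ici 0) 0 := by
      rw [← continuousWithinAt_Ioi_iff_Ici, ContinuousWithinAt, hg0]
      have h5 : Tendsto (fun u : ℝ => Real.exp (-(C * u ^ (-γ)))) (𝓝[>] 0) (𝓝 0) :=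
        Real.tendsto_exp_neg_atTop_nhds_zero.comp
          ((tendsto_rpow_neg_nhdsGT_zero (y := -γ) (by linarith)).const_mul_atTop hC0)
      refine h5.congr' ?_
      filter_upwards [self_mem_nhdsWithin] with u hu
      exact (if_pos hu).symm
    have htop : Tendsto g atTop (𝓝 1) := by
      have h5 : Tendsto (fun u : ℝ => Real.exp (-(C * u ^ (-γ)))) atTop (𝓝 (Real.exp (-(C * 0)))) :=
        (Real.continuous_exp.tendsto _).comp ((tendsto_rpow_neg_atTop hγ0).const_mul C).neg
      rw [mul_zero, neg_zero, Real.exp_zero] at h5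
      refine h5.congr' ?_
      filter_upwards [eventually_gt_atTop 0] with u hu
      exact (if_pos hu).symm
    have hp := fun u hu => hpos u hu θ hθ
    have i1 := integrableOn_Ioi_deriv_of_nonneg hcont hderiv hp htop
    have i2 := integral_Ioi_of_hasDerivAt_of_nonneg hcont hderiv hp htop
    rw [lintegral_const_mul' _ _ (by simp), ← ofReal_integral_eq_lintegral_ofReal i1
      ((ae_restrict_mem measurableSet_Ioi).mono hp), i2, hg0]
    simp
  rw [setLIntegral_congr_fun measurableSet_Ioo e2, setLIntegral_const, Real.volume_Ioo, sub_zero,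
    ← ENNReal.ofReal_mul (by positivity)]
  rw [one_div_mul_cancel hπ.ne', ENNReal.ofReal_one]

lemma integrableOn_subordDensity (h0 : 0 < α) (h1 : α < 1) (hs : 0 < s) :
    IntegrableOn (subordDensity s α) (Ioi 0) := by
  refine ⟨(measurable_subordDensity s α).aestronglyMeasurable, ?_⟩
  rw [hasFiniteIntegral_iff_ofReal (Eventually.of_forall (subordDensity_nonneg h0 h1 hs)),
    lintegral_subordDensity h0 h1 hs]
  exact ENNReal.one_lt_top

lemma integral_subordDensity (h0 : 0 < α) (h1 : α < 1) (hs : 0 < s) :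
    ∫ u in Ioi 0, subordDensity s α u = 1 := by
  rw [integral_eq_lintegral_of_nonneg_ae (Eventually.of_forall (subordDensity_nonneg h0 h1 hs))
    (measurable_subordDensity s α).aestronglyMeasurable, lintegral_subordDensity h0 h1 hs]
  simp

/-- The densities are quasi-decreasing in time. -/
lemma subordDensity_le (h0 : 0 < α) (h1 : α < 1) {t : ℝ} (hs : 0 < s) (hst : s ≤ t) (hl : 0 < l) :
    subordDensity t α l ≤ (t / s) ^ (1 / (1 - α)) * subordDensity s α l := by
  have hα := sub_pos.2 h1
  have hπ := Real.pi_pos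
  have ht : 0 < t := hs.trans_le hst
  rw [subordDensity_eq h0 h1 hs hl, subordDensity_eq h0 h1 ht hl, mul_left_comm,
    ← integral_const_mul ((t / s) ^ (1 / (1 - α)))]
  refine mul_le_mul_of_nonneg_left ?_ (by positivity)
  refine setIntegral_mono_on (integrableOn_stableExponent h0 h1 ht hl)
    ((integrableOn_stableExponent h0 h1 hs hl).const_mul _) measurableSet_Ioo fun θ hθ => ?_
  have hle : stableExponent α s l θ ≤ stableExponent α t l θ := by
    rw [stableExponent_eq hs hl, stableExponent_eq ht hl]
    have := stableProfile_pos h0 h1 hθ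
    gcongr
  have heq : stableExponent α t l θ = (t / s) ^ (1 / (1 - α)) * stableExponent α s l θ := by
    rw [stableExponent_eq hs hl, stableExponent_eq ht hl, Real.div_rpow ht.le hs.le]
    have := Real.rpow_pos_of_pos hs (1 / (1 - α))
    field_simp
  have h3 := (stableExponent_pos h0 h1 hs hl hθ).le
  calc _ = (t / s) ^ (1 / (1 - α)) * (stableExponent α s l θ *
        Real.exp (-stableExponent α t l θ)) := by rw [← mul_assoc, ← heq]
    _ ≤ _ := by gcongr

lemma abs_one_sub_mul_exp_le {x : ℝ} (hx : 0 ≤ x) : |1 - x| * Real.exp (-(x / 2)) ≤ 1 := by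
  have h := Real.add_one_le_exp (x / 4)
  have h2 : Real.exp (x / 2) = Real.exp (x / 4) ^ 2 := by rw [sq, ← Real.exp_add]; congr 1; ring
  have h3 : Real.exp (x / 2) * Real.exp (-(x / 2)) = 1 := by rw [← Real.exp_add]; simp
  have h4 : |1 - x| ≤ Real.exp (x / 2) := by
    rw [h2, abs_le]
    constructor <;> nlinarith [sq_nonneg (x - 4)]
  calc _ ≤ Real.exp (x / 2) * Real.exp (-(x / 2)) := by gcongr
    _ = 1 := h3

/-- The time derivative of the integrand in Zolotarev's formula is dominated by twice the
integrand at the earlier time at which the exponent is halved. -/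
lemma abs_stable_deriv_le {x : ℝ} (hx : 0 ≤ x) :
    |(1 - x) * (x * Real.exp (-x))| ≤ 2 * (x / 2 * Real.exp (-(x / 2))) := by
  have h := abs_one_sub_mul_exp_le hx
  have h2 : Real.exp (-x) = Real.exp (-(x / 2)) * Real.exp (-(x / 2)) := by
    rw [← Real.exp_add]; congr 1; ring
  rw [abs_mul, abs_of_nonneg (a := x * Real.exp (-x)) (by positivity), h2]
  have h3 : 0 ≤ x * Real.exp (-(x / 2)) := by positivity
  nlinarith

/-- The ratio of the two times in `abs_subordDensityDeriv_le`. -/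
def timeRatio (α : ℝ) : ℝ := (1 / 2 : ℝ) ^ (1 - α)

lemma timeRatio_pos (α : ℝ) : 0 < timeRatio α := by unfold timeRatio; positivity

lemma half_le_timeRatio (h0 : 0 < α) : 1 / 2 ≤ timeRatio α := by
  have := Real.rpow_le_rpow_of_exponent_ge (x := 1 / 2) (by norm_num) (by norm_num)
    (show 1 - α ≤ 1 by linarith)
  simpa [timeRatio] using this

lemma timeRatio_le_one (h1 : α < 1) : timeRatio α ≤ 1 :=
  Real.rpow_le_one (by norm_num) (by norm_num) (by linarith)

lemma stableExponent_timeRatio (h1 : α < 1) (hs : 0 < s) (hl : 0 < l) (θ : ℝ) :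
    stableExponent α (timeRatio α * s) l θ = stableExponent α s l θ / 2 := by
  have h2 : timeRatio α ^ (1 / (1 - α)) = 1 / 2 := by
    rw [timeRatio, ← Real.rpow_mul (by norm_num), mul_one_div_cancel (by linarith), Real.rpow_one]
  rw [stableExponent_eq hs hl, stableExponent_eq (mul_pos (timeRatio_pos α) hs) hl,
    Real.mul_rpow (timeRatio_pos α).le hs.le, h2]
  ring

lemma integrableOn_stable_deriv (h0 : 0 < α) (h1 : α < 1) (hs : 0 < s) (hl : 0 < l) :
    IntegrableOn (fun θ => 1 / (1 - α) / s * (1 - stableExponent α s l θ) *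
      (stableExponent α s l θ * Real.exp (-stableExponent α s l θ))) (Ioo 0 Real.pi) := by
  have hα := sub_pos.2 h1
  refine Integrable.mono' (g := fun _ => 1 / (1 - α) / s * 2) (integrableOn_const (by simp)) ?_ ?_
  · have := measurable_stableExponent (α := α) (s := s) (l := l)
    exact Measurable.aestronglyMeasurable (by fun_prop)
  · filter_upwards [ae_restrict_mem measurableSet_Ioo] with θ hθ
    have h := (stableExponent_pos h0 h1 hs hl hθ).le
    rw [mul_assoc, Real.norm_eq_abs, abs_mul, abs_of_pos (a := 1 / (1 - α) / s) (by positivity)]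
    refine mul_le_mul_of_nonneg_left ((abs_stable_deriv_le h).trans ?_) (by positivity)
    have := mul_exp_neg_le_one (x := stableExponent α s l θ / 2) (by positivity)
    linarith

/-- The derivative of the density in time is controlled by the density at a comparable time. -/
lemma abs_subordDensityDeriv_le (h0 : 0 < α) (h1 : α < 1) (hs : 0 < s) (hl : 0 < l) :
    |subordDensityDeriv s α l| ≤ 2 * (1 / (1 - α)) / s * subordDensity (timeRatio α * s) α l := by
  have hα := sub_pos.2 h1
  have hπ := Real.pi_pos
  have hs' := mul_pos (timeRatio_pos α) hs
  rw [subordDensity_eq h0 h1 hs' hl, subordDensityDeriv, abs_mul,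
    abs_of_pos (a := α / ((1 - α) * l * Real.pi)) (by positivity), mul_left_comm,
    ← integral_const_mul (2 * (1 / (1 - α)) / s)]
  refine mul_le_mul_of_nonneg_left ?_ (by positivity)
  refine (abs_integral_le_integral_abs).trans ?_
  refine setIntegral_mono_on (integrableOn_stable_deriv h0 h1 hs hl).abs
    ((integrableOn_stableExponent h0 h1 hs' hl).const_mul _) measurableSet_Ioo fun θ hθ => ?_
  rw [stableExponent_timeRatio h1 hs hl, mul_assoc, abs_mul,
    abs_of_pos (a := 1 / (1 - α) / s) (by positivity)]
  have := mul_le_mul_of_nonneg_left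
    (abs_stable_deriv_le (stableExponent_pos h0 h1 hs hl hθ).le)
    (show 0 ≤ 1 / (1 - α) / s by positivity)
  refine this.trans (le_of_eq ?_)
  ring

lemma hasDerivAt_subordDensity (h0 : 0 < α) (h1 : α < 1) (hs : 0 < s) (hl : 0 < l) :
    HasDerivAt (fun t => subordDensity t α l) (subordDensityDeriv s α l) s := by
  have hα := sub_pos.2 h1
  have hmem : Ioi (s / 2) ∈ 𝓝 s := isOpen_Ioi.mem_nhds (by simp [hs])
  have key := hasDerivAt_integral_of_dominated_loc_of_deriv_le
    (μ := volume.restrict (Ioo 0 Real.pi)) (x₀ := s) (s := Ioi (s / 2))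
    (F := fun t θ => stableExponent α t l θ * Real.exp (-stableExponent α t l θ))
    (F' := fun t θ => 1 / (1 - α) / t * (1 - stableExponent α t l θ) *
      (stableExponent α t l θ * Real.exp (-stableExponent α t l θ)))
    (bound := fun _ => 1 / (1 - α) / (s / 2) * 2) hmem
    (Eventually.of_forall fun t => by
      have := measurable_stableExponent (α := α) (s := t) (l := l)
      exact Measurable.aestronglyMeasurable (by fun_prop))
    (integrableOn_stableExponent h0 h1 hs hl)
    (by
      have := measurable_stableExponent (α := α) (s := s) (l := l)
      exact Measurable.aestronglyMeasurable (by fun_prop))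
    (by
      filter_upwards [ae_restrict_mem measurableSet_Ioo] with θ hθ t ht
      have ht0 : 0 < t := lt_trans (by positivity) ht
      have h := (stableExponent_pos h0 h1 ht0 hl hθ).le
      rw [mul_assoc, Real.norm_eq_abs, abs_mul, abs_of_pos (a := 1 / (1 - α) / t) (by positivity)]
      have h3 := mul_exp_neg_le_one (x := stableExponent α t l θ / 2) (by positivity)
      have h4 := abs_stable_deriv_le h
      have h5 : 1 / (1 - α) / t ≤ 1 / (1 - α) / (s / 2) := by
        have : s / 2 ≤ t := le_of_lt ht
        gcongr
      exact mul_le_mul h5 (by linarith) (abs_nonneg _) (by positivity))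
    (integrableOn_const (by simp))
    (by
      filter_upwards [ae_restrict_mem measurableSet_Ioo] with θ hθ t ht
      have ht0 : 0 < t := lt_trans (by positivity) ht
      have hE : HasDerivAt (fun t => stableExponent α t l θ)
          (1 / (1 - α) / t * stableExponent α t l θ) t := by
        have h5 := (Real.hasDerivAt_rpow_const (x := t) (p := 1 / (1 - α))
          (Or.inl ht0.ne')).mul_const (l * l⁻¹ ^ (1 / (1 - α)) * stableProfile α θ)
        refine HasDerivAt.congr_of_eventuallyEq (f := fun t => t ^ (1 / (1 - α)) *
          (l * l⁻¹ ^ (1 / (1 - α)) * stableProfile α θ)) ?_ ?_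
        · convert! h5 using 1
          rw [stableExponent_eq ht0 hl, Real.rpow_sub_one ht0.ne']
          field_simp
        · filter_upwards [isOpen_Ioi.mem_nhds ht0] with x hx using stableExponent_eq hx hl θ
      convert! hE.mul hE.neg.exp using 1
      simp only [Pi.neg_apply]
      ring)
  refine HasDerivAt.congr_of_eventuallyEq (f := fun t => α / ((1 - α) * l * Real.pi) *
    ∫ θ in Ioo 0 Real.pi, stableExponent α t l θ * Real.exp (-stableExponent α t l θ))
    (key.2.const_mul _) ?_
  filter_upwards [isOpen_Ioi.mem_nhds hs] with t ht using subordDensity_eq h0 h1 ht hl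

end StableDensity

section StableDensity

open Complex (I)
open scoped FourierTransform
variable {α s l : ℝ}

/-! ### The densities form a convolution semigroup -/

/-- The Laplace transform of the density on the line `Re z = 1`. -/
lemma integral_exp_mul_subordDensity (h0 : 0 < α) (h1 : α < 1) (hs : 0 < s) (ξ : ℝ) :
    ∫ u in Ioi (0 : ℝ), Complex.exp (ξ * u * I) * (Real.exp (-u) * subordDensity s α u : ℝ) =
      Complex.exp (-(s * (1 + (-ξ : ℝ) * I : ℂ) ^ (α : ℂ))) := by
  have hπ := Real.pi_pos
  set G : ℝ → ℂ := fun x =>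
    Complex.exp (-(s * (1 + (2 * Real.pi * x : ℝ) * I : ℂ) ^ (α : ℂ))) with hG
  have hinv : 𝓕⁻ G = fun l => ((Real.exp (-l) * subordDensity s α l : ℝ) : ℂ) :=
    funext fun l => fourierInv_exp_neg_mul_cpow h0 h1 hs l
  have hGc : Continuous G := Complex.continuous_exp.comp (continuous_const.mul
    (continuous_one_add_mul_I_cpow.comp (continuous_const.mul continuous_id))).neg
  have hGi : Integrable G :=
    (integrable_exp_neg_mul_cpow h0 h1 hs).comp_mul_left' (R := 2 * Real.pi) (by positivity)
  have hsupp : ∀ l : ℝ, l ∉ Ioi (0 : ℝ) →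
      ((Real.exp (-l) * subordDensity s α l : ℝ) : ℂ) = 0 := fun l hl => by
    rw [subordDensity_of_nonpos h0 h1 hs (not_lt.1 hl)]; simp
  have hFi : Integrable (𝓕⁻ G) := by
    rw [hinv]
    refine IntegrableOn.integrable_of_forall_notMem_eq_zero (s := Ioi 0) ?_ hsupp
    refine Integrable.ofReal ?_
    refine (integrableOn_subordDensity h0 h1 hs).bdd_mul (c := 1)
      (by fun_prop) ?_
    filter_upwards [ae_restrict_mem measurableSet_Ioi] with u hu
    rw [Real.norm_eq_abs, Real.abs_exp, Real.exp_le_one_iff]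
    simpa using (le_of_lt hu : (0 : ℝ) ≤ u)
  have hFi' : Integrable (𝓕 G) := by
    have : 𝓕 G = fun x => 𝓕⁻ G (-x) := by
      ext x; rw [Real.fourierInv_eq_fourier_neg, neg_neg]
    rw [this]
    exact hFi.comp_neg
  have h2 := congr_fun (hGc.fourier_fourierInv_eq hGi hFi') (-ξ / (2 * Real.pi))
  rw [hinv, Real.fourier_real_eq_integral_exp_smul] at h2
  have e : (2 * Real.pi * (-ξ / (2 * Real.pi)) : ℝ) = -ξ := by field_simp
  rw [hG] at h2
  simp only [e] at h2
  rw [← h2]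
  symm
  rw [← setIntegral_eq_integral_of_forall_compl_eq_zero (s := Ioi 0)]
  · refine setIntegral_congr_fun measurableSet_Ioi fun u _ => ?_
    simp only [smul_eq_mul]
    congr 3
    have : -2 * Real.pi * u * (-ξ / (2 * Real.pi)) = ξ * u := by field_simp
    rw [this]
    push_cast; ring
  · intro x hx
    rw [hsupp x hx, smul_zero]

/-- The probability measure on the half line with density `subordDensity s α`. -/
def subordMeasure (s α : ℝ) : Measure ℝ :=
  (volume.restrict (Ioi 0)).withDensity fun u => ENNReal.ofReal (subordDensity s α u)

/-- The exponentially tilted version of `subordMeasure`, whose characteristic function is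
explicit. -/
def tiltedSubordMeasure (s α : ℝ) : Measure ℝ :=
  (volume.restrict (Ioi 0)).withDensity fun u =>
    ENNReal.ofReal (Real.exp (-u) * subordDensity s α u)

lemma isProbabilityMeasure_subordMeasure (h0 : 0 < α) (h1 : α < 1) (hs : 0 < s) :
    IsProbabilityMeasure (subordMeasure s α) := by
  refine ⟨?_⟩
  rw [subordMeasure, withDensity_apply _ MeasurableSet.univ, Measure.restrict_univ,
    lintegral_subordDensity h0 h1 hs]

lemma measurable_exp_neg_mul_subordDensity :
    Measurable fun u => Real.exp (-u) * subordDensity s α u :=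
  (by fun_prop : Measurable fun u : ℝ => Real.exp (-u)).mul (measurable_subordDensity s α)

lemma subordMeasure_eq_withDensity (h0 : 0 < α) (h1 : α < 1) (hs : 0 < s) :
    subordMeasure s α =
      (tiltedSubordMeasure s α).withDensity fun u => ENNReal.ofReal (Real.exp u) := by
  rw [tiltedSubordMeasure, ← withDensity_mul _
    measurable_exp_neg_mul_subordDensity.ennreal_ofReal (by fun_prop), subordMeasure]
  congr 1
  ext u
  rw [Pi.mul_apply, ← ENNReal.ofReal_mul
    (mul_nonneg (Real.exp_pos _).le (subordDensity_nonneg h0 h1 hs u))]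
  congr 1
  have : Real.exp (-u) * Real.exp u = 1 := by rw [← Real.exp_add]; simp
  linear_combination -subordDensity s α u * this

lemma isFiniteMeasure_tiltedSubordMeasure (h0 : 0 < α) (h1 : α < 1) (hs : 0 < s) :
    IsFiniteMeasure (tiltedSubordMeasure s α) := by
  refine ⟨?_⟩
  rw [tiltedSubordMeasure, withDensity_apply _ MeasurableSet.univ, Measure.restrict_univ]
  refine lt_of_le_of_lt ?_ (ENNReal.one_lt_top)
  rw [← lintegral_subordDensity h0 h1 hs]
  refine setLIntegral_mono' measurableSet_Ioi fun u hu => ENNReal.ofReal_le_ofReal ?_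
  refine mul_le_of_le_one_left (subordDensity_nonneg h0 h1 hs u) ?_
  rw [Real.exp_le_one_iff]
  simpa using (le_of_lt hu : (0 : ℝ) ≤ u)

lemma charFun_tiltedSubordMeasure (h0 : 0 < α) (h1 : α < 1) (hs : 0 < s) (ξ : ℝ) :
    charFun (tiltedSubordMeasure s α) ξ =
      Complex.exp (-(s * (1 + (-ξ : ℝ) * I : ℂ) ^ (α : ℂ))) := by
  rw [charFun_apply_real, tiltedSubordMeasure, ← integral_exp_mul_subordDensity h0 h1 hs,
    integral_withDensity_eq_integral_toReal_smul
      measurable_exp_neg_mul_subordDensity.ennreal_ofReal (Eventually.of_forall fun _ => by simp)]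
  refine integral_congr_ae (Eventually.of_forall fun u => ?_)
  simp only
  rw [ENNReal.toReal_ofReal (mul_nonneg (Real.exp_pos _).le (subordDensity_nonneg h0 h1 hs u)),
    Complex.real_smul, mul_comm]

lemma tiltedSubordMeasure_conv (h0 : 0 < α) (h1 : α < 1) {t : ℝ} (hs : 0 < s) (ht : 0 < t) :
    (tiltedSubordMeasure s α).conv (tiltedSubordMeasure t α) = tiltedSubordMeasure (s + t) α := by
  have := isFiniteMeasure_tiltedSubordMeasure h0 h1 hs
  have := isFiniteMeasure_tiltedSubordMeasure h0 h1 ht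
  have := isFiniteMeasure_tiltedSubordMeasure h0 h1 (add_pos hs ht)
  refine Measure.ext_of_charFun (funext fun ξ => ?_)
  rw [charFun_conv, charFun_tiltedSubordMeasure h0 h1 hs, charFun_tiltedSubordMeasure h0 h1 ht,
    charFun_tiltedSubordMeasure h0 h1 (add_pos hs ht), ← Complex.exp_add]
  congr 1
  push_cast
  ring

/-- The densities form a convolution semigroup: the tilted measures do, by their characteristic
functions, and the tilt is multiplicative. -/
theorem subordMeasure_conv (h0 : 0 < α) (h1 : α < 1) {t : ℝ} (hs : 0 < s) (ht : 0 < t) :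
    (subordMeasure s α).conv (subordMeasure t α) = subordMeasure (s + t) α := by
  have := isFiniteMeasure_tiltedSubordMeasure h0 h1 hs
  have := isFiniteMeasure_tiltedSubordMeasure h0 h1 ht
  have := isProbabilityMeasure_subordMeasure h0 h1 hs
  have := isProbabilityMeasure_subordMeasure h0 h1 ht
  have hexp : Measurable fun u : ℝ => ENNReal.ofReal (Real.exp u) := by fun_prop
  ext B hB
  have hind : Measurable (B.indicator (fun _ => (1 : ℝ≥0∞))) := measurable_const.indicator hB
  have e : ∀ {s : ℝ}, 0 < s → ∀ f : ℝ → ℝ≥0∞, Measurable f → ∫⁻ u, f u ∂subordMeasure s α =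
      ∫⁻ u, ENNReal.ofReal (Real.exp u) * f u ∂tiltedSubordMeasure s α := fun hs f hf => by
    rw [subordMeasure_eq_withDensity h0 h1 hs, lintegral_withDensity_eq_lintegral_mul _ hexp hf]
    rfl
  rw [← lintegral_indicator_one hB, ← lintegral_indicator_one hB]
  change ∫⁻ x, B.indicator (fun _ => 1) x ∂_ = ∫⁻ x, B.indicator (fun _ => 1) x ∂_
  have hmeas : Measurable
      (Function.uncurry fun x y : ℝ => B.indicator (fun _ => (1 : ℝ≥0∞)) (x + y)) :=
    hind.comp measurable_add
  rw [Measure.lintegral_conv hind, e (add_pos hs ht) _ hind, ← tiltedSubordMeasure_conv h0 h1 hs ht,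
    Measure.lintegral_conv (f := fun u => ENNReal.ofReal (Real.exp u) * B.indicator (fun _ => 1) u)
      (hexp.mul hind), e hs (fun x => ∫⁻ y, B.indicator (fun _ => 1) (x + y) ∂subordMeasure t α)
      hmeas.lintegral_prod_right']
  refine lintegral_congr fun x => ?_
  rw [e ht (fun y => B.indicator (fun _ => 1) (x + y)) (hind.comp (measurable_const_add x)),
    ← lintegral_const_mul' _ _ (by simp)]
  refine lintegral_congr fun y => ?_
  rw [← mul_assoc, ← ENNReal.ofReal_mul (Real.exp_pos _).le, ← Real.exp_add]

end StableDensity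

section Duality

variable {M : Type*} [MeasurableSpace M] {μ : Measure M}

/-! ### Elements of `L^∞` and `L^1` given by functions -/

lemma Linfty.ae_norm_le (f : Linfty μ) : ∀ᵐ x ∂μ, ‖f x‖ ≤ ‖f‖ := by
  have h := enorm_ae_le_eLpNormEssSup f μ
  filter_upwards [h] with x hx
  rw [← eLpNorm_exponent_top, ← Lp.enorm_def] at hx
  rwa [← ofReal_norm, ← ofReal_norm, ENNReal.ofReal_le_ofReal_iff (norm_nonneg _)] at hx

lemma Linfty.norm_le {f : Linfty μ} {C : ℝ} (hC : 0 ≤ C) (h : ∀ᵐ x ∂μ, ‖f x‖ ≤ C) :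
    ‖f‖ ≤ C := by
  have : ‖f‖ₑ ≤ ENNReal.ofReal C := by
    rw [Lp.enorm_def, eLpNorm_exponent_top]
    refine eLpNormEssSup_le_of_ae_enorm_bound ?_
    filter_upwards [h] with x hx
    rw [← ofReal_norm]
    exact ENNReal.ofReal_le_ofReal hx
  rwa [← ofReal_norm, ENNReal.ofReal_le_ofReal_iff hC] at this

lemma L1.norm_eq_integral (g : Lp ℂ 1 μ) : ‖g‖ = ∫ x, ‖g x‖ ∂μ := L1.norm_eq_integral_norm g

lemma L1.integrable (g : Lp ℂ 1 μ) : Integrable g μ := L1.integrable_coeFn g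

lemma norm_pairing_le (f : Linfty μ) (g : Lp ℂ 1 μ) : ‖pairing f g‖ ≤ ‖f‖ * ‖g‖ := by
  rw [L1.norm_eq_integral, ← integral_const_mul]
  refine norm_integral_le_of_norm_le ((L1.integrable g).norm.const_mul _) ?_
  filter_upwards [Linfty.ae_norm_le f] with x hx
  simpa using mul_le_mul_of_nonneg_right hx (norm_nonneg (g x))

/-- `f ↦ ⟨f, g⟩` as a bounded functional on `L^∞`. -/
def pairingLeft (g : Lp ℂ 1 μ) : Linfty μ →L[ℂ] ℂ :=
  LinearMap.mkContinuous
    { toFun := fun f => pairing f g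
      map_add' := fun f f' => pairing_add_left f f' g
      map_smul' := fun c f => pairing_smul_left c f g } ‖g‖ fun f => by
    rw [mul_comm]; exact norm_pairing_le f g

/-- `g ↦ ⟨f, g⟩` as a bounded conjugate linear functional on `L^1`. -/
def pairingRight (f : Linfty μ) : Lp ℂ 1 μ →L⋆[ℂ] ℂ :=
  LinearMap.mkContinuous
    { toFun := fun g => pairing f g
      map_add' := fun g g' => pairing_add_right f g g'
      map_smul' := fun c g => pairing_smul_right c f g } ‖f‖ fun g => norm_pairing_le f g

@[simp] lemma pairingLeft_apply (f : Linfty μ) (g : Lp ℂ 1 μ) : pairingLeft g f = pairing f g := rfl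

lemma pairing_sub_left (f f' : Linfty μ) (g : Lp ℂ 1 μ) :
    pairing (f - f') g = pairing f g - pairing f' g := map_sub (pairingLeft g) f f'

lemma pairing_neg_left (f : Linfty μ) (g : Lp ℂ 1 μ) : pairing (-f) g = -pairing f g :=
  map_neg (pairingLeft g) f

@[simp] lemma pairing_zero_left (g : Lp ℂ 1 μ) : pairing 0 g = 0 := map_zero (pairingLeft g)

lemma pairing_sum_left {ι : Type*} (s : Finset ι) (f : ι → Linfty μ) (g : Lp ℂ 1 μ) :
    pairing (∑ i ∈ s, f i) g = ∑ i ∈ s, pairing (f i) g := map_sum (pairingLeft g) f s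

lemma pairing_sub_right (f : Linfty μ) (g g' : Lp ℂ 1 μ) :
    pairing f (g - g') = pairing f g - pairing f g' := map_sub (pairingRight f) g g'

@[simp] lemma pairing_zero_right (f : Linfty μ) : pairing f 0 = 0 := map_zero (pairingRight f)

lemma pairing_toL1 (f : Linfty μ) {G : M → ℂ} (hG : Integrable G μ) :
    pairing f (hG.toL1 G) = ∫ x, f x * conj (G x) ∂μ := by
  refine integral_congr_ae ?_
  filter_upwards [hG.coeFn_toL1] with x hx
  rw [hx]

lemma pairing_toLp {F : M → ℂ} (hF : MemLp F ∞ μ) (g : Lp ℂ 1 μ) :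
    pairing (hF.toLp F) g = ∫ x, F x * conj (g x) ∂μ := by
  refine integral_congr_ae ?_
  filter_upwards [hF.coeFn_toLp] with x hx
  rw [hx]

lemma pairing_star (f : Linfty μ) (g : Lp ℂ 1 μ) :
    pairing (star f) (star g) = conj (pairing f g) := by
  unfold pairing
  rw [← integral_conj]
  refine integral_congr_ae ?_
  filter_upwards [Lp.coeFn_star f, Lp.coeFn_star g] with x hx hx'
  rw [hx, hx']
  simp

/-- The indicator function of a measurable set as an element of `L^∞`. -/
def indicatorTop (μ : Measure M) {A : Set M} (hA : MeasurableSet A) : Linfty μ :=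
  MemLp.toLp (A.indicator fun _ => (1 : ℂ)) (memLp_top_of_bound
    ((measurable_const.indicator hA).aestronglyMeasurable) 1
    (ae_of_all _ fun x => by by_cases h : x ∈ A <;> simp [h]))

lemma coeFn_indicatorTop {A : Set M} (hA : MeasurableSet A) :
    indicatorTop μ hA =ᵐ[μ] A.indicator fun _ => (1 : ℂ) := MemLp.coeFn_toLp _

lemma norm_indicatorTop_le {A : Set M} (hA : MeasurableSet A) : ‖indicatorTop μ hA‖ ≤ 1 := by
  refine Linfty.norm_le zero_le_one ?_
  filter_upwards [coeFn_indicatorTop (μ := μ) hA] with x hx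
  rw [hx]
  by_cases h : x ∈ A <;> simp [h]

lemma indicatorTop_union {A B : Set M} (hA : MeasurableSet A) (hB : MeasurableSet B)
    (h : Disjoint A B) :
    indicatorTop μ (hA.union hB) = indicatorTop μ hA + indicatorTop μ hB := by
  refine Lp.ext ?_
  filter_upwards [coeFn_indicatorTop (μ := μ) hA, coeFn_indicatorTop (μ := μ) hB,
    coeFn_indicatorTop (μ := μ) (hA.union hB),
    Lp.coeFn_add (indicatorTop μ hA) (indicatorTop μ hB)] with x h1 h2 h3 h4
  rw [h4, Pi.add_apply, h1, h2, h3, indicator_union_of_disjoint h]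

lemma indicatorTop_of_measure_zero {A : Set M} (hA : MeasurableSet A) (h : μ A = 0) :
    indicatorTop μ hA = 0 := by
  refine Lp.ext ?_
  filter_upwards [coeFn_indicatorTop (μ := μ) hA, Lp.coeFn_zero ℂ ∞ μ,
    measure_eq_zero_iff_ae_notMem.1 h] with x h1 h2 h3
  rw [h1, h2]
  simp [h3]

lemma pairing_indicatorTop {A : Set M} (hA : MeasurableSet A) (g : Lp ℂ 1 μ) :
    pairing (indicatorTop μ hA) g = ∫ x in A, conj (g x) ∂μ := by
  rw [← integral_indicator hA]
  refine integral_congr_ae ?_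
  filter_upwards [coeFn_indicatorTop (μ := μ) hA] with x hx
  rw [hx]
  by_cases h : x ∈ A <;> simp [h]

/-! ### Norm and order in `L^∞` are determined by the pairing -/

lemma integrable_indicator_sign {A : Set M} (hA : MeasurableSet A) (hμ : μ A < ∞) {f : M → ℂ}
    (hf : AEStronglyMeasurable f μ) :
    Integrable (A.indicator fun x => ((‖f x‖⁻¹ : ℝ) : ℂ) * f x) μ := by
  rw [integrable_indicator_iff hA]
  refine Measure.integrableOn_of_bounded (M := 1) hμ.ne ?_ ?_
  · exact (Complex.continuous_ofReal.comp_aestronglyMeasurable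
      hf.norm.aemeasurable.inv.aestronglyMeasurable).mul hf
  · refine ae_of_all _ fun x => ?_
    rw [norm_mul, Complex.norm_real, norm_inv, norm_norm]
    exact inv_mul_le_one

lemma norm_toL1_indicator_sign_le {A : Set M} (hA : MeasurableSet A) (hμ : μ A < ∞) {f : M → ℂ}
    (hf : AEStronglyMeasurable f μ) :
    ‖(integrable_indicator_sign hA hμ hf).toL1 _‖ ≤ μ.real A := by
  rw [L1.norm_of_fun_eq_integral_norm]
  simp only [norm_indicator_eq_indicator_norm]
  rw [integral_indicator hA]
  have : μ.real A = ∫ x in A, (1 : ℝ) ∂μ := by simp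
  rw [this]
  refine integral_mono_of_nonneg (ae_of_all _ fun x => norm_nonneg _)
    (integrableOn_const hμ.ne) (ae_of_all _ fun x => ?_)
  simp only
  rw [norm_mul, Complex.norm_real, norm_inv, norm_norm]
  exact inv_mul_le_one

lemma mul_conj_sign (z : ℂ) : z * conj (((‖z‖⁻¹ : ℝ) : ℂ) * z) = (‖z‖ : ℂ) := by
  rw [map_mul, Complex.conj_ofReal, mul_left_comm, Complex.mul_conj, Complex.normSq_eq_norm_sq]
  by_cases h : z = 0
  · simp [h]
  · have : ‖z‖ ≠ 0 := norm_ne_zero_iff.2 h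
    rw [← Complex.ofReal_mul]
    congr 1
    field_simp

lemma Linfty.norm_le_of_forall_pairing [SigmaFinite μ] {f : Linfty μ} {C : ℝ} (hC : 0 ≤ C)
    (h : ∀ g : Lp ℂ 1 μ, ‖pairing f g‖ ≤ C * ‖g‖) : ‖f‖ ≤ C := by
  refine Linfty.norm_le hC ?_
  have hm : StronglyMeasurable f := Lp.stronglyMeasurable f
  have key : (fun x => ‖f x‖ₑ) ≤ᵐ[μ] fun _ => ENNReal.ofReal C := by
    refine ae_le_of_forall_setLIntegral_le_of_sigmaFinite hm.measurable.enorm fun A hA hμ => ?_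
    have h1 := (h _).trans (mul_le_mul_of_nonneg_left
      (norm_toL1_indicator_sign_le hA hμ hm.aestronglyMeasurable) hC)
    rw [pairing_toL1] at h1
    have h2 : (fun x => f x * conj (A.indicator (fun x => ((‖f x‖⁻¹ : ℝ) : ℂ) * f x) x)) =
        A.indicator fun x => ((‖f x‖ : ℝ) : ℂ) := by
      ext x
      by_cases hx : x ∈ A
      · simp only [hx, indicator_of_mem]
        exact mul_conj_sign _
      · simp [hx]
    have hint : IntegrableOn (fun x => ‖f x‖) A μ :=
      Measure.integrableOn_of_bounded (M := ‖f‖) hμ.ne hm.aestronglyMeasurable.norm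
        (ae_restrict_of_ae (by simpa using Linfty.ae_norm_le f))
    rw [h2, integral_indicator hA, integral_complex_ofReal, Complex.norm_real, Real.norm_of_nonneg
      (integral_nonneg fun x => norm_nonneg _)] at h1
    have h3 : ∫⁻ x in A, ‖f x‖ₑ ∂μ = ENNReal.ofReal (∫ x in A, ‖f x‖ ∂μ) := by
      rw [ofReal_integral_eq_lintegral_ofReal hint (ae_of_all _ fun x => norm_nonneg _)]
      simp
    rw [h3, setLIntegral_const]
    refine (ENNReal.ofReal_le_ofReal h1).trans_eq ?_
    rw [ENNReal.ofReal_mul hC, measureReal_def, ENNReal.ofReal_toReal hμ.ne]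
  filter_upwards [key] with x hx
  rwa [← ofReal_norm, ENNReal.ofReal_le_ofReal_iff hC] at hx

lemma Linfty.ext_pairing [SigmaFinite μ] {f f' : Linfty μ}
    (h : ∀ g : Lp ℂ 1 μ, pairing f g = pairing f' g) : f = f' := by
  rw [← sub_eq_zero, ← norm_le_zero_iff]
  refine Linfty.norm_le_of_forall_pairing le_rfl fun g => ?_
  rw [pairing_sub_left, h g]
  simp

lemma exists_pairing_eq_norm (k : Lp ℂ 1 μ) : ∃ f : Linfty μ, ‖f‖ ≤ 1 ∧ pairing f k = ‖k‖ := by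
  have hm : StronglyMeasurable k := Lp.stronglyMeasurable k
  have hb : ∀ᵐ x ∂μ, ‖((‖k x‖⁻¹ : ℝ) : ℂ) * k x‖ ≤ 1 := ae_of_all _ fun x => by
    rw [norm_mul, Complex.norm_real, norm_inv, norm_norm]
    exact inv_mul_le_one
  have hF : MemLp (fun x => ((‖k x‖⁻¹ : ℝ) : ℂ) * k x) ∞ μ := by
    refine memLp_top_of_bound ?_ 1 hb
    exact ((Complex.measurable_ofReal.comp hm.measurable.norm.inv).mul
      hm.measurable).aestronglyMeasurable
  refine ⟨hF.toLp _, Linfty.norm_le zero_le_one ?_, ?_⟩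
  · filter_upwards [hb, hF.coeFn_toLp] with x h1 h2
    rwa [h2]
  rw [pairing_toLp]
  have h2 : (fun x => ((‖k x‖⁻¹ : ℝ) : ℂ) * k x * conj (k x)) = fun x => ((‖k x‖ : ℝ) : ℂ) := by
    ext x
    have := congrArg conj (mul_conj_sign (k x))
    simpa [mul_comm, mul_assoc, mul_left_comm] using this
  rw [h2, integral_complex_ofReal, L1.norm_eq_integral]

lemma L1.norm_le_of_forall_pairing {g : Lp ℂ 1 μ} {C : ℝ} (hC : 0 ≤ C)
    (h : ∀ f : Linfty μ, ‖pairing f g‖ ≤ C * ‖f‖) : ‖g‖ ≤ C := by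
  obtain ⟨f, hf, hf'⟩ := exists_pairing_eq_norm g
  have h1 := h f
  rw [hf', Complex.norm_real, norm_norm] at h1
  exact h1.trans (mul_le_of_le_one_right hC hf)

lemma L1.ext_pairing {g g' : Lp ℂ 1 μ} (h : ∀ f : Linfty μ, pairing f g = pairing f g') :
    g = g' := by
  rw [← sub_eq_zero, ← norm_le_zero_iff]
  refine L1.norm_le_of_forall_pairing le_rfl fun f => ?_
  rw [pairing_sub_right, h f, sub_self]
  simp

/-- `g` is real and nonnegative almost everywhere. -/
def L1.IsNonneg (g : Lp ℂ 1 μ) : Prop := ∀ᵐ x ∂μ, 0 ≤ g x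

lemma pairing_nonneg {f : Linfty μ} {g : Lp ℂ 1 μ} (hf : IsNonneg f) (hg : L1.IsNonneg g) :
    0 ≤ pairing f g := by
  refine integral_nonneg_of_ae ?_
  filter_upwards [hf, hg] with x hx hx'
  have : conj (g x) = g x := Complex.conj_eq_iff_im.2 (Complex.nonneg_iff.1 hx').2.symm
  rw [this]
  exact mul_nonneg hx hx'

lemma integrable_indicator_one {A : Set M} (hA : MeasurableSet A) (hμ : μ A < ∞) :
    Integrable (A.indicator fun _ => (1 : ℂ)) μ :=
  (integrable_indicator_iff hA).2 (integrableOn_const hμ.ne)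

lemma isNonneg_toL1_indicator {A : Set M} (hA : MeasurableSet A) (hμ : μ A < ∞) :
    L1.IsNonneg ((integrable_indicator_one (μ := μ) hA hμ).toL1 _) := by
  unfold L1.IsNonneg
  filter_upwards [(integrable_indicator_one (μ := μ) hA hμ).coeFn_toL1] with x hx
  rw [hx]
  by_cases h : x ∈ A <;> simp [h]

lemma Linfty.integrableOn (f : Linfty μ) {A : Set M} (hμ : μ A < ∞) : IntegrableOn f A μ :=
  Measure.integrableOn_of_bounded (M := ‖f‖) hμ.ne (Lp.stronglyMeasurable f).aestronglyMeasurable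
    (ae_restrict_of_ae (Linfty.ae_norm_le f))

lemma isNonneg_of_forall_pairing [SigmaFinite μ] {f : Linfty μ}
    (h : ∀ g : Lp ℂ 1 μ, L1.IsNonneg g → 0 ≤ pairing f g) : IsNonneg f := by
  have key : ∀ A : Set M, MeasurableSet A → μ A < ∞ → 0 ≤ ∫ x in A, f x ∂μ := by
    intro A hA hμ
    have h1 := h _ (isNonneg_toL1_indicator hA hμ)
    rw [pairing_toL1] at h1
    rw [← integral_indicator hA]
    convert! h1 using 2
    ext x
    by_cases hx : x ∈ A <;> simp [hx]
  have hre : ∀ A : Set M, μ A < ∞ → ∫ x in A, (f x).re ∂μ = (∫ x in A, f x ∂μ).re :=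
    fun A hμ => integral_re (Linfty.integrableOn f hμ)
  have him : ∀ A : Set M, μ A < ∞ → ∫ x in A, (f x).im ∂μ = (∫ x in A, f x ∂μ).im :=
    fun A hμ => integral_im (Linfty.integrableOn f hμ)
  have h1 : 0 ≤ᵐ[μ] fun x => (f x).re := by
    refine ae_nonneg_of_forall_setIntegral_nonneg_of_sigmaFinite
      (fun A _ hμ => (Linfty.integrableOn f hμ).re) fun A hA hμ => ?_
    rw [hre A hμ]
    exact (Complex.nonneg_iff.1 (key A hA hμ)).1
  have h2 : (fun x => (f x).im) =ᵐ[μ] 0 := by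
    refine ae_eq_zero_of_forall_setIntegral_eq_of_sigmaFinite
      (fun A _ hμ => (Linfty.integrableOn f hμ).im) fun A hA hμ => ?_
    rw [him A hμ]
    exact (Complex.nonneg_iff.1 (key A hA hμ)).2.symm
  unfold IsNonneg
  filter_upwards [h1, h2] with x hx hx'
  exact Complex.nonneg_iff.2 ⟨hx, hx'.symm⟩

end Duality

section Representation

variable {M : Type*} [MeasurableSpace M] {μ : Measure M}

/-! ### Countably additive functionals on `L^∞`, and functionals on `L^1` -/

/-- A bounded functional on `L^∞` is continuous along decreasing sequences of sets with empty
intersection. -/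
def SequentiallyNormal (Λ : Linfty μ →L[ℂ] ℂ) : Prop :=
  ∀ (A : ℕ → Set M) (hA : ∀ n, MeasurableSet (A n)), Antitone A → ⋂ n, A n = ∅ →
    Tendsto (fun n => Λ (indicatorTop μ (hA n))) atTop (𝓝 0)

lemma summable_of_abs_sum_le {x : ℕ → ℝ} {C : ℝ} (h : ∀ F : Finset ℕ, |∑ i ∈ F, x i| ≤ C) :
    Summable x := by
  refine Summable.of_abs (summable_of_sum_le (c := 2 * C) (fun _ => abs_nonneg _) fun F => ?_)
  rw [← Finset.sum_filter_add_sum_filter_not F (fun i => 0 ≤ x i)]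
  have h1 : ∑ i ∈ F with 0 ≤ x i, |x i| = ∑ i ∈ F with 0 ≤ x i, x i :=
    Finset.sum_congr rfl fun i hi => abs_of_nonneg (Finset.mem_filter.1 hi).2
  have h2 : ∑ i ∈ F with ¬ 0 ≤ x i, |x i| = -∑ i ∈ F with ¬ 0 ≤ x i, x i := by
    rw [← Finset.sum_neg_distrib]
    exact Finset.sum_congr rfl fun i hi => abs_of_neg (not_le.1 (Finset.mem_filter.1 hi).2)
  have h3 := (le_abs_self _).trans (h (F.filter fun i => 0 ≤ x i))
  have h4 := (neg_le_abs _).trans (h (F.filter fun i => ¬ 0 ≤ x i))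
  linarith

lemma indicatorTop_biUnion {B : ℕ → Set M} (hB : ∀ i, MeasurableSet (B i))
    (hd : Pairwise (Function.onFun Disjoint B)) (F : Finset ℕ) :
    indicatorTop μ (F.measurableSet_biUnion fun i _ => hB i) =
      ∑ i ∈ F, indicatorTop μ (hB i) := by
  classical
  induction F using Finset.induction_on with
  | empty => exact (indicatorTop_of_measure_zero _ (by simp))
  | insert i F hi ih =>
    have hdis : Disjoint (B i) (⋃ j ∈ F, B j) := by
      simp only [disjoint_iUnion_right]
      exact fun j hj => hd fun hij => hi (hij ▸ hj)
    rw [Finset.sum_insert hi, ← ih, ← indicatorTop_union _ _ hdis]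
    congr 1
    simp

lemma SequentiallyNormal.hasSum {Λ : Linfty μ →L[ℂ] ℂ} (hΛ : SequentiallyNormal Λ)
    {B : ℕ → Set M} (hB : ∀ i, MeasurableSet (B i))
    (hd : Pairwise (Function.onFun Disjoint B)) :
    HasSum (fun i => Λ (indicatorTop μ (hB i))) (Λ (indicatorTop μ (MeasurableSet.iUnion hB))) := by
  have hbound : ∀ F : Finset ℕ, ‖∑ i ∈ F, Λ (indicatorTop μ (hB i))‖ ≤ ‖Λ‖ := fun F => by
    rw [← map_sum, ← indicatorTop_biUnion hB hd]
    exact (Λ.le_opNorm _).trans (mul_le_of_le_one_right (norm_nonneg _) (norm_indicatorTop_le _))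
  have hsum : Summable fun i => Λ (indicatorTop μ (hB i)) := by
    have hre : Summable fun i => (Λ (indicatorTop μ (hB i))).re :=
      summable_of_abs_sum_le (C := ‖Λ‖) fun F => by
        rw [← Complex.re_sum]
        exact (Complex.abs_re_le_norm _).trans (hbound F)
    have him : Summable fun i => (Λ (indicatorTop μ (hB i))).im :=
      summable_of_abs_sum_le (C := ‖Λ‖) fun F => by
        rw [← Complex.im_sum]
        exact (Complex.abs_im_le_norm _).trans (hbound F)
    exact (Complex.hasSum_iff _ ⟨_, _⟩).2 ⟨hre.hasSum, him.hasSum⟩ |>.summable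
  have htail : ∀ n, MeasurableSet (⋃ i, B (i + n)) := fun n => MeasurableSet.iUnion fun i => hB _
  have h1 := hΛ (fun n => ⋃ i, B (i + n)) htail
    (antitone_nat_of_succ_le fun n => iUnion_subset fun i => by
      have : i + (n + 1) = (i + 1) + n := by ring
      rw [this]
      exact subset_iUnion (fun i => B (i + n)) (i + 1)) (by
        rw [eq_empty_iff_forall_notMem]
        intro x hx
        rw [mem_iInter] at hx
        obtain ⟨i, hi⟩ := mem_iUnion.1 (hx 0)
        obtain ⟨j, hj⟩ := mem_iUnion.1 (hx (i + 1))
        exact (hd (show i + 0 ≠ j + (i + 1) by omega)).le_bot ⟨hi, hj⟩)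
  have h2 : ∀ n, ∑ i ∈ Finset.range n, Λ (indicatorTop μ (hB i)) =
      Λ (indicatorTop μ (MeasurableSet.iUnion hB)) - Λ (indicatorTop μ (htail n)) := fun n => by
    rw [← map_sum, ← indicatorTop_biUnion hB hd, ← map_sub]
    congr 1
    rw [eq_sub_iff_add_eq, ← indicatorTop_union]
    · congr 1
      ext x
      simp only [mem_union, mem_iUnion, Finset.mem_range, exists_prop]
      constructor
      · rintro (⟨i, _, hi⟩ | ⟨i, hi⟩)
        exacts [⟨i, hi⟩, ⟨_, hi⟩]
      · rintro ⟨i, hi⟩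
        by_cases h : i < n
        · exact Or.inl ⟨i, h, hi⟩
        · exact Or.inr ⟨i - n, by rwa [Nat.sub_add_cancel (not_lt.1 h)]⟩
    · simp only [disjoint_iUnion_right, disjoint_iUnion_left]
      intro i j hj
      exact hd (by simp at hj; omega)
  have h3 := hsum.hasSum
  have h4 : Tendsto (fun n => ∑ i ∈ Finset.range n, Λ (indicatorTop μ (hB i))) atTop
      (𝓝 (Λ (indicatorTop μ (MeasurableSet.iUnion hB)))) := by
    simp_rw [h2]
    simpa using h1.const_sub (Λ (indicatorTop μ (MeasurableSet.iUnion hB)))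
  rwa [tendsto_nhds_unique h3.tendsto_sum_nat h4] at h3

open Classical in
/-- The set function `A ↦ Re (c Λ 1_A)` as a signed measure. -/
def SequentiallyNormal.signedMeasure {Λ : Linfty μ →L[ℂ] ℂ} (hΛ : SequentiallyNormal Λ) (c : ℂ) :
    SignedMeasure M where
  measureOf' A := if hA : MeasurableSet A then (c * Λ (indicatorTop μ hA)).re else 0
  empty' := by
    rw [dif_pos MeasurableSet.empty, indicatorTop_of_measure_zero _ (by simp)]
    simp
  not_measurable' A hA := dif_neg hA
  m_iUnion' B hB hd := by
    rw [dif_pos (MeasurableSet.iUnion hB)]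
    simp_rw [dif_pos (hB _)]
    exact Complex.hasSum_re ((hΛ.hasSum hB hd).mul_left c)

lemma SequentiallyNormal.signedMeasure_apply {Λ : Linfty μ →L[ℂ] ℂ} (hΛ : SequentiallyNormal Λ)
    (c : ℂ) {A : Set M} (hA : MeasurableSet A) :
    hΛ.signedMeasure c A = (c * Λ (indicatorTop μ hA)).re := dif_pos hA

/-- Radon–Nikodym, applied to real parts of multiples of the functional. -/
lemma SequentiallyNormal.exists_density [SigmaFinite μ] {Λ : Linfty μ →L[ℂ] ℂ}
    (hΛ : SequentiallyNormal Λ) (c : ℂ) :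
    ∃ r : M → ℝ, Integrable r μ ∧
      ∀ (A : Set M) (hA : MeasurableSet A), (c * Λ (indicatorTop μ hA)).re = ∫ x in A, r x ∂μ := by
  have hac : hΛ.signedMeasure c ≪ᵥ μ.toENNRealVectorMeasure := by
    refine VectorMeasure.AbsolutelyContinuous.mk fun A hA h => ?_
    rw [Measure.toENNRealVectorMeasure_apply_measurable hA] at h
    rw [hΛ.signedMeasure_apply c hA, indicatorTop_of_measure_zero hA h]
    simp
  refine ⟨(hΛ.signedMeasure c).rnDeriv μ, SignedMeasure.integrable_rnDeriv _ _, fun A hA => ?_⟩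
  have h1 := congrArg (fun s => s A) (SignedMeasure.withDensityᵥ_rnDeriv_eq _ μ hac)
  rw [withDensityᵥ_apply (SignedMeasure.integrable_rnDeriv _ _) hA,
    hΛ.signedMeasure_apply c hA] at h1
  exact h1.symm

/-- Two bounded functionals on `L^∞` that agree on indicator functions are equal: every essentially
bounded function is a uniform limit of simple functions. -/
lemma Linfty.clm_ext {Λ Λ' : Linfty μ →L[ℂ] ℂ}
    (h : ∀ (A : Set M) (hA : MeasurableSet A), Λ (indicatorTop μ hA) = Λ' (indicatorTop μ hA)) :
    Λ = Λ' := by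
  have hsimple : ∀ s : SimpleFunc M ℂ,
      Λ ((s.memLp_top μ).toLp s) = Λ' ((s.memLp_top μ).toLp s) := by
    intro s
    induction s using SimpleFunc.induction with
    | const c hA =>
      have : ((SimpleFunc.piecewise _ hA (SimpleFunc.const M c)
          (SimpleFunc.const M 0)).memLp_top μ).toLp _ = c • indicatorTop μ hA := by
        refine Lp.ext ?_
        filter_upwards [MemLp.coeFn_toLp ((SimpleFunc.piecewise _ hA (SimpleFunc.const M c)
          (SimpleFunc.const M 0)).memLp_top μ), Lp.coeFn_smul c (indicatorTop μ hA),
          coeFn_indicatorTop (μ := μ) hA] with x h1 h2 h3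
        rw [h1, h2, Pi.smul_apply, h3]
        simp [Set.indicator]
      rw [this, map_smul, map_smul, h]
    | add _ hf hg =>
      exact (map_add Λ _ _).trans ((congrArg₂ (· + ·) hf hg).trans (map_add Λ' _ _).symm)
  ext f
  have hcl : IsClosed {x | Λ x = Λ' x} := isClosed_eq Λ.continuous Λ'.continuous
  refine (hcl.closure_subset (?_ : f ∈ closure {x | Λ x = Λ' x}))
  rw [Metric.mem_closure_iff]
  intro ε hε
  obtain ⟨N, hN⟩ : ∃ N : ℕ, Metric.closedBall (0 : ℂ) ‖f‖ ⊆
      ⋃ k ∈ Finset.range N, Metric.ball (TopologicalSpace.denseSeq ℂ k) (ε / 2) := by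
    have hc : IsCompact (Metric.closedBall (0 : ℂ) ‖f‖) := isCompact_closedBall _ _
    obtain ⟨t, ht⟩ := hc.elim_finite_subcover
      (fun k : ℕ => Metric.ball (TopologicalSpace.denseSeq ℂ k) (ε / 2))
      (fun _ => Metric.isOpen_ball) fun z _ => by
        obtain ⟨k, hk⟩ := (TopologicalSpace.denseRange_denseSeq ℂ).exists_dist_lt z (half_pos hε)
        exact mem_iUnion.2 ⟨k, hk⟩
    refine ⟨t.sup id + 1, ht.trans (iUnion₂_mono' fun k hk => ⟨k, ?_, Subset.rfl⟩)⟩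
    exact Finset.mem_range.2 (Nat.lt_succ_of_le (Finset.le_sup (f := id) hk))
  have hm : Measurable f := (Lp.stronglyMeasurable f).measurable
  let s : SimpleFunc M ℂ := (SimpleFunc.nearestPt (TopologicalSpace.denseSeq ℂ) N).comp f hm
  refine ⟨(s.memLp_top μ).toLp s, hsimple s, ?_⟩
  rw [dist_eq_norm]
  refine lt_of_le_of_lt (Linfty.norm_le (half_pos hε).le ?_) (half_lt_self hε)
  filter_upwards [Linfty.ae_norm_le f, MemLp.coeFn_toLp (s.memLp_top μ),
    Lp.coeFn_sub f ((s.memLp_top μ).toLp s)] with x h1 h2 h3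
  rw [h3, Pi.sub_apply, h2]
  obtain ⟨k, hk, hk'⟩ := mem_iUnion₂.1 (hN (mem_closedBall_zero_iff.2 h1))
  have h4 := SimpleFunc.edist_nearestPt_le (TopologicalSpace.denseSeq ℂ) (f x)
    (Finset.mem_range.1 hk).le
  rw [edist_dist, edist_dist, ENNReal.ofReal_le_ofReal_iff dist_nonneg] at h4
  rw [← dist_eq_norm, dist_comm]
  rw [Metric.mem_ball, dist_comm] at hk'
  exact h4.trans hk'.le

/-- A countably additive bounded functional on `L^∞` is given by an element of `L^1`. -/
lemma SequentiallyNormal.exists_pairing [SigmaFinite μ] {Λ : Linfty μ →L[ℂ] ℂ}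
    (hΛ : SequentiallyNormal Λ) : ∃ g : Lp ℂ 1 μ, ∀ f, Λ f = pairing f g := by
  obtain ⟨r, hr, hr'⟩ := hΛ.exists_density 1
  obtain ⟨q, hq, hq'⟩ := hΛ.exists_density (-Complex.I)
  have hrc : Integrable (fun x => (r x : ℂ)) μ := hr.ofReal
  have hqc : Integrable (fun x => Complex.I * (q x : ℂ)) μ := Integrable.const_mul hq.ofReal _
  have hint : Integrable (fun x => (r x : ℂ) - Complex.I * q x) μ := hrc.sub hqc
  refine ⟨hint.toL1 _, fun f => ?_⟩
  suffices Λ = pairingLeft (hint.toL1 _) by rw [this]; rfl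
  refine Linfty.clm_ext fun A hA => ?_
  have h1 : ∫ x in A, ((r x : ℂ) + Complex.I * q x) ∂μ =
      ((∫ x in A, r x ∂μ : ℝ) : ℂ) + Complex.I * ((∫ x in A, q x ∂μ : ℝ) : ℂ) := by
    rw [integral_add hrc.integrableOn hqc.integrableOn,
      integral_const_mul, integral_complex_ofReal, integral_complex_ofReal]
  rw [pairingLeft_apply, pairing_indicatorTop]
  have h2 : ∫ x in A, conj ((hint.toL1 _) x) ∂μ = ∫ x in A, ((r x : ℂ) + Complex.I * q x) ∂μ := by
    refine integral_congr_ae (ae_restrict_of_ae ?_)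
    filter_upwards [hint.coeFn_toL1] with x hx
    rw [hx]
    simp
  rw [h2, h1, ← hr' A hA, ← hq' A hA]
  apply Complex.ext <;> simp

/-! ### Bounded functionals on `L^1` -/

lemma exists_pos_integrable (μ : Measure M) [SigmaFinite μ] :
    ∃ w : M → ℝ, Measurable w ∧ (∀ x, 0 < w x) ∧ Integrable w μ := by
  obtain ⟨w, h1, h2, h3⟩ := exists_pos_lintegral_lt_of_sigmaFinite μ one_ne_zero
  refine ⟨fun x => w x, h2.coe_nnreal_real, fun x => h1 x, ?_⟩
  refine ⟨h2.coe_nnreal_real.aestronglyMeasurable, ?_⟩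
  rw [hasFiniteIntegral_iff_enorm]
  simpa using h3.trans ENNReal.one_lt_top

/-- Every bounded functional on `L^1` is given by an element of `L^∞` whose norm is at most the bound. -/
lemma exists_pairing_of_bounded [SigmaFinite μ] (Λ : Lp ℂ 1 μ →L⋆[ℂ] ℂ) {C : ℝ} (hC : 0 ≤ C)
    (hΛ : ∀ g, ‖Λ g‖ ≤ C * ‖g‖) : ∃ h : Linfty μ, ‖h‖ ≤ C ∧ ∀ g, Λ g = pairing h g := by
  obtain ⟨w, hwm, hw0, hwi⟩ := exists_pos_integrable μ
  have hwc : Integrable (fun x => (w x : ℂ)) μ := hwi.ofReal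
  let W : Lp ℂ 1 μ := hwc.toL1 _
  have hW : W =ᵐ[μ] fun x => (w x : ℂ) := hwc.coeFn_toL1
  have hfW : ∀ f : Linfty μ, (f • W : Lp ℂ 1 μ) =ᵐ[μ] fun x => f x * w x := fun f => by
    filter_upwards [Lp.coeFn_lpSMul (r := 1) f W, hW] with x h1 h2
    rw [h1, Pi.smul_apply', h2, smul_eq_mul]
  let Λ' : Linfty μ →L[ℂ] ℂ := LinearMap.mkContinuous
    { toFun := fun f => conj (Λ (f • W : Lp ℂ 1 μ))
      map_add' := fun f f' => by
        have : ((f + f') • W : Lp ℂ 1 μ) = (f • W : Lp ℂ 1 μ) + (f' • W : Lp ℂ 1 μ) :=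
          Lp.smul_add f f' W
        rw [this, map_add, map_add]
      map_smul' := fun c f => by
        have : ((c • f) • W : Lp ℂ 1 μ) = c • (f • W : Lp ℂ 1 μ) := Lp.smul_assoc c f W
        rw [this]
        simp } (C * ‖W‖) fun f => by
      change ‖conj (Λ (f • W : Lp ℂ 1 μ))‖ ≤ _
      rw [RCLike.norm_conj, mul_assoc, mul_comm ‖W‖]
      exact (hΛ _).trans (mul_le_mul_of_nonneg_left (Lp.norm_smul_le f W) hC)
  have hΛ' : ∀ f, Λ' f = conj (Λ (f • W : Lp ℂ 1 μ)) := fun f => rfl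
  have hnorm : ∀ f : Linfty μ, ‖(f • W : Lp ℂ 1 μ)‖ = ∫ x, ‖f x‖ * w x ∂μ := fun f => by
    rw [L1.norm_eq_integral]
    refine integral_congr_ae ?_
    filter_upwards [hfW f] with x hx
    rw [hx, norm_mul, Complex.norm_real, Real.norm_of_nonneg (hw0 x).le]
  have hnormal : SequentiallyNormal Λ' := by
    intro A hA hanti hinter
    have h1 : Tendsto (fun n => ∫ x in A n, w x ∂μ) atTop (𝓝 0) := by
      have := tendsto_setIntegral_of_antitone hA hanti ⟨0, hwi.integrableOn⟩
      simpa [hinter] using this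
    have h2 : ∀ n, ‖Λ' (indicatorTop μ (hA n))‖ ≤ C * ∫ x in A n, w x ∂μ := fun n => by
      rw [hΛ', RCLike.norm_conj]
      refine (hΛ _).trans_eq ?_
      rw [hnorm, ← integral_indicator (hA n)]
      congr 1
      refine integral_congr_ae ?_
      filter_upwards [coeFn_indicatorTop (μ := μ) (hA n)] with x hx
      rw [hx]
      by_cases h : x ∈ A n <;> simp [h]
    exact squeeze_zero_norm h2 (by simpa using h1.const_mul C)
  obtain ⟨k, hk⟩ := hnormal.exists_pairing
  have hkm : StronglyMeasurable k := Lp.stronglyMeasurable k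
  -- the density `k` is dominated by the weight
  have hkw : ∀ᵐ x ∂μ, ‖k x‖ ≤ C * w x := by
    refine ae_le_of_forall_setIntegral_le (L1.integrable k).norm (hwi.const_mul C)
      fun A hA hμ => ?_
    have hb : ∀ᵐ x ∂μ, ‖A.indicator (fun x => ((‖k x‖⁻¹ : ℝ) : ℂ) * k x) x‖ ≤ 1 :=
      ae_of_all _ fun x => by
        by_cases hx : x ∈ A
        · rw [indicator_of_mem hx, norm_mul, Complex.norm_real, norm_inv, norm_norm]
          exact inv_mul_le_one
        · simp [hx]
    have hF : MemLp (A.indicator fun x => ((‖k x‖⁻¹ : ℝ) : ℂ) * k x) ∞ μ := by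
      refine memLp_top_of_bound ?_ 1 hb
      exact (((Complex.measurable_ofReal.comp hkm.measurable.norm.inv).mul
        hkm.measurable).indicator hA).aestronglyMeasurable
    have h1 := hk (hF.toLp _)
    rw [pairing_toLp] at h1
    have h2 : (fun x => A.indicator (fun x => ((‖k x‖⁻¹ : ℝ) : ℂ) * k x) x * conj (k x)) =
        A.indicator fun x => ((‖k x‖ : ℝ) : ℂ) := by
      ext x
      by_cases hx : x ∈ A
      · have := congrArg conj (mul_conj_sign (k x))
        simpa [hx, mul_comm, mul_assoc, mul_left_comm] using this
      · simp [hx]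
    rw [h2, integral_indicator hA, integral_complex_ofReal] at h1
    have h3 : ‖Λ' (hF.toLp _)‖ ≤ C * ∫ x in A, w x ∂μ := by
      rw [hΛ', RCLike.norm_conj]
      refine (hΛ _).trans (mul_le_mul_of_nonneg_left ?_ hC)
      rw [hnorm, ← integral_indicator hA]
      refine integral_mono_of_nonneg (ae_of_all _ fun x => by have := (hw0 x).le; positivity)
        (hwi.indicator hA) ?_
      filter_upwards [hF.coeFn_toLp, hb] with x hx hx'
      rw [hx]
      by_cases h : x ∈ A
      · rw [indicator_of_mem h w]
        exact mul_le_of_le_one_left (hw0 x).le hx'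
      · simp [h]
    rw [h1, Complex.norm_real, Real.norm_of_nonneg (integral_nonneg fun x => norm_nonneg _)] at h3
    rwa [integral_const_mul]
  have hHm : AEStronglyMeasurable (fun x => k x / (w x : ℂ)) μ :=
    (hkm.measurable.div (Complex.measurable_ofReal.comp hwm)).aestronglyMeasurable
  have hHb : ∀ᵐ x ∂μ, ‖k x / (w x : ℂ)‖ ≤ C := by
    filter_upwards [hkw] with x hx
    rwa [norm_div, Complex.norm_real, Real.norm_of_nonneg (hw0 x).le, div_le_iff₀ (hw0 x)]
  have hH : MemLp (fun x => k x / (w x : ℂ)) ∞ μ := memLp_top_of_bound hHm C hHb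
  refine ⟨hH.toLp _, Linfty.norm_le hC ?_, ?_⟩
  · filter_upwards [hHb, hH.coeFn_toLp] with x h1 h2
    rwa [h2]
  have hagree : ∀ f : Linfty μ, Λ (f • W : Lp ℂ 1 μ) = pairing (hH.toLp _) (f • W : Lp ℂ 1 μ) := by
    intro f
    have h1 : Λ (f • W : Lp ℂ 1 μ) = conj (pairing f k) := by rw [← hk, hΛ', Complex.conj_conj]
    rw [h1, pairing_toLp, pairing, ← integral_conj]
    refine integral_congr_ae ?_
    filter_upwards [hfW f] with x hx
    rw [hx]
    have : (w x : ℂ) ≠ 0 := Complex.ofReal_ne_zero.2 (hw0 x).ne'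
    simp
    field_simp
  intro g
  have hcl : IsClosed {x | Λ x = pairingRight (hH.toLp _) x} :=
    isClosed_eq Λ.continuous (pairingRight _).continuous
  refine hcl.closure_subset (?_ : g ∈ closure _)
  have hgm : StronglyMeasurable g := Lp.stronglyMeasurable g
  -- truncate `g` where it is not dominated by a multiple of the weight
  let A : ℕ → Set M := fun n => {x | ‖g x‖ ≤ n * w x}
  have hA : ∀ n, MeasurableSet (A n) := fun n =>
    measurableSet_le hgm.measurable.norm (hwm.const_mul _)
  have hFb : ∀ n, ∀ x, ‖(A n).indicator (fun x => g x / (w x : ℂ)) x‖ ≤ n := fun n x => by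
    by_cases hx : x ∈ A n
    · rw [indicator_of_mem hx, norm_div, Complex.norm_real, Real.norm_of_nonneg (hw0 x).le,
        div_le_iff₀ (hw0 x)]
      exact hx
    · simp [hx]
  have hF : ∀ n, MemLp ((A n).indicator fun x => g x / (w x : ℂ)) ∞ μ := fun n =>
    memLp_top_of_bound ((hgm.measurable.div (Complex.measurable_ofReal.comp hwm)).indicator
      (hA n)).aestronglyMeasurable n (ae_of_all _ (hFb n))
  refine mem_closure_of_tendsto (f := fun n => ((hF n).toLp _ • W : Lp ℂ 1 μ)) (b := atTop) ?_
    (Eventually.of_forall fun n => hagree _)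
  rw [tendsto_iff_norm_sub_tendsto_zero]
  have h1 : ∀ n, ‖((hF n).toLp _ • W : Lp ℂ 1 μ) - g‖ =
      ∫ x, (A n)ᶜ.indicator (fun x => ‖g x‖) x ∂μ := fun n => by
    rw [L1.norm_eq_integral]
    refine integral_congr_ae ?_
    filter_upwards [Lp.coeFn_sub ((hF n).toLp _ • W : Lp ℂ 1 μ) g, hfW ((hF n).toLp _),
      (hF n).coeFn_toLp] with x h1 h2 h3
    rw [h1, Pi.sub_apply, h2, h3]
    have : (w x : ℂ) ≠ 0 := Complex.ofReal_ne_zero.2 (hw0 x).ne'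
    by_cases hx : x ∈ A n
    · simp [hx, this]
    · simp [hx]
  simp_rw [h1]
  have h2 : Tendsto (fun n => ∫ x, (A n)ᶜ.indicator (fun x => ‖g x‖) x ∂μ) atTop
      (𝓝 (∫ x, (0 : ℝ) ∂μ)) := by
    refine tendsto_integral_of_dominated_convergence (fun x => ‖g x‖)
      (fun n => (hgm.measurable.norm.indicator (hA n).compl).aestronglyMeasurable)
      (L1.integrable g).norm (fun n => ae_of_all _ fun x => ?_) (ae_of_all _ fun x => ?_)
    · by_cases hx : x ∈ (A n)ᶜ <;> simp [hx]
    · obtain ⟨n, hn⟩ := exists_nat_ge (‖g x‖ / w x)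
      refine tendsto_const_nhds.congr' ?_
      filter_upwards [eventually_ge_atTop n] with m hm
      have : x ∈ A m := by
        rw [div_le_iff₀ (hw0 x)] at hn
        exact hn.trans (mul_le_mul_of_nonneg_right (Nat.cast_le.2 hm) (hw0 x).le)
      simp [this]
  simpa using h2

end Representation

section WeakLimits

variable {M : Type*} [MeasurableSpace M] {μ : Measure M}

/-! ### Weak sequential completeness of `L^1` -/

lemma sequentiallyNormal_pairingLeft (g : Lp ℂ 1 μ) : SequentiallyNormal (pairingLeft g) := by
  intro A hA hanti hinter
  simp_rw [pairingLeft_apply, pairing_indicatorTop]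
  have hi : Integrable (fun x => conj (g x)) μ :=
    Complex.conjCLE.toContinuousLinearMap.integrable_comp (L1.integrable g)
  have := tendsto_setIntegral_of_antitone (f := fun x => conj (g x)) hA hanti
    ⟨0, hi.integrableOn⟩
  simpa [hinter] using this

/-- The union of the members `B k` of a family of sets that are selected by `x k = true`. -/
def selectedUnion (B : ℕ → Set M) (x : ℕ → Bool) : Set M := ⋃ k, {p | p ∈ B k ∧ x k = true}

lemma measurableSet_selectedUnion {B : ℕ → Set M} (hB : ∀ k, MeasurableSet (B k))
    (x : ℕ → Bool) : MeasurableSet (selectedUnion B x) :=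
  MeasurableSet.iUnion fun k => (hB k).inter (MeasurableSet.const _)

omit [MeasurableSpace M] in
lemma mem_selectedUnion {B : ℕ → Set M} (hd : Pairwise (Function.onFun Disjoint B)) {k : ℕ}
    {p : M} (hp : p ∈ B k) (x : ℕ → Bool) : p ∈ selectedUnion B x ↔ x k = true := by
  constructor
  · intro h
    obtain ⟨j, hj, hj'⟩ := mem_iUnion.1 h
    by_cases hjk : j = k
    · exact hjk ▸ hj'
    · exact ((hd hjk).le_bot ⟨hj, hp⟩).elim
  · exact fun h => mem_iUnion.2 ⟨k, hp, h⟩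

/-- On the Cantor space of subfamilies, integrals over the selected unions are continuous by dominated
convergence. -/
lemma continuous_setIntegral_selectedUnion {B : ℕ → Set M} (hB : ∀ k, MeasurableSet (B k))
    (hd : Pairwise (Function.onFun Disjoint B)) {G : M → ℂ} (hG : Integrable G μ) :
    Continuous fun x : ℕ → Bool => ∫ p in selectedUnion B x, G p ∂μ := by
  simp_rw [← integral_indicator (measurableSet_selectedUnion hB _)]
  refine continuous_of_dominated (bound := fun p => ‖G p‖)
    (fun x => hG.aestronglyMeasurable.indicator (measurableSet_selectedUnion hB x))
    (fun x => ae_of_all _ fun p => norm_indicator_le_norm_self _ _) hG.norm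
    (ae_of_all _ fun p => ?_)
  by_cases hp : ∃ k, p ∈ B k
  · obtain ⟨k, hk⟩ := hp
    have h1 : (fun x : ℕ → Bool => (selectedUnion B x).indicator G p) =
        (fun b : Bool => if b = true then G p else 0) ∘ fun x => x k := by
      ext x
      simp only [indicator, mem_selectedUnion hd hk, Function.comp]
    rw [h1]
    exact continuous_of_discreteTopology.comp (continuous_apply k)
  · have h1 : (fun x : ℕ → Bool => (selectedUnion B x).indicator G p) = fun _ => 0 := by
      ext x
      refine indicator_of_notMem (fun h => ?_) _
      obtain ⟨j, hj, _⟩ := mem_iUnion.1 h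
      exact hp ⟨j, hj⟩
    rw [h1]
    exact continuous_const

/-- Vitali–Hahn–Saks: a pointwise limit of functionals in `L^1` is countably additive.  Baire's
theorem on the Cantor space of subfamilies of a disjoint sequence gives uniformity. -/
lemma sequentiallyNormal_of_tendsto {g : ℕ → Lp ℂ 1 μ} {Λ : Linfty μ →L[ℂ] ℂ}
    (h : ∀ f, Tendsto (fun n => pairing f (g n)) atTop (𝓝 (Λ f))) : SequentiallyNormal Λ := by
  intro A hA hanti hinter
  let B : ℕ → Set M := fun k => A k \ A (k + 1)
  have hB : ∀ k, MeasurableSet (B k) := fun k => (hA k).diff (hA _)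
  have hd' : ∀ i j, i < j → Disjoint (B i) (B j) := fun i j hij =>
    disjoint_left.2 fun p hp hp' => hp.2 (hanti (Nat.succ_le_of_lt hij) hp'.1)
  have hd : Pairwise (Function.onFun Disjoint B) := fun i j hij => by
    rcases lt_or_gt_of_ne hij with h | h
    exacts [hd' i j h, (hd' j i h).symm]
  have hcover : ∀ m p, p ∈ A m → ∃ k, m ≤ k ∧ p ∈ B k := by
    intro m p hp
    by_contra hcon
    push Not at hcon
    have : ∀ k, m ≤ k → p ∈ A k := fun k hk => by
      induction k, hk using Nat.le_induction with
      | base => exact hp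
      | succ k hk ih =>
        by_contra hne
        exact hcon k hk ⟨ih, hne⟩
    have h2 : p ∈ ⋂ n, A n := mem_iInter.2 fun n =>
      hanti (le_max_left n m) (this _ (le_max_right n m))
    rw [hinter] at h2
    exact h2
  let Φ : ℕ → (ℕ → Bool) → ℂ := fun n x =>
    pairing (indicatorTop μ (measurableSet_selectedUnion hB x)) (g n)
  have hΦ : ∀ n, Continuous (Φ n) := fun n => by
    have hi : Integrable (fun x => conj (g n x)) μ :=
      Complex.conjCLE.toContinuousLinearMap.integrable_comp (L1.integrable (g n))
    simp only [Φ, pairing_indicatorTop]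
    exact continuous_setIntegral_selectedUnion hB hd hi
  rw [Metric.tendsto_atTop]
  intro ε hε
  let F : ℕ → Set (ℕ → Bool) := fun N => ⋂ n ≥ N, {x | ‖Φ n x - Φ N x‖ ≤ ε / 8}
  have hFc : ∀ N, IsClosed (F N) := fun N => isClosed_biInter fun n _ =>
    isClosed_le (((hΦ n).sub (hΦ N)).norm) continuous_const
  have hFU : ⋃ N, F N = univ := by
    rw [eq_univ_iff_forall]
    intro x
    obtain ⟨N, hN⟩ := Metric.cauchySeq_iff'.1
      (h (indicatorTop μ (measurableSet_selectedUnion hB x))).cauchySeq (ε / 8) (by positivity)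
    refine mem_iUnion.2 ⟨N, mem_iInter₂.2 fun n hn => ?_⟩
    rw [mem_ofPred_eq, ← dist_eq_norm]
    exact (hN n hn).le
  obtain ⟨N, x₀, hx₀⟩ := nonempty_interior_of_iUnion_of_closed hFc hFU
  obtain ⟨I, u, hIu, hIF⟩ := isOpen_pi_iff.1 isOpen_interior x₀ hx₀
  have hcyl : ∀ x : ℕ → Bool, (∀ k ≤ I.sup id, x k = x₀ k) → x ∈ F N := fun x hx =>
    interior_subset (hIF fun k hk => by
      rw [hx k (Finset.le_sup (f := id) hk)]
      exact (hIu k hk).2)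
  -- the difference of two points of the cylinder is the indicator of `A m`
  have hdiff : ∀ m, I.sup id < m → ∃ x y, x ∈ F N ∧ y ∈ F N ∧
      indicatorTop μ (measurableSet_selectedUnion hB x) =
        indicatorTop μ (measurableSet_selectedUnion hB y) + indicatorTop μ (hA m) := by
    intro m hm
    refine ⟨fun k => if m ≤ k then true else x₀ k, fun k => if m ≤ k then false else x₀ k,
      hcyl _ fun k hk => if_neg (by omega), hcyl _ fun k hk => if_neg (by omega), ?_⟩
    rw [← indicatorTop_union]
    · congr 1
      ext p
      constructor
      · intro hp
        obtain ⟨k, hk, hk'⟩ := mem_iUnion.1 hp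
        by_cases hmk : m ≤ k
        · exact Or.inr (hanti hmk hk.1)
        · refine Or.inl ((mem_selectedUnion hd hk _).2 ?_)
          simpa [hmk] using hk'
      · rintro (hp | hp)
        · obtain ⟨k, hk, hk'⟩ := mem_iUnion.1 hp
          refine (mem_selectedUnion hd hk _).2 ?_
          by_cases hmk : m ≤ k
          · simp [hmk]
          · simpa [hmk] using hk'
        · obtain ⟨k, hk, hk'⟩ := hcover m p hp
          exact (mem_selectedUnion hd hk' _).2 (by simp [hk])
    · refine disjoint_left.2 fun p hp hp' => ?_
      obtain ⟨k, hk, hk'⟩ := hcover m p hp'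
      have := (mem_selectedUnion hd hk' _).1 hp
      simp [hk] at this
  have hN0 := sequentiallyNormal_pairingLeft (g N) A hA hanti hinter
  obtain ⟨m₀, hm₀⟩ := Metric.tendsto_atTop.1 hN0 (ε / 4) (by positivity)
  refine ⟨max m₀ (I.sup id + 1), fun m hm => ?_⟩
  rw [ge_iff_le, max_le_iff] at hm
  obtain ⟨x, y, hx, hy, hxy⟩ := hdiff m (Nat.lt_of_succ_le hm.2)
  have h1 : ∀ n ≥ N, ‖pairing (indicatorTop μ (hA m)) (g n) -
      pairing (indicatorTop μ (hA m)) (g N)‖ ≤ ε / 4 := fun n hn => by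
    have e : ∀ k, pairing (indicatorTop μ (hA m)) (g k) = Φ k x - Φ k y := fun k => by
      simp only [Φ, hxy, pairing_add_left]
      ring
    have hx' := mem_iInter₂.1 hx n hn
    have hy' := mem_iInter₂.1 hy n hn
    rw [mem_ofPred_eq] at hx' hy'
    rw [e, e, show Φ n x - Φ n y - (Φ N x - Φ N y) = (Φ n x - Φ N x) - (Φ n y - Φ N y) by ring]
    exact (norm_sub_le _ _).trans (by linarith)
  have h2 : ‖Λ (indicatorTop μ (hA m)) - pairing (indicatorTop μ (hA m)) (g N)‖ ≤ ε / 4 :=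
    le_of_tendsto ((h _).sub_const _).norm (eventually_atTop.2 ⟨N, h1⟩)
  have h3 := hm₀ m hm.1
  rw [dist_zero_right, pairingLeft_apply] at h3
  rw [dist_zero_right]
  have h4 := norm_add_le (Λ (indicatorTop μ (hA m)) - pairing (indicatorTop μ (hA m)) (g N))
    (pairing (indicatorTop μ (hA m)) (g N))
  rw [sub_add_cancel] at h4
  linarith

/-- `L^1` is weakly sequentially complete. -/
lemma exists_pairing_of_tendsto [SigmaFinite μ] {g : ℕ → Lp ℂ 1 μ} {Λ : Linfty μ → ℂ}
    (h : ∀ f, Tendsto (fun n => pairing f (g n)) atTop (𝓝 (Λ f))) :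
    ∃ k : Lp ℂ 1 μ, ∀ f, Λ f = pairing f k := by
  let Λ' : Linfty μ →L[ℂ] ℂ := continuousLinearMapOfTendsto (fun n => pairingLeft (g n))
    (f := Λ) (tendsto_pi_nhds.2 h)
  obtain ⟨k, hk⟩ := (sequentiallyNormal_of_tendsto (Λ := Λ') h).exists_pairing
  exact ⟨k, hk⟩

end WeakLimits

section Order

variable {M : Type*} [MeasurableSpace M] {μ : Measure M}

/-! ### Products, conjugation and order -/

instance : StarAddMonoid (Linfty μ) where
  star_add f g := by
    refine Lp.ext ?_
    filter_upwards [Lp.coeFn_star (f + g), Lp.coeFn_star f, Lp.coeFn_star g, Lp.coeFn_add f g,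
      Lp.coeFn_add (star f) (star g)] with x h1 h2 h3 h4 h5
    rw [h1, h5, Pi.add_apply, h2, h3, Pi.star_apply, h4, Pi.add_apply, star_add]
    rfl

instance : StarModule ℂ (Linfty μ) where
  star_smul c f := by
    refine Lp.ext ?_
    filter_upwards [Lp.coeFn_star (c • f), Lp.coeFn_star f, Lp.coeFn_smul c f,
      Lp.coeFn_smul (star c) (star f)] with x h1 h2 h3 h4
    rw [h1, h4, Pi.star_apply, h3, Pi.smul_apply, Pi.smul_apply, h2, star_smul]
    rfl

/-- The pointwise product of two functions in `L^∞`. -/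
def Linfty.mul (f g : Linfty μ) : Linfty μ := f • g

/-- The pointwise product of a function in `L^∞` and a function in `L^1`. -/
def L1.mul (f : Linfty μ) (g : Lp ℂ 1 μ) : Lp ℂ 1 μ := f • g

lemma Linfty.coeFn_mul (f g : Linfty μ) : Linfty.mul f g =ᵐ[μ] fun x => f x * g x :=
  Lp.coeFn_lpSMul f g

lemma L1.coeFn_mul (f : Linfty μ) (g : Lp ℂ 1 μ) : L1.mul f g =ᵐ[μ] fun x => f x * g x :=
  Lp.coeFn_lpSMul f g

lemma absSq_eq_mul (f : Linfty μ) : absSq f = Linfty.mul (star f) f := rfl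

lemma Linfty.coeFn_star (f : Linfty μ) : (star f : Linfty μ) =ᵐ[μ] fun x => conj (f x) :=
  Lp.coeFn_star f

lemma coeFn_absSq (f : Linfty μ) : absSq f =ᵐ[μ] fun x => ((‖f x‖ ^ 2 : ℝ) : ℂ) := by
  filter_upwards [Linfty.coeFn_mul (star f) f, Linfty.coeFn_star f] with x h1 h2
  rw [absSq_eq_mul, h1, h2, mul_comm, Complex.mul_conj, Complex.normSq_eq_norm_sq]

lemma isNonneg_absSq (f : Linfty μ) : IsNonneg (absSq f) := by
  unfold IsNonneg
  filter_upwards [coeFn_absSq f] with x hx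
  rw [hx]
  exact_mod_cast sq_nonneg ‖f x‖

lemma Linfty.norm_star (f : Linfty μ) : ‖star f‖ = ‖f‖ := by
  have h : ∀ f : Linfty μ, ‖star f‖ ≤ ‖f‖ := fun f => by
    refine Linfty.norm_le (norm_nonneg _) ?_
    filter_upwards [Linfty.coeFn_star f, Linfty.ae_norm_le f] with x h1 h2
    rwa [h1, RCLike.norm_conj]
  exact le_antisymm (h f) (by simpa using h (star f))

lemma norm_absSq (f : Linfty μ) : ‖absSq f‖ = ‖f‖ ^ 2 := by
  refine le_antisymm (Linfty.norm_le (by positivity) ?_) ?_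
  · filter_upwards [coeFn_absSq f, Linfty.ae_norm_le f] with x h1 h2
    rw [h1, Complex.norm_real, Real.norm_of_nonneg (by positivity)]
    gcongr
  · have : ‖f‖ ≤ √‖absSq f‖ := Linfty.norm_le (Real.sqrt_nonneg _) (by
      filter_upwards [coeFn_absSq f, Linfty.ae_norm_le (absSq f)] with x h1 h2
      rw [h1, Complex.norm_real, Real.norm_of_nonneg (by positivity)] at h2
      exact Real.le_sqrt_of_sq_le h2)
    exact (Real.le_sqrt (norm_nonneg _) (norm_nonneg _)).1 this

lemma absSq_smul (c : ℂ) (f : Linfty μ) : absSq (c • f) = (((‖c‖ ^ 2 : ℝ)) : ℂ) • absSq f := by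
  refine Lp.ext ?_
  filter_upwards [coeFn_absSq f, coeFn_absSq (c • f), Lp.coeFn_smul c f,
    Lp.coeFn_smul (((‖c‖ ^ 2 : ℝ)) : ℂ) (absSq f)] with x h1 h2 h3 h4
  rw [h4, Pi.smul_apply, h1, h2, h3, Pi.smul_apply, norm_smul]
  push_cast
  simp
  ring

lemma pairing_mul_star (f h : Linfty μ) (g : Lp ℂ 1 μ) :
    pairing (Linfty.mul (star f) h) g = pairing h (L1.mul f g) := by
  refine integral_congr_ae ?_
  filter_upwards [Linfty.coeFn_mul (star f) h, Linfty.coeFn_star f, L1.coeFn_mul f g]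
    with x h1 h2 h3
  rw [h1, h2, h3, map_mul]
  ring

/-- The constant function `1`. -/
def Linfty.one (μ : Measure M) : Linfty μ := indicatorTop μ MeasurableSet.univ

lemma Linfty.coeFn_one : Linfty.one μ =ᵐ[μ] fun _ => (1 : ℂ) := by
  filter_upwards [coeFn_indicatorTop (μ := μ) MeasurableSet.univ] with x hx
  rw [Linfty.one, hx]
  simp

lemma Linfty.norm_one_le : ‖Linfty.one μ‖ ≤ 1 := norm_indicatorTop_le _

lemma isNonneg_one : IsNonneg (Linfty.one μ) := by
  unfold IsNonneg
  filter_upwards [Linfty.coeFn_one (μ := μ)] with x hx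
  rw [hx]
  exact zero_le_one

lemma IsNonneg.star_eq {f : Linfty μ} (hf : IsNonneg f) : star f = f := by
  refine Lp.ext ?_
  filter_upwards [hf, Linfty.coeFn_star f] with x h1 h2
  rw [h2]
  exact Complex.conj_eq_iff_im.2 (Complex.nonneg_iff.1 h1).2.symm

lemma isNonneg_norm_sub_of_star_eq {f : Linfty μ} (hf : star f = f) :
    IsNonneg ((‖f‖ : ℂ) • Linfty.one μ - f) := by
  unfold IsNonneg
  have h0 : (f : M → ℂ) =ᵐ[μ] fun x => conj (f x) := by
    conv_lhs => rw [← hf]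
    exact Linfty.coeFn_star f
  filter_upwards [h0, Linfty.ae_norm_le f, Lp.coeFn_sub ((‖f‖ : ℂ) • Linfty.one μ) f,
    Lp.coeFn_smul (‖f‖ : ℂ) (Linfty.one μ), Linfty.coeFn_one (μ := μ)] with x h1 h2 h3 h4 h5
  rw [h3, Pi.sub_apply, h4, Pi.smul_apply, h5, Complex.nonneg_iff]
  have him := Complex.conj_eq_iff_im.1 h1.symm
  have := (Complex.abs_re_le_norm (f x)).trans h2
  simp [him]
  exact (le_abs_self _).trans this

/-- `S` maps nonnegative functions to nonnegative functions. -/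
def IsPositiveOp (S : Linfty μ →L[ℂ] Linfty μ) : Prop := ∀ f, IsNonneg f → IsNonneg (S f)

lemma IsPositiveOp.map_star {S : Linfty μ →L[ℂ] Linfty μ} (hS : IsPositiveOp S) (f : Linfty μ) :
    S (star f) = star (S f) := by
  have hreal : ∀ h : Linfty μ, star h = h → star (S h) = S h := by
    intro h hh
    have h1 := (hS _ (isNonneg_norm_sub_of_star_eq hh)).star_eq
    have h2 := (hS _ (isNonneg_one (μ := μ))).star_eq
    rw [map_sub, map_smul, star_sub, star_smul, h2] at h1
    simpa using h1
  have h1 := hreal (f + star f) (by rw [star_add, star_star, add_comm])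
  have h2 := hreal (Complex.I • (f - star f)) (by
    rw [star_smul, star_sub, star_star]
    simp [add_comm, sub_eq_add_neg])
  rw [map_add, star_add] at h1
  rw [map_smul, map_sub, star_smul, star_sub, Complex.star_def, Complex.conj_I, neg_smul,
    ← smul_neg] at h2
  have h3 := smul_right_injective _ Complex.I_ne_zero h2
  rw [neg_sub] at h3
  -- sum of the identities for the real and for the imaginary part
  have h4 : (2 : ℂ) • S (star f) = (2 : ℂ) • star (S f) := by
    rw [two_smul, two_smul]
    have e1 : S (star f) = star (S f) + star (S (star f)) - S f := by rw [h1]; abel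
    have e2 : S (star f) = S f - (star (S (star f)) - star (S f)) := by rw [h3]; abel
    calc S (star f) + S (star f) = (star (S f) + star (S (star f)) - S f) +
        (S f - (star (S (star f)) - star (S f))) := by rw [← e1, ← e2]
      _ = _ := by abel
  exact smul_right_injective _ two_ne_zero h4

/-- The defect `S|F|² - |SF|²` in the Kadison–Schwarz inequality. -/
def schwarzDefect (S : Linfty μ →L[ℂ] Linfty μ) (F : Linfty μ) : Linfty μ :=
  S (absSq F) - absSq (S F)

/-- The Kadison–Schwarz inequality `|SF|² ≤ S|F|²`, from `0 ≤ S|F - z|²` for constants `z` in a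
countable dense set. -/
lemma IsPositiveOp.isNonneg_schwarzDefect {S : Linfty μ →L[ℂ] Linfty μ} (hS : IsPositiveOp S)
    (hS1 : ‖S‖ ≤ 1) (F : Linfty μ) : IsNonneg (schwarzDefect S F) := by
  have key : ∀ z : ℂ, ∀ᵐ x ∂μ, 0 ≤ (S (absSq F) x).re - 2 * (conj z * S F x).re + ‖z‖ ^ 2 := by
    intro z
    have e : absSq (F - z • Linfty.one μ) = absSq F - conj z • F - z • star F +
        (((‖z‖ ^ 2 : ℝ)) : ℂ) • Linfty.one μ := by
      refine Lp.ext ?_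
      filter_upwards [coeFn_absSq F, coeFn_absSq (F - z • Linfty.one μ),
        Lp.coeFn_sub F (z • Linfty.one μ), Lp.coeFn_smul z (Linfty.one μ),
        Linfty.coeFn_one (μ := μ), Linfty.coeFn_star F,
        Lp.coeFn_add (absSq F - conj z • F - z • star F) ((((‖z‖ ^ 2 : ℝ)) : ℂ) • Linfty.one μ),
        Lp.coeFn_sub (absSq F - conj z • F) (z • star F), Lp.coeFn_sub (absSq F) (conj z • F),
        Lp.coeFn_smul (conj z) F, Lp.coeFn_smul z (star F),
        Lp.coeFn_smul (((‖z‖ ^ 2 : ℝ)) : ℂ) (Linfty.one μ)] with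
        x h1 h2 h3 h4 h5 h6 h7 h8 h9 h10 h11 h12
      simp only [h2, h3, h7, h8, h9, h10, h11, h12, h4, h1, h5, h6, Pi.add_apply, Pi.sub_apply,
        Pi.smul_apply]
      rw [← Complex.normSq_eq_norm_sq, ← Complex.normSq_eq_norm_sq, ← Complex.normSq_eq_norm_sq,
        ← Complex.mul_conj, ← Complex.mul_conj, ← Complex.mul_conj]
      simp
      ring
    have h1 := hS _ (isNonneg_absSq (F - z • Linfty.one μ))
    rw [e, map_add, map_sub, map_sub, map_smul, map_smul, map_smul, hS.map_star] at h1
    have hone : ∀ᵐ x ∂μ, (S (Linfty.one μ) x).re ≤ 1 := by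
      filter_upwards [Linfty.ae_norm_le (S (Linfty.one μ))] with x hx
      refine (Complex.re_le_norm _).trans (hx.trans ((S.le_opNorm _).trans ?_))
      exact mul_le_one₀ hS1 (norm_nonneg _) Linfty.norm_one_le
    filter_upwards [h1, hone, Linfty.coeFn_star (S F),
      Lp.coeFn_add (S (absSq F) - conj z • S F - z • star (S F))
        ((((‖z‖ ^ 2 : ℝ)) : ℂ) • S (Linfty.one μ)),
      Lp.coeFn_sub (S (absSq F) - conj z • S F) (z • star (S F)),
      Lp.coeFn_sub (S (absSq F)) (conj z • S F),
      Lp.coeFn_smul (conj z) (S F), Lp.coeFn_smul z (star (S F)),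
      Lp.coeFn_smul (((‖z‖ ^ 2 : ℝ)) : ℂ) (S (Linfty.one μ))] with
      x h1 h2 h3 h4 h5 h6 h7 h8 h9
    rw [h4, Pi.add_apply, h5, Pi.sub_apply, h6, Pi.sub_apply, h7, h8, h9, Pi.smul_apply,
      Pi.smul_apply, Pi.smul_apply, h3] at h1
    have h10 := (Complex.nonneg_iff.1 h1).1
    have h11 : ‖z‖ ^ 2 * (S (Linfty.one μ) x).re ≤ ‖z‖ ^ 2 :=
      mul_le_of_le_one_right (by positivity) h2
    simp only [Complex.add_re, Complex.sub_re, smul_eq_mul, Complex.mul_re, Complex.conj_re,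
      Complex.conj_im, Complex.ofReal_re, Complex.ofReal_im] at h10 ⊢
    linarith
  have hall : ∀ᵐ x ∂μ, ∀ n : ℕ, 0 ≤ (S (absSq F) x).re -
      2 * (conj (TopologicalSpace.denseSeq ℂ n) * S F x).re +
        ‖TopologicalSpace.denseSeq ℂ n‖ ^ 2 := ae_all_iff.2 fun n => key _
  unfold IsNonneg schwarzDefect
  filter_upwards [hall, Lp.coeFn_sub (S (absSq F)) (absSq (S F)), coeFn_absSq (S F),
    hS _ (isNonneg_absSq F)] with x h1 h2 h3 h4
  have h5 : ∀ z : ℂ, 0 ≤ (S (absSq F) x).re - 2 * (conj z * S F x).re + ‖z‖ ^ 2 := by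
    intro z
    have hc : IsClosed {z : ℂ | 0 ≤ (S (absSq F) x).re - 2 * (conj z * S F x).re + ‖z‖ ^ 2} :=
      isClosed_le continuous_const (by fun_prop)
    refine hc.closure_subset_iff.2 ?_
      ((TopologicalSpace.denseRange_denseSeq ℂ).closure_range ▸ mem_univ z)
    rintro _ ⟨n, rfl⟩
    exact h1 n
  have h6 := h5 (S F x)
  rw [h2, Pi.sub_apply, h3, Complex.nonneg_iff]
  have h7 := (Complex.nonneg_iff.1 h4).2
  rw [mul_comm (conj _), Complex.mul_conj, Complex.ofReal_re, Complex.normSq_eq_norm_sq] at h6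
  constructor
  · rw [Complex.sub_re, Complex.ofReal_re]
    linarith
  · rw [Complex.sub_im, Complex.ofReal_im, ← h7, sub_zero]

end Order

section NormalOperators

variable {M : Type*} [MeasurableSpace M] {μ : Measure M}

/-! ### Normal operators and real pairings -/

/-- The operator `S` on `L^∞` is the adjoint of an operator on `L^1`. -/
def IsNormalOp (S : Linfty μ →L[ℂ] Linfty μ) : Prop :=
  ∀ g : Lp ℂ 1 μ, ∃ g' : Lp ℂ 1 μ, ∀ f, pairing (S f) g = pairing f g'

lemma isNormalOp_of_sequentiallyNormal [SigmaFinite μ] {S : Linfty μ →L[ℂ] Linfty μ}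
    (h : ∀ g, SequentiallyNormal ((pairingLeft g).comp S)) : IsNormalOp S := fun g => by
  obtain ⟨g', h'⟩ := (h g).exists_pairing
  exact ⟨g', h'⟩

lemma isNormalOp_of_continuous [SigmaFinite μ] {S : Linfty μ →L[ℂ] Linfty μ}
    (hS : Continuous[weakStar μ, weakStar μ] S) : IsNormalOp S := by
  refine isNormalOp_of_sequentiallyNormal fun g A hA hanti hinter => ?_
  have h0 : Tendsto (fun n => indicatorTop μ (hA n)) atTop (@nhds _ (weakStar μ) 0) := by
    rw [nhds_induced, tendsto_comap_iff, tendsto_pi_nhds]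
    intro g
    have := sequentiallyNormal_pairingLeft g A hA hanti hinter
    simpa using this
  have h1 := (@Continuous.tendsto _ _ (weakStar μ) (weakStar μ) _ hS 0).comp h0
  rw [map_zero, nhds_induced, tendsto_comap_iff, tendsto_pi_nhds] at h1
  simpa using h1 g

/-- A positive contraction of `L^∞` that is the adjoint of an operator on `L^1`. -/
structure IsSubMarkov (S : Linfty μ →L[ℂ] Linfty μ) : Prop where
  norm_le : ‖S‖ ≤ 1
  positive : IsPositiveOp S
  normal : IsNormalOp S

/-- `Re ⟨F, g⟩`. -/
def rePairing (g : Lp ℂ 1 μ) (F : Linfty μ) : ℝ := (pairing F g).re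

lemma rePairing_add (g : Lp ℂ 1 μ) (F G : Linfty μ) :
    rePairing g (F + G) = rePairing g F + rePairing g G := by
  simp [rePairing, pairing_add_left]

lemma rePairing_sub (g : Lp ℂ 1 μ) (F G : Linfty μ) :
    rePairing g (F - G) = rePairing g F - rePairing g G := by
  simp [rePairing, pairing_sub_left]

lemma rePairing_smul (g : Lp ℂ 1 μ) (c : ℝ) (F : Linfty μ) :
    rePairing g ((c : ℂ) • F) = c * rePairing g F := by
  rw [rePairing, pairing_smul_left, Complex.re_ofReal_mul, rePairing]

lemma rePairing_sum {ι : Type*} (s : Finset ι) (g : Lp ℂ 1 μ) (F : ι → Linfty μ) :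
    rePairing g (∑ i ∈ s, F i) = ∑ i ∈ s, rePairing g (F i) := by
  simp [rePairing, pairing_sum_left]

lemma rePairing_nonneg {g : Lp ℂ 1 μ} (hg : L1.IsNonneg g) {F : Linfty μ} (hF : IsNonneg F) :
    0 ≤ rePairing g F := (Complex.nonneg_iff.1 (pairing_nonneg hF hg)).1

lemma pairing_eq_rePairing {g : Lp ℂ 1 μ} (hg : L1.IsNonneg g) {F : Linfty μ} (hF : IsNonneg F) :
    pairing F g = (rePairing g F : ℂ) :=
  Complex.ext rfl (by simpa using (Complex.nonneg_iff.1 (pairing_nonneg hF hg)).2.symm)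

lemma rePairing_le_norm (g : Lp ℂ 1 μ) (F : Linfty μ) : rePairing g F ≤ ‖F‖ * ‖g‖ :=
  (Complex.re_le_norm _).trans (norm_pairing_le F g)

/-- The function `|g|` in `L^1`. -/
def L1.abs (g : Lp ℂ 1 μ) : Lp ℂ 1 μ :=
  Integrable.toL1 (fun x => ((‖g x‖ : ℝ) : ℂ)) (L1.integrable g).norm.ofReal

lemma L1.coeFn_abs (g : Lp ℂ 1 μ) : L1.abs g =ᵐ[μ] fun x => ((‖g x‖ : ℝ) : ℂ) :=
  Integrable.coeFn_toL1 _

lemma L1.isNonneg_abs (g : Lp ℂ 1 μ) : L1.IsNonneg (L1.abs g) := by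
  unfold L1.IsNonneg
  filter_upwards [L1.coeFn_abs g] with x hx
  rw [hx]
  exact_mod_cast norm_nonneg (g x)

lemma L1.norm_abs (g : Lp ℂ 1 μ) : ‖L1.abs g‖ = ‖g‖ := by
  rw [L1.norm_eq_integral, L1.norm_eq_integral]
  refine integral_congr_ae ?_
  filter_upwards [L1.coeFn_abs g] with x hx
  rw [hx, Complex.norm_real, norm_norm]

lemma norm_pairing_le_rePairing_abs {F : Linfty μ} (hF : IsNonneg F) (g : Lp ℂ 1 μ) :
    ‖pairing F g‖ ≤ rePairing (L1.abs g) F := by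
  have h1 : pairing F (L1.abs g) = ((∫ x, ‖F x * conj (g x)‖ ∂μ : ℝ) : ℂ) := by
    rw [← integral_complex_ofReal]
    refine integral_congr_ae ?_
    filter_upwards [hF, L1.coeFn_abs g] with x hx h2
    rw [h2, Complex.conj_ofReal, norm_mul, RCLike.norm_conj, Complex.ofReal_mul,
      Complex.norm_of_nonneg' hx]
  rw [rePairing, h1, Complex.ofReal_re]
  exact norm_integral_le_integral_norm _

lemma norm_le_of_rePairing_le [SigmaFinite μ] {F : Linfty μ} (hF : IsNonneg F) {C : ℝ}
    (hC : 0 ≤ C) (h : ∀ g, L1.IsNonneg g → rePairing g F ≤ C * ‖g‖) : ‖F‖ ≤ C :=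
  Linfty.norm_le_of_forall_pairing hC fun g =>
    (norm_pairing_le_rePairing_abs hF g).trans
      ((h _ (L1.isNonneg_abs g)).trans_eq (by rw [L1.norm_abs]))

lemma isNonneg_toL1_of_forall_pairing {g : Lp ℂ 1 μ}
    (h : ∀ f : Linfty μ, IsNonneg f → 0 ≤ pairing f g) : L1.IsNonneg g := by
  have key : ∀ A : Set M, MeasurableSet A → 0 ≤ ∫ x in A, conj (g x) ∂μ := by
    intro A hA
    rw [← pairing_indicatorTop hA]
    refine h _ ?_
    unfold IsNonneg
    filter_upwards [coeFn_indicatorTop (μ := μ) hA] with x hx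
    rw [hx]
    by_cases hx' : x ∈ A <;> simp [hx']
  have hi : Integrable (fun x => conj (g x)) μ :=
    Complex.conjCLE.toContinuousLinearMap.integrable_comp (L1.integrable g)
  have hre : ∀ A : Set M, ∫ x in A, (conj (g x)).re ∂μ = (∫ x in A, conj (g x) ∂μ).re :=
    fun A => integral_re hi.integrableOn
  have him : ∀ A : Set M, ∫ x in A, (conj (g x)).im ∂μ = (∫ x in A, conj (g x) ∂μ).im :=
    fun A => integral_im hi.integrableOn
  have h1 : 0 ≤ᵐ[μ] fun x => (conj (g x)).re := by
    refine ae_nonneg_of_forall_setIntegral_nonneg hi.re fun A hA hμ => ?_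
    exact (Complex.nonneg_iff.1 (key A hA)).1.trans_eq (hre A).symm
  have h2 : (fun x => (conj (g x)).im) =ᵐ[μ] 0 := by
    refine Integrable.ae_eq_zero_of_forall_setIntegral_eq_zero hi.im fun A hA hμ => ?_
    exact (him A).trans (Complex.nonneg_iff.1 (key A hA)).2.symm
  unfold L1.IsNonneg
  filter_upwards [h1, h2] with x hx hx'
  have h3 : (g x).im = 0 := by simpa using hx'
  exact Complex.nonneg_iff.2 ⟨by simpa using hx, h3.symm⟩

lemma IsSubMarkov.exists_adjoint {S : Linfty μ →L[ℂ] Linfty μ} (hS : IsSubMarkov S)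
    {g : Lp ℂ 1 μ} (hg : L1.IsNonneg g) :
    ∃ g' : Lp ℂ 1 μ, L1.IsNonneg g' ∧ ‖g'‖ ≤ ‖g‖ ∧ ∀ f, pairing (S f) g = pairing f g' := by
  obtain ⟨g', h⟩ := hS.normal g
  refine ⟨g', isNonneg_toL1_of_forall_pairing fun f hf => ?_,
    L1.norm_le_of_forall_pairing (norm_nonneg _) fun f => ?_, h⟩
  · rw [← h]
    exact pairing_nonneg (hS.positive f hf) hg
  · rw [← h, mul_comm]
    refine (norm_pairing_le _ _).trans (mul_le_mul_of_nonneg_right ?_ (norm_nonneg _))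
    exact (S.le_opNorm f).trans (mul_le_of_le_one_left (norm_nonneg _) hS.norm_le)

lemma IsSubMarkov.norm_apply_le {S : Linfty μ →L[ℂ] Linfty μ} (hS : IsSubMarkov S)
    (F : Linfty μ) : ‖S F‖ ≤ ‖F‖ :=
  (S.le_opNorm F).trans (mul_le_of_le_one_left (norm_nonneg _) hS.norm_le)

/-! ### Seminorms that are suprema of functionals in `L^1` -/

/-- A seminorm each of whose values is attained by a functional in `L^1` below the seminorm. -/
def IsDualSeminorm (p : Linfty μ → ℝ) : Prop :=
  ∀ x, ∃ g : Lp ℂ 1 μ, (∀ y, ‖pairing y g‖ ≤ p y) ∧ pairing x g = p x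

lemma IsDualSeminorm.nonneg {p : Linfty μ → ℝ} (hp : IsDualSeminorm p) (x : Linfty μ) :
    0 ≤ p x := by
  obtain ⟨g, hg, _⟩ := hp x
  exact (norm_nonneg _).trans (hg x)

lemma IsDualSeminorm.le_of_forall {p : Linfty μ → ℝ} (hp : IsDualSeminorm p) {x : Linfty μ}
    {C : ℝ} (h : ∀ g : Lp ℂ 1 μ, (∀ y, ‖pairing y g‖ ≤ p y) → ‖pairing x g‖ ≤ C) : p x ≤ C := by
  obtain ⟨g, hg, hx⟩ := hp x
  have := h g hg
  rw [hx, Complex.norm_real] at this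
  exact (Real.le_norm_self _).trans this

lemma IsDualSeminorm.add_le {p : Linfty μ → ℝ} (hp : IsDualSeminorm p) (x y : Linfty μ) :
    p (x + y) ≤ p x + p y := hp.le_of_forall fun g hg => by
  rw [pairing_add_left]
  exact (norm_add_le _ _).trans (add_le_add (hg x) (hg y))

lemma IsDualSeminorm.smul_le {p : Linfty μ → ℝ} (hp : IsDualSeminorm p) (c : ℂ) (x : Linfty μ) :
    p (c • x) ≤ ‖c‖ * p x := hp.le_of_forall fun g hg => by
  rw [pairing_smul_left, norm_mul]
  exact mul_le_mul_of_nonneg_left (hg x) (norm_nonneg _)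

lemma IsDualSeminorm.sub_le {p : Linfty μ → ℝ} (hp : IsDualSeminorm p) (x y : Linfty μ) :
    p (x - y) ≤ p x + p y := hp.le_of_forall fun g hg => by
  rw [pairing_sub_left]
  exact (norm_sub_le _ _).trans (add_le_add (hg x) (hg y))

lemma IsDualSeminorm.le_integral {p : Linfty μ → ℝ} (hp : IsDualSeminorm p) {ν : Measure ℝ}
    {F : ℝ → Linfty μ} {h : Linfty μ} (hF : ∀ g, ∫ u, pairing (F u) g ∂ν = pairing h g)
    {m : ℝ → ℝ} (hm : Integrable m ν) (hle : ∀ᵐ u ∂ν, p (F u) ≤ m u) : p h ≤ ∫ u, m u ∂ν :=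
  hp.le_of_forall fun g hg => by
    rw [← hF]
    refine norm_integral_le_of_norm_le hm ?_
    filter_upwards [hle] with u hu
    exact (hg _).trans hu

/-! ### The seminorm given by the Kadison–Schwarz defect -/

/-- The sesquilinear form `S(x^* y) - (Sx)^* Sy`. -/
def schwarzForm (S : Linfty μ →L[ℂ] Linfty μ) (x y : Linfty μ) : Linfty μ :=
  S (Linfty.mul (star x) y) - Linfty.mul (star (S x)) (S y)

lemma schwarzDefect_id (F : Linfty μ) :
    schwarzDefect (ContinuousLinearMap.id ℂ (Linfty μ)) F = 0 := by
  simp [schwarzDefect]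

lemma schwarzForm_self (S : Linfty μ →L[ℂ] Linfty μ) (x : Linfty μ) :
    schwarzForm S x x = schwarzDefect S x := rfl

lemma Linfty.mul_add_left (x x' y : Linfty μ) :
    Linfty.mul (x + x') y = Linfty.mul x y + Linfty.mul x' y := Lp.smul_add x x' y

lemma Linfty.mul_smul_left (c : ℂ) (x y : Linfty μ) :
    Linfty.mul (c • x) y = c • Linfty.mul x y := Lp.smul_assoc c x y

lemma Linfty.star_mul (x y : Linfty μ) :
    star (Linfty.mul (star x) y) = Linfty.mul (star y) x := by
  refine Lp.ext ?_
  filter_upwards [Linfty.coeFn_star (Linfty.mul (star x) y), Linfty.coeFn_mul (star x) y,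
    Linfty.coeFn_mul (star y) x, Linfty.coeFn_star x, Linfty.coeFn_star y] with x h1 h2 h3 h4 h5
  rw [h1, h2, h3, h4, h5]
  simp [mul_comm]

lemma pairing_star_left {g : Lp ℂ 1 μ} (hg : L1.IsNonneg g) (F : Linfty μ) :
    pairing (star F) g = conj (pairing F g) := by
  rw [pairing, pairing, ← integral_conj]
  refine integral_congr_ae ?_
  filter_upwards [hg, Linfty.coeFn_star F] with x h1 h2
  have : conj (g x) = g x := Complex.conj_eq_iff_im.2 (Complex.nonneg_iff.1 h1).2.symm
  rw [h2, map_mul, this, this]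

lemma schwarzForm_star {S : Linfty μ →L[ℂ] Linfty μ} (hS : IsPositiveOp S) (x y : Linfty μ) :
    star (schwarzForm S x y) = schwarzForm S y x := by
  unfold schwarzForm
  rw [star_sub, ← hS.map_star, Linfty.star_mul, Linfty.star_mul]

/-- For `g ≥ 0`, the positive semidefinite form `⟨S(x^* y) - (Sx)^* Sy, g⟩`. -/
@[reducible] def schwarzCore {S : Linfty μ →L[ℂ] Linfty μ} (hS : IsSubMarkov S) {g : Lp ℂ 1 μ}
    (hg : L1.IsNonneg g) : PreInnerProductSpace.Core ℂ (Linfty μ) where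
  inner x y := pairing (schwarzForm S x y) g
  conj_inner_symm x y := by
    change conj (pairing (schwarzForm S y x) g) = pairing (schwarzForm S x y) g
    rw [← pairing_star_left hg, schwarzForm_star hS.positive]
  re_inner_nonneg x :=
    rePairing_nonneg hg (hS.positive.isNonneg_schwarzDefect hS.norm_le x)
  add_left x y z := by
    rw [← pairing_add_left]
    congr 1
    simp only [schwarzForm, star_add, map_add, Linfty.mul_add_left]
    abel
  smul_left x y r := by
    rw [← pairing_smul_left]
    congr 1
    simp only [schwarzForm, star_smul, map_smul, Linfty.mul_smul_left, smul_sub]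
    rfl

/-- `⟨S|F|² - |SF|², g⟩^{1/2}`. -/
def defectNorm (S : Linfty μ →L[ℂ] Linfty μ) (g : Lp ℂ 1 μ) (F : Linfty μ) : ℝ :=
  √(rePairing g (schwarzDefect S F))

lemma defectNorm_nonneg (S : Linfty μ →L[ℂ] Linfty μ) (g : Lp ℂ 1 μ) (F : Linfty μ) :
    0 ≤ defectNorm S g F := Real.sqrt_nonneg _

lemma defectNorm_sq {S : Linfty μ →L[ℂ] Linfty μ} (hS : IsSubMarkov S) {g : Lp ℂ 1 μ}
    (hg : L1.IsNonneg g) (F : Linfty μ) :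
    defectNorm S g F ^ 2 = rePairing g (schwarzDefect S F) :=
  Real.sq_sqrt (rePairing_nonneg hg (hS.positive.isNonneg_schwarzDefect hS.norm_le F))

lemma isDualSeminorm_defectNorm {S : Linfty μ →L[ℂ] Linfty μ} (hS : IsSubMarkov S)
    {g : Lp ℂ 1 μ} (hg : L1.IsNonneg g) : IsDualSeminorm (defectNorm S g) := by
  intro x
  rcases eq_or_lt_of_le (defectNorm_nonneg S g x) with h0 | h0
  · refine ⟨0, fun y => ?_, ?_⟩
    · rw [pairing_zero_right, norm_zero]
      exact defectNorm_nonneg S g y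
    · rw [pairing_zero_right, ← h0, Complex.ofReal_zero]
  have hrepr : ∃ k : Lp ℂ 1 μ, ∀ y, pairing (schwarzForm S x y) g = pairing y k := by
    obtain ⟨g', h'⟩ := hS.normal g
    obtain ⟨g'', h''⟩ := hS.normal (L1.mul (S x) g)
    refine ⟨L1.mul x g' - g'', fun y => ?_⟩
    rw [schwarzForm, pairing_sub_left, pairing_sub_right, h', pairing_mul_star, pairing_mul_star,
      h'']
  obtain ⟨k, hk⟩ := hrepr
  have hcs : ∀ y, ‖pairing y k‖ ≤ defectNorm S g x * defectNorm S g y := fun y => by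
    rw [← hk]
    have h1 := InnerProductSpace.Core.norm_inner_le_norm (𝕜 := ℂ) (c := schwarzCore hS hg) x y
    exact h1
  have hxk : pairing x k = ((defectNorm S g x ^ 2 : ℝ) : ℂ) := by
    rw [← hk, schwarzForm_self, defectNorm_sq hS hg]
    exact pairing_eq_rePairing hg (hS.positive.isNonneg_schwarzDefect hS.norm_le x)
  refine ⟨(((defectNorm S g x)⁻¹ : ℝ) : ℂ) • k, fun y => ?_, ?_⟩
  · rw [pairing_smul_right, norm_mul, Complex.conj_ofReal, Complex.norm_real,
      Real.norm_of_nonneg (inv_nonneg.2 h0.le), inv_mul_le_iff₀ h0]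
    exact hcs y
  · rw [pairing_smul_right, Complex.conj_ofReal, hxk, ← Complex.ofReal_mul]
    congr 1
    field_simp

lemma rePairing_absSq_le {S : Linfty μ →L[ℂ] Linfty μ} (hS : IsSubMarkov S) {g : Lp ℂ 1 μ}
    (hg : L1.IsNonneg g) (F : Linfty μ) :
    rePairing g (absSq (S F)) ≤ rePairing g (S (absSq F)) := by
  have := rePairing_nonneg hg (hS.positive.isNonneg_schwarzDefect hS.norm_le F)
  rw [schwarzDefect, rePairing_sub] at this
  linarith

lemma rePairing_schwarzDefect_le (S : Linfty μ →L[ℂ] Linfty μ) {g : Lp ℂ 1 μ}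
    (hg : L1.IsNonneg g) (F : Linfty μ) :
    rePairing g (schwarzDefect S F) ≤ rePairing g (S (absSq F)) := by
  have := rePairing_nonneg hg (isNonneg_absSq (S F))
  rw [schwarzDefect, rePairing_sub]
  linarith

end NormalOperators

section Kernels

variable {M : Type*} [MeasurableSpace M] {μ : Measure M} {T : ℝ → Linfty μ →L[ℂ] Linfty μ}

/-! ### Weak* integrals of a semigroup against a kernel -/

namespace IsPositiveContractionSemigroup

lemma isSubMarkov [SigmaFinite μ] (hT : IsPositiveContractionSemigroup T) {t : ℝ} (ht : 0 ≤ t) :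
    IsSubMarkov (T t) where
  norm_le := hT.contraction t ht
  positive := hT.positive t ht
  normal := isNormalOp_of_continuous (hT.weakStar_continuous t ht)

lemma tendsto_right (hT : IsPositiveContractionSemigroup T) {u : ℝ} (hu : 0 ≤ u) (f : Linfty μ)
    (g : Lp ℂ 1 μ) :
    Tendsto (fun v => pairing (T v f) g) (𝓝[>] u) (𝓝 (pairing (T u f) g)) := by
  have h1 : Tendsto (fun v => v - u) (𝓝[>] u) (𝓝[>] 0) := by
    refine tendsto_nhdsWithin_iff.2 ⟨?_, ?_⟩
    · have : Tendsto (fun v : ℝ => v - u) (𝓝 u) (𝓝 (u - u)) := tendsto_id.sub_const u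
      rw [sub_self] at this
      exact this.mono_left nhdsWithin_le_nhds
    · filter_upwards [self_mem_nhdsWithin] with v hv
      have hv' : u < v := hv
      exact mem_Ioi.2 (sub_pos.2 hv')
  refine ((hT.tendsto_zero (T u f) g).comp h1).congr' ?_
  filter_upwards [self_mem_nhdsWithin] with v hv
  have hv' : u < v := hv
  have h2 := hT.add (v - u) u (by linarith) hu
  rw [sub_add_cancel] at h2
  rw [h2]
  rfl

/-- `u ↦ ⟨T_u f, g⟩` is right continuous, hence a limit of functions of `⌊n u⌋`. -/
lemma measurable_pairing (hT : IsPositiveContractionSemigroup T) (f : Linfty μ) (g : Lp ℂ 1 μ) :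
    Measurable ((Ioi (0 : ℝ)).indicator fun u => pairing (T u f) g) := by
  have h1 : ∀ n : ℕ, Measurable ((Ioi (0 : ℝ)).indicator
      fun u => pairing (T ((⌊((n : ℝ) + 1) * u⌋ + 1 : ℝ) / ((n : ℝ) + 1)) f) g) := fun n => by
    refine Measurable.indicator ?_ measurableSet_Ioi
    have h2 : Measurable fun k : ℤ => pairing (T (((k : ℝ) + 1) / ((n : ℝ) + 1)) f) g :=
      measurable_from_top
    exact h2.comp (Int.measurable_floor.comp (measurable_const.mul measurable_id))
  refine measurable_of_tendsto_metrizable h1 (tendsto_pi_nhds.2 fun u => ?_)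
  by_cases hu : u ∈ Ioi (0 : ℝ)
  · simp only [indicator_of_mem hu]
    refine (hT.tendsto_right (le_of_lt hu) f g).comp (tendsto_nhdsWithin_iff.2 ⟨?_, ?_⟩)
    · have hb : ∀ n : ℕ, ‖(⌊((n : ℝ) + 1) * u⌋ + 1 : ℝ) / ((n : ℝ) + 1) - u‖ ≤
          1 / ((n : ℝ) + 1) := fun n => by
        have hn : (0 : ℝ) < (n : ℝ) + 1 := by positivity
        rw [div_sub' hn.ne', norm_div, Real.norm_of_nonneg hn.le]
        gcongr
        have h3 := Int.floor_le (((n : ℝ) + 1) * u)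
        have h4 := Int.lt_floor_add_one (((n : ℝ) + 1) * u)
        rw [Real.norm_eq_abs, abs_le]
        constructor <;> linarith
      exact tendsto_iff_norm_sub_tendsto_zero.2
        (squeeze_zero (fun _ => norm_nonneg _) hb tendsto_one_div_add_atTop_nhds_zero_nat)
    · refine Eventually.of_forall fun n => ?_
      have hn : (0 : ℝ) < (n : ℝ) + 1 := by positivity
      rw [mem_Ioi, lt_div_iff₀ hn, mul_comm]
      exact Int.lt_floor_add_one _
  · simp only [indicator_of_notMem hu]
    exact tendsto_const_nhds

lemma aestronglyMeasurable_pairing (hT : IsPositiveContractionSemigroup T) (f : Linfty μ)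
    (g : Lp ℂ 1 μ) :
    AEStronglyMeasurable (fun u => pairing (T u f) g) (volume.restrict (Ioi 0)) :=
  (hT.measurable_pairing f g).aestronglyMeasurable.congr
    ((indicator_ae_eq_restrict measurableSet_Ioi))

lemma norm_apply_le (hT : IsPositiveContractionSemigroup T) {t : ℝ} (ht : 0 ≤ t) (f : Linfty μ) :
    ‖T t f‖ ≤ ‖f‖ :=
  ((T t).le_opNorm f).trans (mul_le_of_le_one_left (norm_nonneg _) (hT.contraction t ht))

lemma norm_pairing_apply_le (hT : IsPositiveContractionSemigroup T) {t : ℝ} (ht : 0 ≤ t)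
    (f : Linfty μ) (g : Lp ℂ 1 μ) : ‖pairing (T t f) g‖ ≤ ‖f‖ * ‖g‖ :=
  (norm_pairing_le _ _).trans
    (mul_le_mul_of_nonneg_right (hT.norm_apply_le ht f) (norm_nonneg _))

lemma norm_kernel_mul_le (hT : IsPositiveContractionSemigroup T) (k : ℝ → ℝ) (f : Linfty μ)
    (g : Lp ℂ 1 μ) :
    ∀ᵐ u ∂volume.restrict (Ioi 0), ‖(k u : ℂ) * pairing (T u f) g‖ ≤ ‖k u‖ * (‖f‖ * ‖g‖) := by
  filter_upwards [ae_restrict_mem measurableSet_Ioi] with u hu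
  rw [norm_mul, Complex.norm_real]
  exact mul_le_mul_of_nonneg_left (hT.norm_pairing_apply_le (le_of_lt hu) f g) (norm_nonneg _)

lemma integrableOn_kernel (hT : IsPositiveContractionSemigroup T) {k : ℝ → ℝ}
    (hk : IntegrableOn k (Ioi 0)) (f : Linfty μ) (g : Lp ℂ 1 μ) :
    IntegrableOn (fun u => (k u : ℂ) * pairing (T u f) g) (Ioi 0) :=
  (hk.norm.mul_const (‖f‖ * ‖g‖)).mono'
    ((Complex.continuous_ofReal.comp_aestronglyMeasurable hk.aestronglyMeasurable).mul
      (hT.aestronglyMeasurable_pairing f g)) (hT.norm_kernel_mul_le k f g)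

lemma norm_integral_kernel_le (hT : IsPositiveContractionSemigroup T) {k : ℝ → ℝ}
    (hk : IntegrableOn k (Ioi 0)) (f : Linfty μ) (g : Lp ℂ 1 μ) :
    ‖∫ u in Ioi 0, (k u : ℂ) * pairing (T u f) g‖ ≤ (∫ u in Ioi 0, ‖k u‖) * (‖f‖ * ‖g‖) := by
  rw [← integral_mul_const]
  exact norm_integral_le_of_norm_le (hk.norm.mul_const (‖f‖ * ‖g‖)) (hT.norm_kernel_mul_le k f g)

/-- The weak* integral of the orbit against an integrable kernel exists, as a bounded functional on
`L^1` is given by an element of `L^∞`. -/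
lemma exists_kernelOp [SigmaFinite μ] (hT : IsPositiveContractionSemigroup T) {k : ℝ → ℝ}
    (hk : IntegrableOn k (Ioi 0)) :
    ∃ S : Linfty μ →L[ℂ] Linfty μ,
      ∀ f g, pairing (S f) g = ∫ u in Ioi 0, (k u : ℂ) * pairing (T u f) g := by
  have hC : 0 ≤ ∫ u in Ioi 0, ‖k u‖ := integral_nonneg fun _ => norm_nonneg _
  have h1 : ∀ f : Linfty μ, ∃ h : Linfty μ, ‖h‖ ≤ (∫ u in Ioi 0, ‖k u‖) * ‖f‖ ∧
      ∀ g, pairing h g = ∫ u in Ioi 0, (k u : ℂ) * pairing (T u f) g := by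
    intro f
    let Λ : Lp ℂ 1 μ →L⋆[ℂ] ℂ := LinearMap.mkContinuous
      { toFun := fun g => ∫ u in Ioi 0, (k u : ℂ) * pairing (T u f) g
        map_add' := fun g g' => by
          rw [← integral_add (hT.integrableOn_kernel hk f g) (hT.integrableOn_kernel hk f g')]
          simp_rw [pairing_add_right, mul_add]
        map_smul' := fun c g => by
          rw [smul_eq_mul, ← integral_const_mul (conj c)]
          simp_rw [pairing_smul_right]
          refine integral_congr_ae (ae_of_all _ fun u => ?_)
          simp only
          ring } ((∫ u in Ioi 0, ‖k u‖) * ‖f‖) fun g => by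
        rw [mul_assoc]
        exact hT.norm_integral_kernel_le hk f g
    obtain ⟨h, hh, hh'⟩ := exists_pairing_of_bounded Λ (mul_nonneg hC (norm_nonneg f)) fun g => by
      rw [mul_assoc]
      exact hT.norm_integral_kernel_le hk f g
    exact ⟨h, hh, fun g => (hh' g).symm⟩
  choose S hS hS' using h1
  refine ⟨LinearMap.mkContinuous
    { toFun := S
      map_add' := fun f f' => Linfty.ext_pairing fun g => ?_
      map_smul' := fun c f => Linfty.ext_pairing fun g => ?_ } _ hS, hS'⟩
  · rw [pairing_add_left, hS', hS', hS', ← integral_add (hT.integrableOn_kernel hk f g)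
      (hT.integrableOn_kernel hk f' g)]
    simp_rw [map_add, pairing_add_left, mul_add]
  · rw [RingHom.id_apply, pairing_smul_left, hS', hS', ← integral_const_mul c]
    simp_rw [map_smul, pairing_smul_left]
    refine integral_congr_ae (ae_of_all _ fun u => ?_)
    simp only
    ring

end IsPositiveContractionSemigroup

open Classical in
/-- The operator `f ↦ ∫_0^∞ k(u) T_u f du` (a weak* integral). -/
def kernelOp (T : ℝ → Linfty μ →L[ℂ] Linfty μ) (k : ℝ → ℝ) : Linfty μ →L[ℂ] Linfty μ :=
  if h : ∃ S : Linfty μ →L[ℂ] Linfty μ,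
    ∀ f g, pairing (S f) g = ∫ u in Ioi 0, (k u : ℂ) * pairing (T u f) g then h.choose else 0

namespace IsPositiveContractionSemigroup

lemma pairing_kernelOp [SigmaFinite μ] (hT : IsPositiveContractionSemigroup T) {k : ℝ → ℝ}
    (hk : IntegrableOn k (Ioi 0)) (f : Linfty μ) (g : Lp ℂ 1 μ) :
    pairing (kernelOp T k f) g = ∫ u in Ioi 0, (k u : ℂ) * pairing (T u f) g := by
  rw [kernelOp, dif_pos (hT.exists_kernelOp hk)]
  exact (hT.exists_kernelOp hk).choose_spec f g

lemma norm_kernelOp_le [SigmaFinite μ] (hT : IsPositiveContractionSemigroup T) {k : ℝ → ℝ}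
    (hk : IntegrableOn k (Ioi 0)) : ‖kernelOp T k‖ ≤ ∫ u in Ioi 0, ‖k u‖ := by
  have hC : 0 ≤ ∫ u in Ioi 0, ‖k u‖ := integral_nonneg fun _ => norm_nonneg _
  refine ContinuousLinearMap.opNorm_le_bound _ hC fun f =>
    Linfty.norm_le_of_forall_pairing (by positivity) fun g => ?_
  rw [hT.pairing_kernelOp hk, mul_assoc]
  exact hT.norm_integral_kernel_le hk f g

lemma isNormalOp_kernelOp [SigmaFinite μ] (hT : IsPositiveContractionSemigroup T) {k : ℝ → ℝ}
    (hk : IntegrableOn k (Ioi 0)) : IsNormalOp (kernelOp T k) := by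
  refine isNormalOp_of_sequentiallyNormal fun g A hA hanti hinter => ?_
  have h1 : ∀ n, ((pairingLeft g).comp (kernelOp T k)) (indicatorTop μ (hA n)) =
      ∫ u in Ioi 0, (k u : ℂ) * pairing (T u (indicatorTop μ (hA n))) g :=
    fun n => hT.pairing_kernelOp hk _ g
  simp_rw [h1]
  have h2 : Tendsto (fun n => ∫ u in Ioi 0, (k u : ℂ) * pairing (T u (indicatorTop μ (hA n))) g)
      atTop (𝓝 (∫ u in Ioi (0 : ℝ), (0 : ℂ))) := by
    refine tendsto_integral_of_dominated_convergence (fun u => ‖k u‖ * (1 * ‖g‖))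
      (fun n => (hT.integrableOn_kernel hk _ g).aestronglyMeasurable) (hk.norm.mul_const _)
      (fun n => ?_) ?_
    · filter_upwards [hT.norm_kernel_mul_le k (indicatorTop μ (hA n)) g] with u hu
      refine hu.trans ?_
      gcongr
      exact norm_indicatorTop_le _
    · filter_upwards [ae_restrict_mem measurableSet_Ioi] with u hu
      obtain ⟨g', hg'⟩ := (hT.isSubMarkov (le_of_lt hu)).normal g
      simp_rw [hg']
      simpa using (sequentiallyNormal_pairingLeft g' A hA hanti hinter).const_mul (k u : ℂ)
  simpa using h2

lemma rePairing_kernelOp [SigmaFinite μ] (hT : IsPositiveContractionSemigroup T) {k : ℝ → ℝ}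
    (hk : IntegrableOn k (Ioi 0)) (f : Linfty μ) (g : Lp ℂ 1 μ) :
    rePairing g (kernelOp T k f) = ∫ u in Ioi 0, k u * rePairing g (T u f) := by
  rw [rePairing, hT.pairing_kernelOp hk]
  have h1 := integral_re (hT.integrableOn_kernel hk f g)
  refine (Eq.trans ?_ h1).symm
  refine integral_congr_ae (ae_of_all _ fun u => ?_)
  exact (Complex.re_ofReal_mul _ _).symm

lemma integrableOn_rePairing (hT : IsPositiveContractionSemigroup T) {k : ℝ → ℝ}
    (hk : IntegrableOn k (Ioi 0)) (f : Linfty μ) (g : Lp ℂ 1 μ) :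
    IntegrableOn (fun u => k u * rePairing g (T u f)) (Ioi 0) := by
  refine (hT.integrableOn_kernel hk f g).re.congr (ae_of_all _ fun u => ?_)
  exact Complex.re_ofReal_mul _ _

lemma isPositiveOp_kernelOp [SigmaFinite μ] (hT : IsPositiveContractionSemigroup T) {k : ℝ → ℝ}
    (hk : IntegrableOn k (Ioi 0)) (hk0 : ∀ u, 0 ≤ k u) : IsPositiveOp (kernelOp T k) := by
  intro f hf
  refine isNonneg_of_forall_pairing fun g hg => ?_
  rw [hT.pairing_kernelOp hk]
  refine integral_nonneg_of_ae ?_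
  filter_upwards [ae_restrict_mem measurableSet_Ioi] with u hu
  exact mul_nonneg (by exact_mod_cast hk0 u)
    (pairing_nonneg (hT.positive u (le_of_lt hu) f hf) hg)

/-- Jensen's inequality for a seminorm `p` that is a supremum of functionals in `L^1`, and a kernel
dominated by a probability density. -/
lemma sq_kernelOp_le [SigmaFinite μ] (hT : IsPositiveContractionSemigroup T) {k φ : ℝ → ℝ}
    (hk : IntegrableOn k (Ioi 0)) (hφ : IntegrableOn φ (Ioi 0))
    (hφ1 : ∫ u in Ioi 0, φ u = 1) {C : ℝ} (hC : 0 ≤ C)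
    (hkφ : ∀ u, 0 < u → |k u| ≤ C * φ u) {p : Linfty μ → ℝ} (hp : IsDualSeminorm p)
    {F G : Linfty μ} (hG : IsNonneg G) {g : Lp ℂ 1 μ} (hg : L1.IsNonneg g)
    (hφ0 : ∀ u, 0 ≤ φ u)
    (hpT : ∀ u, 0 < u → p (T u F) ^ 2 ≤ rePairing g (T u G)) :
    p (kernelOp T k F) ^ 2 ≤ C ^ 2 * rePairing g (kernelOp T φ G) := by
  have hR : 0 ≤ rePairing g (kernelOp T φ G) :=
    rePairing_nonneg hg (hT.isPositiveOp_kernelOp hφ hφ0 G hG)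
  set R := rePairing g (kernelOp T φ G) with hRdef
  -- `√x ≤ (x / r + r) / 2` makes the bound linear in `⟨T_u G, g⟩`
  have key : ∀ r : ℝ, 0 < r → p (kernelOp T k F) ≤ C * ((R / r + r) / 2) := by
    intro r hr
    have hint : IntegrableOn (fun u => C * (((φ u * rePairing g (T u G)) / r + φ u * r) / 2))
        (Ioi 0) :=
      ((((hT.integrableOn_rePairing hφ G g).div_const r).add (hφ.mul_const r)).div_const 2).const_mul
        C
    have h1 := hp.le_integral (ν := volume.restrict (Ioi 0)) (F := fun u => (k u : ℂ) • T u F)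
      (h := kernelOp T k F) (fun g => by
        simp_rw [pairing_smul_left]
        exact (hT.pairing_kernelOp hk F g).symm) hint ?_
    · refine h1.trans_eq ?_
      rw [integral_const_mul, integral_div, integral_add
        ((hT.integrableOn_rePairing hφ G g).div_const r) (hφ.mul_const r), integral_div,
        integral_mul_const, hφ1, hRdef, hT.rePairing_kernelOp hφ, one_mul]
    · filter_upwards [ae_restrict_mem measurableSet_Ioi] with u hu
      have hu' : 0 < u := hu
      have h2 := hpT u hu'
      have h3 := hp.nonneg (T u F)
      have h4 : p (T u F) ≤ (rePairing g (T u G) / r + r) / 2 := by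
        have h6 : p (T u F) ^ 2 / r ≤ rePairing g (T u G) / r := by gcongr
        have h5 : p (T u F) * 2 ≤ p (T u F) ^ 2 / r + r := by
          rw [div_add' _ _ _ hr.ne', le_div_iff₀ hr]
          nlinarith [sq_nonneg (p (T u F) - r)]
        linarith
      calc p ((k u : ℂ) • T u F) ≤ ‖(k u : ℂ)‖ * p (T u F) := hp.smul_le _ _
        _ ≤ (C * φ u) * ((rePairing g (T u G) / r + r) / 2) := by
          rw [Complex.norm_real, Real.norm_eq_abs]
          exact mul_le_mul (hkφ u hu') h4 h3 (mul_nonneg hC (hφ0 u))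
        _ = _ := by ring
  have hp0 := hp.nonneg (kernelOp T k F)
  have h7 : p (kernelOp T k F) ≤ C * √R := by
    rcases eq_or_lt_of_le hR with h0 | h0
    · rw [← h0, Real.sqrt_zero, mul_zero]
      have h8 : Tendsto (fun r : ℝ => C * ((R / r + r) / 2)) (𝓝[>] 0) (𝓝 (C * (0 / 2))) := by
        refine Tendsto.mono_left ?_ nhdsWithin_le_nhds
        rw [← h0]
        simp only [zero_div, zero_add]
        have : Tendsto (fun r : ℝ => C * (r / 2)) (𝓝 0) (𝓝 (C * (0 / 2))) :=
          (tendsto_id.div_const 2).const_mul C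
        simpa using this
      have := ge_of_tendsto h8 (by
        filter_upwards [self_mem_nhdsWithin] with r hr
        exact key r hr)
      simpa using this
    · refine (key _ (Real.sqrt_pos.2 h0)).trans_eq ?_
      rw [Real.div_sqrt]
      ring
  calc p (kernelOp T k F) ^ 2 ≤ (C * √R) ^ 2 := by gcongr
    _ = C ^ 2 * R := by rw [mul_pow, Real.sq_sqrt hR]

end IsPositiveContractionSemigroup

end Kernels

section Subordination

variable {M : Type*} [MeasurableSpace M] {μ : Measure M} {T : ℝ → Linfty μ →L[ℂ] Linfty μ}
  {α s t : ℝ}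

/-! ### The subordinated semigroup -/

lemma ae_pos_subordMeasure (s α : ℝ) : ∀ᵐ u ∂subordMeasure s α, 0 < u :=
  (withDensity_absolutelyContinuous _ _).ae_le (ae_restrict_mem measurableSet_Ioi)

lemma integral_subordMeasure (h0 : 0 < α) (h1 : α < 1) (hs : 0 < s) (F : ℝ → ℂ) :
    ∫ u, F u ∂subordMeasure s α = ∫ u in Ioi 0, (subordDensity s α u : ℂ) * F u := by
  rw [subordMeasure, integral_withDensity_eq_integral_toReal_smul
    (measurable_subordDensity s α).ennreal_ofReal (ae_of_all _ fun _ => ENNReal.ofReal_lt_top)]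
  refine integral_congr_ae (ae_of_all _ fun u => ?_)
  simp only
  rw [ENNReal.toReal_ofReal (subordDensity_nonneg h0 h1 hs u), Complex.real_smul]

/-- The subordinated semigroup as a family of bounded operators. -/
def subordOp (T : ℝ → Linfty μ →L[ℂ] Linfty μ) (α t : ℝ) : Linfty μ →L[ℂ] Linfty μ :=
  if 0 < t then kernelOp T (subordDensity t α) else ContinuousLinearMap.id ℂ _

/-- The derivative `d/dt T_{t,α}`. -/
def subordDerivOp (T : ℝ → Linfty μ →L[ℂ] Linfty μ) (α t : ℝ) : Linfty μ →L[ℂ] Linfty μ :=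
  kernelOp T (subordDensityDeriv t α)

lemma subordOp_of_pos (ht : 0 < t) : subordOp T α t = kernelOp T (subordDensity t α) :=
  if_pos ht

lemma subordOp_zero : subordOp T α 0 = ContinuousLinearMap.id ℂ _ := if_neg (lt_irrefl _)

lemma integrableOn_subordDensityDeriv (h0 : 0 < α) (h1 : α < 1) (ht : 0 < t) :
    IntegrableOn (subordDensityDeriv t α) (Ioi 0) := by
  refine ((integrableOn_subordDensity h0 h1 (mul_pos (timeRatio_pos α) ht)).const_mul
    (2 * (1 / (1 - α)) / t)).mono' (measurable_subordDensityDeriv t α).aestronglyMeasurable ?_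
  filter_upwards [ae_restrict_mem measurableSet_Ioi] with u hu
  exact abs_subordDensityDeriv_le h0 h1 ht hu

lemma integral_norm_subordDensityDeriv_le (h0 : 0 < α) (h1 : α < 1) (ht : 0 < t) :
    ∫ u in Ioi 0, ‖subordDensityDeriv t α u‖ ≤ 2 * (1 / (1 - α)) / t := by
  have hc := mul_pos (timeRatio_pos α) ht
  have h2 : ∫ u in Ioi 0, (2 * (1 / (1 - α)) / t) * subordDensity (timeRatio α * t) α u =
      2 * (1 / (1 - α)) / t := by
    rw [integral_const_mul, integral_subordDensity h0 h1 hc, mul_one]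
  rw [← h2]
  refine integral_mono_of_nonneg (ae_of_all _ fun _ => norm_nonneg _)
    ((integrableOn_subordDensity h0 h1 hc).const_mul _) ?_
  filter_upwards [ae_restrict_mem measurableSet_Ioi] with u hu
  exact abs_subordDensityDeriv_le h0 h1 ht hu

namespace IsPositiveContractionSemigroup

variable [SigmaFinite μ] (hT : IsPositiveContractionSemigroup T)

include hT

lemma pairing_subordOp (h0 : 0 < α) (h1 : α < 1) (ht : 0 < t) (f : Linfty μ) (g : Lp ℂ 1 μ) :
    pairing (subordOp T α t f) g = ∫ u, pairing (T u f) g ∂subordMeasure t α := by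
  rw [subordOp_of_pos ht, hT.pairing_kernelOp (integrableOn_subordDensity h0 h1 ht),
    integral_subordMeasure h0 h1 ht]

lemma hasWeakStarIntegral_subordOp (h0 : 0 < α) (h1 : α < 1) (ht : 0 < t) (f : Linfty μ) :
    HasWeakStarIntegral (subordIntegrand T α t f) (subordOp T α t f) := fun g => by
  have hk := integrableOn_subordDensity h0 h1 ht
  simp_rw [subordIntegrand, pairing_smul_left]
  exact ⟨hT.integrableOn_kernel hk f g, by rw [subordOp_of_pos ht, hT.pairing_kernelOp hk]⟩

lemma subord_eq (h0 : 0 < α) (h1 : α < 1) (t : ℝ) (f : Linfty μ) :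
    subord T α t f = subordOp T α t f := by
  unfold subord
  split_ifs with ht
  · have h := hT.hasWeakStarIntegral_subordOp h0 h1 ht f
    have hex : ∃ k, HasWeakStarIntegral (subordIntegrand T α t f) k := ⟨_, h⟩
    rw [weakStarIntegral, dif_pos hex]
    exact Linfty.ext_pairing fun g => (hex.choose_spec g).2.symm.trans (h g).2
  · rw [subordOp, if_neg ht]
    rfl

lemma isSubMarkov_subordOp (h0 : 0 < α) (h1 : α < 1) (t : ℝ) : IsSubMarkov (subordOp T α t) := by
  unfold subordOp
  split_ifs with ht
  · have hk := integrableOn_subordDensity h0 h1 ht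
    refine ⟨(hT.norm_kernelOp_le hk).trans_eq ?_,
      hT.isPositiveOp_kernelOp hk (subordDensity_nonneg h0 h1 ht), hT.isNormalOp_kernelOp hk⟩
    rw [← integral_subordDensity h0 h1 ht]
    refine integral_congr_ae (ae_of_all _ fun u => ?_)
    exact Real.norm_of_nonneg (subordDensity_nonneg h0 h1 ht u)
  · exact ⟨ContinuousLinearMap.norm_id_le, fun f hf => hf, fun g => ⟨g, fun f => rfl⟩⟩

lemma subordOp_comm (h0 : 0 < α) (h1 : α < 1) (t : ℝ) {u : ℝ} (hu : 0 ≤ u) (f : Linfty μ) :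
    subordOp T α t (T u f) = T u (subordOp T α t f) := by
  unfold subordOp
  split_ifs with ht
  · have hk := integrableOn_subordDensity h0 h1 ht
    refine Linfty.ext_pairing fun g => ?_
    obtain ⟨g', hg'⟩ := (hT.isSubMarkov hu).normal g
    rw [hg', hT.pairing_kernelOp hk, hT.pairing_kernelOp hk]
    refine setIntegral_congr_fun measurableSet_Ioi fun v hv => ?_
    have hv' : 0 ≤ v := le_of_lt hv
    rw [← hg', ← ContinuousLinearMap.comp_apply, ← ContinuousLinearMap.comp_apply,
      ← hT.add v u hv' hu, ← hT.add u v hu hv', add_comm]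
  · rfl

lemma subordOp_add (h0 : 0 < α) (h1 : α < 1) (hs : 0 ≤ s) (ht : 0 ≤ t) (f : Linfty μ) :
    subordOp T α (s + t) f = subordOp T α s (subordOp T α t f) := by
  rcases eq_or_lt_of_le hs with rfl | hs
  · rw [zero_add, subordOp_zero]
    rfl
  rcases eq_or_lt_of_le ht with rfl | ht
  · rw [add_zero, subordOp_zero]
    rfl
  have := isProbabilityMeasure_subordMeasure h0 h1 hs
  have := isProbabilityMeasure_subordMeasure h0 h1 ht
  refine Linfty.ext_pairing fun g => ?_
  rw [hT.pairing_subordOp h0 h1 (add_pos hs ht), hT.pairing_subordOp h0 h1 hs,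
    ← subordMeasure_conv h0 h1 hs ht]
  have hm := hT.measurable_pairing f g
  have hae : ∀ r, (fun u => pairing (T u f) g) =ᵐ[subordMeasure r α]
      (Ioi (0 : ℝ)).indicator fun u => pairing (T u f) g := fun r => by
    filter_upwards [ae_pos_subordMeasure r α] with u hu
    rw [indicator_of_mem (mem_Ioi.2 hu)]
  have hbound : ∀ u, ‖(Ioi (0 : ℝ)).indicator (fun u => pairing (T u f) g) u‖ ≤ ‖f‖ * ‖g‖ := by
    intro u
    by_cases hu : u ∈ Ioi (0 : ℝ)
    · rw [indicator_of_mem hu]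
      exact hT.norm_pairing_apply_le (le_of_lt hu) f g
    · rw [indicator_of_notMem hu, norm_zero]
      positivity
  have e1 := hae (s + t)
  rw [← subordMeasure_conv h0 h1 hs ht] at e1
  rw [integral_congr_ae e1, integral_conv
    (Integrable.of_bound hm.aestronglyMeasurable _ (ae_of_all _ hbound))]
  refine integral_congr_ae ?_
  filter_upwards [ae_pos_subordMeasure s α] with u hu
  obtain ⟨g', hg'⟩ := (hT.isSubMarkov hu.le).normal g
  rw [hg', hT.pairing_subordOp h0 h1 ht]
  refine integral_congr_ae ?_
  filter_upwards [ae_pos_subordMeasure t α] with v hv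
  rw [indicator_of_mem (mem_Ioi.2 (add_pos hu hv)), ← hg', hT.add u v hu.le hv.le]
  rfl

/-! ### The derivative of the subordinated semigroup and its generator -/

lemma norm_subordDerivOp_le (h0 : 0 < α) (h1 : α < 1) (ht : 0 < t) (f : Linfty μ) :
    ‖subordDerivOp T α t f‖ ≤ 2 * (1 / (1 - α)) / t * ‖f‖ :=
  ((subordDerivOp T α t).le_opNorm f).trans (mul_le_mul_of_nonneg_right
    ((hT.norm_kernelOp_le (integrableOn_subordDensityDeriv h0 h1 ht)).trans
      (integral_norm_subordDensityDeriv_le h0 h1 ht)) (norm_nonneg _))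

lemma isNormalOp_subordDerivOp (h0 : 0 < α) (h1 : α < 1) (ht : 0 < t) :
    IsNormalOp (subordDerivOp T α t) :=
  hT.isNormalOp_kernelOp (integrableOn_subordDensityDeriv h0 h1 ht)

lemma hasDerivAt_pairing_subordOp (h0 : 0 < α) (h1 : α < 1) (ht : 0 < t) (f : Linfty μ)
    (g : Lp ℂ 1 μ) :
    HasDerivAt (fun t => pairing (subordOp T α t f) g) (pairing (subordDerivOp T α t f) g) t := by
  have hβ : 0 < 1 / (1 - α) := one_div_pos.2 (sub_pos.2 h1)
  have hm : ∀ k : ℝ → ℝ, Measurable k → AEStronglyMeasurable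
      (fun u => (k u : ℂ) * pairing (T u f) g) (volume.restrict (Ioi 0)) := fun k hk =>
    (Complex.measurable_ofReal.comp hk).aestronglyMeasurable.mul
      (hT.aestronglyMeasurable_pairing f g)
  have key := hasDerivAt_integral_of_dominated_loc_of_deriv_le
    (μ := volume.restrict (Ioi (0 : ℝ)))
    (F := fun (r u : ℝ) => (subordDensity r α u : ℂ) * pairing (T u f) g)
    (F' := fun (r u : ℝ) => (subordDensityDeriv r α u : ℂ) * pairing (T u f) g)
    (bound := fun u => (2 * (1 / (1 - α)) / (t / 2) * (8 : ℝ) ^ (1 / (1 - α)) *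
      subordDensity (t / 4) α u) * (‖f‖ * ‖g‖))
    (x₀ := t) (s := Ioo (t / 2) (2 * t)) (Ioo_mem_nhds (by linarith) (by linarith))
    (Eventually.of_forall fun r => hm _ (measurable_subordDensity r α))
    (hT.integrableOn_kernel (integrableOn_subordDensity h0 h1 ht) f g)
    (hm _ (measurable_subordDensityDeriv t α)) ?_ ?_ ?_
  · have h2 := key.2
    rw [← hT.pairing_kernelOp (integrableOn_subordDensityDeriv h0 h1 ht)] at h2
    refine h2.congr_of_eventuallyEq ?_
    filter_upwards [Ioi_mem_nhds ht] with r hr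
    rw [subordOp_of_pos hr, hT.pairing_kernelOp (integrableOn_subordDensity h0 h1 hr)]
  · filter_upwards [ae_restrict_mem measurableSet_Ioi] with u hu r hr
    have hr0 : 0 < r := by linarith [hr.1]
    have hc1 := half_le_timeRatio (α := α) h0
    have hc2 := timeRatio_le_one (α := α) h1
    have h4 : t / 4 ≤ timeRatio α * r := by nlinarith [hr.1]
    have h5 : timeRatio α * r ≤ 2 * t := by nlinarith [hr.2]
    have hφ := subordDensity_nonneg h0 h1 (show 0 < t / 4 by linarith) u
    rw [norm_mul, Complex.norm_real, Real.norm_eq_abs]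
    refine mul_le_mul ?_ (hT.norm_pairing_apply_le (le_of_lt hu) f g) (norm_nonneg _)
      (by positivity)
    refine (abs_subordDensityDeriv_le h0 h1 hr0 hu).trans ?_
    rw [mul_assoc]
    refine mul_le_mul ?_ ?_ (subordDensity_nonneg h0 h1 (mul_pos (timeRatio_pos α) hr0) u)
      (by positivity)
    · have := hr.1
      gcongr
    · refine (subordDensity_le h0 h1 (by linarith) h4 hu).trans ?_
      refine mul_le_mul_of_nonneg_right ?_ hφ
      refine Real.rpow_le_rpow (div_nonneg (by linarith) (by linarith)) ?_ hβ.le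
      rw [div_le_iff₀ (by linarith)]
      linarith
  · exact ((integrableOn_subordDensity h0 h1 (show 0 < t / 4 by linarith)).const_mul _).mul_const _
  · filter_upwards [ae_restrict_mem measurableSet_Ioi] with u hu r hr
    have hr0 : 0 < r := by linarith [hr.1]
    exact ((hasDerivAt_subordDensity h0 h1 hr0 hu).ofReal_comp).mul_const _

lemma subordDerivOp_add (h0 : 0 < α) (h1 : α < 1) (hs : 0 ≤ s) (ht : 0 < t) (f : Linfty μ) :
    subordDerivOp T α (s + t) f = subordOp T α s (subordDerivOp T α t f) := by
  refine Linfty.ext_pairing fun g => ?_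
  obtain ⟨g', hg'⟩ := (hT.isSubMarkov_subordOp h0 h1 s).normal g
  have e1 := hT.hasDerivAt_pairing_subordOp h0 h1 ht f g'
  have e2 : HasDerivAt (fun r => pairing (subordOp T α (s + r) f) g)
      (pairing (subordDerivOp T α (s + t) f) g) t :=
    (hT.hasDerivAt_pairing_subordOp h0 h1 (add_pos_of_nonneg_of_pos hs ht) f g).comp_const_add s t
  rw [hg']
  refine HasDerivAt.unique (e2.congr_of_eventuallyEq ?_) e1
  filter_upwards [Ioi_mem_nhds ht] with r hr
  rw [hT.subordOp_add h0 h1 hs (le_of_lt hr), hg']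

lemma subordDerivOp_add' (h0 : 0 < α) (h1 : α < 1) (hs : 0 ≤ s) (ht : 0 < t) (f : Linfty μ) :
    subordDerivOp T α (t + s) f = subordDerivOp T α t (subordOp T α s f) := by
  refine Linfty.ext_pairing fun g => ?_
  have e1 := hT.hasDerivAt_pairing_subordOp h0 h1 ht (subordOp T α s f) g
  have e2 : HasDerivAt (fun r => pairing (subordOp T α (r + s) f) g)
      (pairing (subordDerivOp T α (t + s) f) g) t :=
    (hT.hasDerivAt_pairing_subordOp h0 h1 (add_pos_of_pos_of_nonneg ht hs) f g).comp_add_const t s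
  refine HasDerivAt.unique (e2.congr_of_eventuallyEq ?_) e1
  filter_upwards [Ioi_mem_nhds ht] with r hr
  rw [hT.subordOp_add h0 h1 (le_of_lt hr) hs]

/-- The semigroup is norm continuous for positive times, being weak* differentiable with locally
bounded derivative. -/
lemma norm_subordOp_sub_le (h0 : 0 < α) (h1 : α < 1) {a b : ℝ} (ha : 0 < a) (hab : a ≤ b)
    (f : Linfty μ) :
    ‖subordOp T α b f - subordOp T α a f‖ ≤ 2 * (1 / (1 - α)) / a * ‖f‖ * (b - a) := by
  have hβ : 0 < 1 / (1 - α) := one_div_pos.2 (sub_pos.2 h1)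
  have hba : 0 ≤ b - a := sub_nonneg.2 hab
  refine Linfty.norm_le_of_forall_pairing (by positivity) fun g => ?_
  rw [pairing_sub_left]
  have h2 := (convex_Icc a b).norm_image_sub_le_of_norm_hasDerivWithin_le
    (f := fun t => pairing (subordOp T α t f) g)
    (f' := fun t => pairing (subordDerivOp T α t f) g)
    (C := 2 * (1 / (1 - α)) / a * ‖f‖ * ‖g‖)
    (fun x hx => (hT.hasDerivAt_pairing_subordOp h0 h1 (ha.trans_le hx.1) f g).hasDerivWithinAt)
    (fun x hx => ?_) (left_mem_Icc.2 hab) (right_mem_Icc.2 hab)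
  · rw [Real.norm_of_nonneg hba] at h2
    exact h2.trans_eq (by ring)
  · refine (norm_pairing_le _ _).trans (mul_le_mul_of_nonneg_right ?_ (norm_nonneg _))
    refine (hT.norm_subordDerivOp_le h0 h1 (ha.trans_le hx.1) f).trans ?_
    have := hx.1
    gcongr

lemma continuousOn_subordDerivOp (h0 : 0 < α) (h1 : α < 1) (f : Linfty μ) :
    ContinuousOn (fun t => subordDerivOp T α t f) (Ioi 0) := by
  have hβ : 0 < 1 / (1 - α) := one_div_pos.2 (sub_pos.2 h1)
  intro t ht
  have ht' : 0 < t := ht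
  have hb : ∀ v w, t / 2 ≤ v → v ≤ w → ‖subordDerivOp T α w f - subordDerivOp T α v f‖ ≤
      (2 * (1 / (1 - α)) / (t / 4)) * (2 * (1 / (1 - α)) / (t / 4) * ‖f‖) * |w - v| := by
    intro v w hv hvw
    have h4 : 0 < t / 4 := by linarith
    have e1 : subordDerivOp T α w f = subordDerivOp T α (t / 4) (subordOp T α (w - t / 4) f) := by
      rw [← hT.subordDerivOp_add' h0 h1 (by linarith) h4]
      congr 2
      ring
    have e2 : subordDerivOp T α v f = subordDerivOp T α (t / 4) (subordOp T α (v - t / 4) f) := by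
      rw [← hT.subordDerivOp_add' h0 h1 (by linarith) h4]
      congr 2
      ring
    rw [e1, e2, ← map_sub, mul_assoc]
    refine (hT.norm_subordDerivOp_le h0 h1 h4 _).trans
      (mul_le_mul_of_nonneg_left ?_ (by positivity))
    refine (hT.norm_subordOp_sub_le h0 h1 (show 0 < v - t / 4 by linarith) (by linarith) f).trans ?_
    rw [abs_of_nonneg (by linarith), show w - t / 4 - (v - t / 4) = w - v by ring]
    have h5 : t / 4 ≤ v - t / 4 := by linarith
    have h6 : 0 ≤ w - v := by linarith
    gcongr
  refine ContinuousAt.continuousWithinAt ?_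
  refine tendsto_iff_norm_sub_tendsto_zero.2 ?_
  refine squeeze_zero' (Eventually.of_forall fun _ => norm_nonneg _) (g := fun w =>
    (2 * (1 / (1 - α)) / (t / 4)) * (2 * (1 / (1 - α)) / (t / 4) * ‖f‖) * |w - t|) ?_ ?_
  · filter_upwards [Ioi_mem_nhds (show t / 2 < t by linarith)] with w hw
    rcases le_total t w with h | h
    · exact hb t w (by linarith) h
    · rw [norm_sub_rev, abs_sub_comm]
      exact hb w t (le_of_lt hw) h
  · have : Tendsto (fun w : ℝ => |w - t|) (𝓝 t) (𝓝 |t - t|) := (tendsto_id.sub_const t).abs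
    simpa using this.const_mul
      ((2 * (1 / (1 - α)) / (t / 4)) * (2 * (1 / (1 - α)) / (t / 4) * ‖f‖))

lemma hasNegGenerator_subordOp (h0 : 0 < α) (h1 : α < 1) (ht : 0 < t) (f : Linfty μ) :
    HasNegGenerator (subord T α) (subord T α t f) (-subordDerivOp T α t f) := fun g => by
  have hd := (hT.hasDerivAt_pairing_subordOp h0 h1 ht f g).tendsto_slope_zero_right
  rw [pairing_neg_left]
  refine hd.neg.congr' ?_
  filter_upwards [self_mem_nhdsWithin] with y hy
  have hy' : 0 < y := hy
  rw [hT.subord_eq h0 h1, hT.subord_eq h0 h1, ← hT.subordOp_add h0 h1 hy'.le ht.le,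
    pairing_smul_left, pairing_sub_left, add_comm y t, Complex.real_smul]
  push_cast
  ring

lemma hasNegGenerator_fracGenSubord (h0 : 0 < α) (h1 : α < 1) (ht : 0 < t) (f : Linfty μ) :
    HasNegGenerator (subord T α) (subord T α t f) (fracGenSubord T α t f) := by
  have hex : ∃ k, HasNegGenerator (subord T α) (subord T α t f) k :=
    ⟨_, hT.hasNegGenerator_subordOp h0 h1 ht f⟩
  rw [fracGenSubord, negGenerator, dif_pos hex]
  exact hex.choose_spec

/-- `L^α T_{t,α} f = -∂_t T_{t,α} f`: weak* limits of difference quotients are unique, because `L^1`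
separates the points of `L^∞`. -/
lemma fracGenSubord_eq (h0 : 0 < α) (h1 : α < 1) (ht : 0 < t) (f : Linfty μ) :
    fracGenSubord T α t f = -subordDerivOp T α t f :=
  Linfty.ext_pairing fun g => tendsto_nhds_unique
    (hT.hasNegGenerator_fracGenSubord h0 h1 ht f g) (hT.hasNegGenerator_subordOp h0 h1 ht f g)

/-- Quasi-monotonicity of `t ↦ T_{t,α} F` for `F ≥ 0`. -/
lemma rePairing_subordOp_le (h0 : 0 < α) (h1 : α < 1) (hs : 0 < s) (hst : s ≤ t) {F : Linfty μ}
    (hF : IsNonneg F) {g : Lp ℂ 1 μ} (hg : L1.IsNonneg g) :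
    rePairing g (subordOp T α t F) ≤
      (t / s) ^ (1 / (1 - α)) * rePairing g (subordOp T α s F) := by
  have ht : 0 < t := hs.trans_le hst
  have hks := integrableOn_subordDensity h0 h1 hs
  have hkt := integrableOn_subordDensity h0 h1 ht
  rw [subordOp_of_pos hs, subordOp_of_pos ht, hT.rePairing_kernelOp hks,
    hT.rePairing_kernelOp hkt, ← integral_const_mul]
  refine setIntegral_mono_on (hT.integrableOn_rePairing hkt F g)
    ((hT.integrableOn_rePairing hks F g).const_mul _) measurableSet_Ioi fun u hu => ?_
  rw [← mul_assoc]
  exact mul_le_mul_of_nonneg_right (subordDensity_le h0 h1 hs hst hu)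
    (rePairing_nonneg hg (hT.positive u (le_of_lt hu) F hF))

end IsPositiveContractionSemigroup

end Subordination

section GammaTwo

variable {M : Type*} [MeasurableSpace M] {μ : Measure M} {T : ℝ → Linfty μ →L[ℂ] Linfty μ}
  {α s t : ℝ}

/-! ### The `Γ²` criterion for the subordinated semigroup -/

/-- A semigroup `P` with derivative `Q`, with the properties of subordinated semigroups on which the
estimates rest: analyticity, quasi-monotonicity, the `Γ²` criterion, and its analogue for `Q`. The
parameter `β` is `1 / (1 - α)`. -/
structure SubordinatedSemigroup (P Q : ℝ → Linfty μ →L[ℂ] Linfty μ) (β c : ℝ) : Prop where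
  one_le : 1 ≤ β
  half_le : 1 / 2 ≤ c
  le_one : c ≤ 1
  zero : ∀ f, P 0 f = f
  add : ∀ {s t}, 0 ≤ s → 0 ≤ t → ∀ f, P (s + t) f = P s (P t f)
  subMarkov : ∀ t, IsSubMarkov (P t)
  hasDerivAt : ∀ {t}, 0 < t → ∀ f g,
    HasDerivAt (fun t => pairing (P t f) g) (pairing (Q t f) g) t
  deriv_add : ∀ {s t}, 0 ≤ s → 0 < t → ∀ f, Q (s + t) f = P s (Q t f)
  deriv_add' : ∀ {s t}, 0 ≤ s → 0 < t → ∀ f, Q (t + s) f = Q t (P s f)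
  norm_deriv_le : ∀ {t}, 0 < t → ∀ f, ‖Q t f‖ ≤ 2 * β / t * ‖f‖
  normal_deriv : ∀ {t}, 0 < t → IsNormalOp (Q t)
  continuousOn_deriv : ∀ f, ContinuousOn (fun t => Q t f) (Ioi 0)
  rePairing_le : ∀ {s t}, 0 < s → s ≤ t → ∀ {F}, IsNonneg F → ∀ {g}, L1.IsNonneg g →
    rePairing g (P t F) ≤ (t / s) ^ β * rePairing g (P s F)
  gammaTwo : ∀ {t u}, 0 ≤ t → 0 ≤ u → ∀ F {g}, L1.IsNonneg g →
    rePairing g (schwarzDefect (P t) (P u F)) ≤ rePairing g (P u (schwarzDefect (P t) F))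
  gammaTwo_deriv : ∀ {t v}, 0 ≤ t → 0 < v → ∀ F {g}, L1.IsNonneg g →
    defectNorm (P t) g (Q v F) ^ 2 ≤
      (2 * β / v) ^ 2 * rePairing g (P (c * v) (schwarzDefect (P t) F))

namespace IsPositiveContractionSemigroup

variable [SigmaFinite μ] (hT : IsPositiveContractionSemigroup T)

include hT

lemma gammaTwo_subordOp_right (hΓ : GammaTwoNonneg T) (h0 : 0 < α) (h1 : α < 1) (ht : 0 < t)
    {v : ℝ} (hv : 0 < v) (F : Linfty μ) {g : Lp ℂ 1 μ} (hg : L1.IsNonneg g) :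
    rePairing g (schwarzDefect (T v) (subordOp T α t F)) ≤
      rePairing g (subordOp T α t (schwarzDefect (T v) F)) := by
  have hk := integrableOn_subordDensity h0 h1 ht
  have hφ0 := subordDensity_nonneg h0 h1 ht
  have hS := hT.isSubMarkov hv.le
  rw [subordOp_of_pos ht, ← defectNorm_sq hS hg, ← one_mul (rePairing g (kernelOp _ _ _)),
    ← one_pow 2]
  refine hT.sq_kernelOp_le hk hk (integral_subordDensity h0 h1 ht) zero_le_one
    (fun u _ => by rw [one_mul, abs_of_nonneg (hφ0 u)]) (isDualSeminorm_defectNorm hS hg)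
    (hS.positive.isNonneg_schwarzDefect hS.norm_le F) hg hφ0 fun u hu => ?_
  rw [defectNorm_sq hS hg]
  have := rePairing_nonneg hg (hΓ v u hv hu F)
  rw [rePairing_sub] at this
  exact sub_nonneg.1 this

/-- The `Γ²` criterion is symmetric in the two semigroups. -/
lemma gammaTwo_subordOp_left (hΓ : GammaTwoNonneg T) (h0 : 0 < α) (h1 : α < 1) (ht : 0 < t)
    {v : ℝ} (hv : 0 < v) (F : Linfty μ) {g : Lp ℂ 1 μ} (hg : L1.IsNonneg g) :
    rePairing g (schwarzDefect (subordOp T α t) (T v F)) ≤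
      rePairing g (T v (schwarzDefect (subordOp T α t) F)) := by
  have h := hT.gammaTwo_subordOp_right hΓ h0 h1 ht hv F hg
  simp only [schwarzDefect, map_sub, rePairing_sub, hT.subordOp_comm h0 h1 t hv.le] at h ⊢
  linarith

/-- The `Γ²` inequality for a signed kernel that is dominated by a multiple of a subordination
density. -/
lemma gammaTwo_kernelOp (hΓ : GammaTwoNonneg T) (h0 : 0 < α) (h1 : α < 1) (ht : 0 < t)
    {k : ℝ → ℝ} (hk : IntegrableOn k (Ioi 0)) {r : ℝ} (hr : 0 < r) {C : ℝ} (hC : 0 ≤ C)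
    (hkφ : ∀ u, 0 < u → |k u| ≤ C * subordDensity r α u) (F : Linfty μ) {g : Lp ℂ 1 μ}
    (hg : L1.IsNonneg g) :
    defectNorm (subordOp T α t) g (kernelOp T k F) ^ 2 ≤
      C ^ 2 * rePairing g (subordOp T α r (schwarzDefect (subordOp T α t) F)) := by
  have hS := hT.isSubMarkov_subordOp h0 h1 t
  rw [subordOp_of_pos hr]
  refine hT.sq_kernelOp_le hk (integrableOn_subordDensity h0 h1 hr)
    (integral_subordDensity h0 h1 hr) hC hkφ (isDualSeminorm_defectNorm hS hg)
    (hS.positive.isNonneg_schwarzDefect hS.norm_le F) hg (subordDensity_nonneg h0 h1 hr)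
    fun u hu => ?_
  rw [defectNorm_sq hS hg]
  exact hT.gammaTwo_subordOp_left hΓ h0 h1 ht hu F hg

lemma subordinatedSemigroup (hΓ : GammaTwoNonneg T) (h0 : 0 < α) (h1 : α < 1) :
    SubordinatedSemigroup (subordOp T α) (subordDerivOp T α) (1 / (1 - α)) (timeRatio α) where
  one_le := by rw [le_div_iff₀ (sub_pos.2 h1)]; linarith
  half_le := half_le_timeRatio h0
  le_one := timeRatio_le_one h1
  zero f := by rw [subordOp_zero]; rfl
  add hs ht f := hT.subordOp_add h0 h1 hs ht f
  subMarkov t := hT.isSubMarkov_subordOp h0 h1 t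
  hasDerivAt ht f g := hT.hasDerivAt_pairing_subordOp h0 h1 ht f g
  deriv_add hs ht f := hT.subordDerivOp_add h0 h1 hs ht f
  deriv_add' hs ht f := hT.subordDerivOp_add' h0 h1 hs ht f
  norm_deriv_le ht f := hT.norm_subordDerivOp_le h0 h1 ht f
  normal_deriv ht := hT.isNormalOp_subordDerivOp h0 h1 ht
  continuousOn_deriv f := hT.continuousOn_subordDerivOp h0 h1 f
  rePairing_le hs hst _ hF _ hg := hT.rePairing_subordOp_le h0 h1 hs hst hF hg
  gammaTwo := by
    intro t u ht hu F g hg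
    rcases eq_or_lt_of_le ht with rfl | ht
    · rw [subordOp_zero, schwarzDefect_id, schwarzDefect_id, map_zero]
    rcases eq_or_lt_of_le hu with rfl | hu
    · rw [subordOp_zero]
      rfl
    have hS := hT.isSubMarkov_subordOp h0 h1 t
    have h := hT.gammaTwo_kernelOp hΓ h0 h1 ht (integrableOn_subordDensity h0 h1 hu) hu
      zero_le_one (fun v _ => by
        rw [one_mul, abs_of_nonneg (subordDensity_nonneg h0 h1 hu v)]) F hg
    rwa [defectNorm_sq hS hg, ← subordOp_of_pos hu, one_pow, one_mul] at h
  gammaTwo_deriv := by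
    intro t v ht hv F g hg
    have hβ : 0 < 1 / (1 - α) := one_div_pos.2 (sub_pos.2 h1)
    rcases eq_or_lt_of_le ht with rfl | ht
    · rw [subordOp_zero, defectNorm, schwarzDefect_id, schwarzDefect_id, map_zero, rePairing,
        pairing_zero_left]
      simp
    · exact hT.gammaTwo_kernelOp hΓ h0 h1 ht (integrableOn_subordDensityDeriv h0 h1 hv)
        (mul_pos (timeRatio_pos α) hv) (by positivity)
        (fun u hu => abs_subordDensityDeriv_le h0 h1 hv hu) F hg

end IsPositiveContractionSemigroup

end GammaTwo

section DefectIdentities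

variable {M : Type*} [MeasurableSpace M] {μ : Measure M} {P Q : ℝ → Linfty μ →L[ℂ] Linfty μ}
  {β c s t : ℝ}

/-! ### Cocycle identity and averaging for the Schwarz defect -/

/-- The order of `L^∞`, tested on the real parts of the pairings with nonnegative functions. -/
def WeakLE (X Y : Linfty μ) : Prop := ∀ g, L1.IsNonneg g → rePairing g X ≤ rePairing g Y

lemma WeakLE.trans {X Y Z : Linfty μ} (h : WeakLE X Y) (h' : WeakLE Y Z) : WeakLE X Z :=
  fun g hg => (h g hg).trans (h' g hg)

lemma WeakLE.map {X Y : Linfty μ} (h : WeakLE X Y) {S : Linfty μ →L[ℂ] Linfty μ}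
    (hS : IsSubMarkov S) : WeakLE (S X) (S Y) := fun g hg => by
  obtain ⟨g', hg', -, h'⟩ := hS.exists_adjoint hg
  simp only [rePairing, h']
  exact h g' hg'

lemma WeakLE.smul {X Y : Linfty μ} (h : WeakLE X Y) {r : ℝ} (hr : 0 ≤ r) :
    WeakLE ((r : ℂ) • X) ((r : ℂ) • Y) := fun g hg => by
  rw [rePairing_smul, rePairing_smul]
  exact mul_le_mul_of_nonneg_left (h g hg) hr

namespace SubordinatedSemigroup

variable (hP : SubordinatedSemigroup P Q β c)

include hP

lemma beta_pos : 0 < β := zero_lt_one.trans_le hP.one_le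

lemma isNonneg_defect (t : ℝ) (F : Linfty μ) : IsNonneg (schwarzDefect (P t) F) :=
  (hP.subMarkov t).positive.isNonneg_schwarzDefect (hP.subMarkov t).norm_le F

lemma isDualSeminorm (t : ℝ) {g : Lp ℂ 1 μ} (hg : L1.IsNonneg g) :
    IsDualSeminorm (defectNorm (P t) g) := isDualSeminorm_defectNorm (hP.subMarkov t) hg

lemma sq_defectNorm (t : ℝ) {g : Lp ℂ 1 μ} (hg : L1.IsNonneg g) (F : Linfty μ) :
    defectNorm (P t) g F ^ 2 = rePairing g (schwarzDefect (P t) F) :=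
  defectNorm_sq (hP.subMarkov t) hg F

lemma weakLE_gammaTwo {u : ℝ} (ht : 0 ≤ t) (hu : 0 ≤ u) (F : Linfty μ) :
    WeakLE (schwarzDefect (P t) (P u F)) (P u (schwarzDefect (P t) F)) :=
  fun _ hg => hP.gammaTwo ht hu F hg

/-- The cocycle identity for the defects. -/
lemma defect_add (hs : 0 ≤ s) (ht : 0 ≤ t) (F : Linfty μ) :
    schwarzDefect (P (s + t)) F =
      P s (schwarzDefect (P t) F) + schwarzDefect (P s) (P t F) := by
  simp only [schwarzDefect, map_sub, hP.add hs ht]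
  abel

/-- The defect at time `n τ`, decomposed along `n` steps of length `τ`. -/
lemma defect_nat_mul {τ : ℝ} (hτ : 0 ≤ τ) (n : ℕ) (F : Linfty μ) :
    schwarzDefect (P (n * τ)) F =
      ∑ j ∈ Finset.range n, P (((n : ℝ) - 1 - j) * τ) (schwarzDefect (P τ) (P (j * τ) F)) := by
  induction n with
  | zero => simp [schwarzDefect, hP.zero]
  | succ n ih =>
    have e : ((n + 1 : ℕ) : ℝ) * τ = τ + n * τ := by push_cast; ring
    rw [e, hP.defect_add hτ (by positivity), ih, map_sum, Finset.sum_range_succ]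
    congr 1
    · refine Finset.sum_congr rfl fun j hj => ?_
      have hj' : (j : ℝ) + 1 ≤ n := by exact_mod_cast Finset.mem_range.1 hj
      rw [← hP.add hτ (mul_nonneg (by linarith) hτ)]
      congr 2
      push_cast
      ring
    · have : (((n + 1 : ℕ) : ℝ) - 1 - n) * τ = 0 := by push_cast; ring
      rw [this, hP.zero]

/-- The summands in the decomposition of the defect decrease, so that averages over later blocks
are smaller than averages over earlier blocks. -/
lemma defect_average_le {δ : ℝ} (hδ : 0 ≤ δ) (a b : ℕ) (F : Linfty μ) {g : Lp ℂ 1 μ}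
    (hg : L1.IsNonneg g) :
    b * rePairing g (schwarzDefect (P (a * δ)) (P (b * δ) F)) ≤
      a * rePairing g (P (a * δ) (schwarzDefect (P (b * δ)) F)) := by
  let z : ℕ → ℝ := fun j => rePairing g
    (P (((a : ℝ) + b - 1 - j) * δ) (schwarzDefect (P δ) (P (j * δ) F)))
  have hstep : ∀ j, j + 1 < a + b → z (j + 1) ≤ z j := fun j hj => by
    have hj' : (j : ℝ) + 1 + 1 ≤ a + b := by exact_mod_cast hj
    have e1 : ((a : ℝ) + b - 1 - j) * δ = ((a : ℝ) + b - 1 - (j + 1 : ℕ)) * δ + δ := by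
      push_cast; ring
    have e2 : ((j + 1 : ℕ) : ℝ) * δ = δ + j * δ := by push_cast; ring
    simp only [z]
    rw [e1, hP.add (mul_nonneg (by push_cast; linarith) hδ) hδ, e2, hP.add hδ (by positivity)]
    exact (hP.weakLE_gammaTwo hδ hδ (P (j * δ) F)).map (hP.subMarkov _) g hg
  have hanti : ∀ i j, i ≤ j → j < a + b → z j ≤ z i := fun i j hij => by
    induction j, hij using Nat.le_induction with
    | base => exact fun _ => le_rfl
    | succ j _ ih => exact fun hj => (hstep j hj).trans (ih (by omega))
  have e1 : rePairing g (P (a * δ) (schwarzDefect (P (b * δ)) F)) =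
      ∑ j ∈ Finset.range b, z j := by
    rw [hP.defect_nat_mul hδ, map_sum, rePairing_sum]
    refine Finset.sum_congr rfl fun j hj => ?_
    have hj' : (j : ℝ) + 1 ≤ b := by exact_mod_cast Finset.mem_range.1 hj
    simp only [z]
    rw [← hP.add (by positivity) (mul_nonneg (by linarith) hδ)]
    congr 3
    ring
  have e2 : rePairing g (schwarzDefect (P (a * δ)) (P (b * δ) F)) =
      ∑ i ∈ Finset.range a, z (b + i) := by
    rw [hP.defect_nat_mul hδ, rePairing_sum]
    refine Finset.sum_congr rfl fun i _ => ?_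
    simp only [z]
    rw [← hP.add (by positivity) (by positivity)]
    congr 3
    · push_cast
      ring
    · congr 2
      push_cast
      ring
  rw [e1, e2]
  calc (b : ℝ) * ∑ i ∈ Finset.range a, z (b + i)
      = ∑ _j ∈ Finset.range b, ∑ i ∈ Finset.range a, z (b + i) := by simp
    _ ≤ ∑ j ∈ Finset.range b, ∑ _i ∈ Finset.range a, z j := by
        refine Finset.sum_le_sum fun j hj => Finset.sum_le_sum fun i hi => ?_
        rw [Finset.mem_range] at hj hi
        exact hanti _ _ (by omega) (by omega)
    _ = a * ∑ j ∈ Finset.range b, z j := by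
        rw [Finset.mul_sum]
        simp

/-- The defect at scale `τ` of `Q_w f`, estimated by the defect at the scale `2^l τ / 8`, which is
at most `w / 4`. -/
lemma sq_defectNorm_deriv_le {τ w S : ℝ} (hτ : 0 < τ) (l : ℕ) (hS : S = 2 ^ l * (τ / 8))
    (hw : 4 * S ≤ w) (f : Linfty μ) {g : Lp ℂ 1 μ} (hg : L1.IsNonneg g) :
    defectNorm (P τ) g (Q w f) ^ 2 ≤ (4 * β / w) ^ 2 * (8 / 2 ^ l) *
      rePairing g (P (c * (w / 2) + τ + (w / 2 - 2 * S)) (schwarzDefect (P S) (P S f))) := by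
  have hS0 : 0 < S := by rw [hS]; positivity
  have hw0 : 0 < w := by linarith
  have hc : 0 ≤ c := le_trans (by norm_num) hP.half_le
  have e1 : Q w f = Q (w / 2) (P (w / 2) f) := by
    rw [← hP.deriv_add' (by positivity) (by positivity), add_halves]
  have e2 : P (w / 2) f = P S (P (w / 2 - 2 * S) (P S f)) := by
    rw [← hP.add (by linarith) hS0.le, ← hP.add hS0.le (by linarith)]
    congr 2
    ring
  have h1 := hP.gammaTwo_deriv hτ.le (half_pos hw0) (P (w / 2) f) hg
  rw [← e1, show 2 * β / (w / 2) = 4 * β / w by field_simp; ring] at h1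
  refine h1.trans ?_
  rw [mul_assoc]
  refine mul_le_mul_of_nonneg_left ?_ (by positivity)
  -- averaging, with `τ` divided into `8` steps
  have h2 : WeakLE (schwarzDefect (P τ) (P (w / 2) f))
      (((8 / 2 ^ l : ℝ) : ℂ) • P τ (schwarzDefect (P S) (P (w / 2 - 2 * S) (P S f)))) := by
    intro g hg
    have h3 := hP.defect_average_le (δ := τ / 8) (by positivity) 8 (2 ^ l)
      (P (w / 2 - 2 * S) (P S f)) hg
    rw [show ((8 : ℕ) : ℝ) * (τ / 8) = τ by push_cast; ring,
      show ((2 ^ l : ℕ) : ℝ) * (τ / 8) = S by rw [hS]; push_cast; ring, ← e2] at h3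
    push_cast at h3
    rw [rePairing_smul, div_mul_eq_mul_div, le_div_iff₀ (by positivity), mul_comm]
    exact h3
  have h4 := (hP.weakLE_gammaTwo hS0.le (show 0 ≤ w / 2 - 2 * S by linarith) (P S f)).map
    (hP.subMarkov τ)
  have h5 := (h2.trans (h4.smul (by positivity))).map (hP.subMarkov (c * (w / 2))) g hg
  rw [map_smul, rePairing_smul, ← hP.add hτ.le (by linarith), ← hP.add (by positivity)
    (by linarith), ← add_assoc] at h5
  exact h5

end SubordinatedSemigroup

end DefectIdentities

section Weights

variable {M : Type*} [MeasurableSpace M] {μ : Measure M} {P Q : ℝ → Linfty μ →L[ℂ] Linfty μ}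
  {β c s t : ℝ} {a : ℝ → ℂ} {κ : ℝ}

/-! ### Weights with bounded averages -/

/-- The averages of `|a|` over the intervals `(0, ρ]` are bounded by `κ`. -/
structure BoundedAverages (a : ℝ → ℂ) (κ : ℝ) : Prop where
  integrableOn : ∀ ρ, IntegrableOn a (Ioc 0 ρ)
  integral_le : ∀ ρ, 0 < ρ → ∫ v in Ioc 0 ρ, ‖a v‖ ≤ κ * ρ

/-- A weight with bounded averages that vanishes near `0` and near `∞`. -/
structure CompactWeight (a : ℝ → ℂ) (κ : ℝ) : Prop extends BoundedAverages a κ where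
  support : ∃ ε R, 0 < ε ∧ ∀ v, a v ≠ 0 → ε ≤ v ∧ v ≤ R

lemma BoundedAverages.nonneg (ha : BoundedAverages a κ) : 0 ≤ κ := by
  have := ha.integral_le 1 one_pos
  rw [mul_one] at this
  exact (integral_nonneg fun _ => norm_nonneg _).trans this

lemma BoundedAverages.mono {b : ℝ → ℂ} (ha : BoundedAverages a κ)
    (hb : AEStronglyMeasurable b (volume.restrict (Ioi 0))) (h : ∀ v, ‖b v‖ ≤ ‖a v‖) :
    BoundedAverages b κ := by
  have hi : ∀ ρ, IntegrableOn b (Ioc 0 ρ) := fun ρ =>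
    Integrable.mono (ha.integrableOn ρ)
      (hb.mono_measure (Measure.restrict_mono Ioc_subset_Ioi_self le_rfl))
      (ae_of_all _ h)
  exact ⟨hi, fun ρ hρ => (integral_mono (hi ρ).norm (ha.integrableOn ρ).norm h).trans
    (ha.integral_le ρ hρ)⟩

lemma CompactWeight.integrableOn_Ioi (ha : CompactWeight a κ) : IntegrableOn a (Ioi 0) := by
  obtain ⟨ε, R, hε, h⟩ := ha.support
  refine (ha.integrableOn R).of_forall_sdiff_eq_zero measurableSet_Ioi fun v hv => ?_
  by_contra hne
  exact hv.2 ⟨hv.1, (h v hne).2⟩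

lemma CompactWeight.mono {b : ℝ → ℂ} (ha : CompactWeight a κ)
    (hb : AEStronglyMeasurable b (volume.restrict (Ioi 0))) (h : ∀ v, ‖b v‖ ≤ ‖a v‖) :
    CompactWeight b κ := by
  obtain ⟨ε, R, hε, h'⟩ := ha.support
  refine ⟨ha.toBoundedAverages.mono hb h, ε, R, hε, fun v hv => h' v fun h0 => hv ?_⟩
  have := h v
  rw [h0, norm_zero] at this
  exact norm_le_zero_iff.1 this

lemma CompactWeight.indicator (ha : CompactWeight a κ) {s : Set ℝ} (hs : MeasurableSet s) :
    CompactWeight (s.indicator a) κ :=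
  ha.mono (ha.integrableOn_Ioi.aestronglyMeasurable.indicator hs)
    fun _ => norm_indicator_le_norm_self _ _

/-- The dyadic intervals `(0, τ]` and `(2^{l-1} τ, 2^l τ]`, `l ≥ 1`. -/
def dyadicPiece (τ : ℝ) (l : ℕ) : Set ℝ := Ioc (if l = 0 then 0 else 2 ^ l * τ / 2) (2 ^ l * τ)

lemma measurableSet_dyadicPiece (τ : ℝ) (l : ℕ) : MeasurableSet (dyadicPiece τ l) :=
  measurableSet_Ioc

lemma dyadicPiece_subset {τ : ℝ} (hτ : 0 < τ) (l : ℕ) :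
    dyadicPiece τ l ⊆ Ioc 0 (2 ^ l * τ) := by
  refine Ioc_subset_Ioc_left ?_
  split_ifs <;> positivity

lemma exists_mem_dyadicPiece {τ v : ℝ} (hv : 0 < v) {L : ℕ} (h : v ≤ 2 ^ L * τ) :
    ∃ l ≤ L, v ∈ dyadicPiece τ l := by
  induction L with
  | zero => exact ⟨0, le_rfl, by simpa [dyadicPiece, hv] using h⟩
  | succ L ih =>
    by_cases h' : v ≤ 2 ^ L * τ
    · obtain ⟨l, hl, hl'⟩ := ih h'
      exact ⟨l, hl.trans (Nat.le_succ L), hl'⟩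
    · refine ⟨L + 1, le_rfl, ?_, h⟩
      rw [if_neg (Nat.succ_ne_zero L), pow_succ]
      linarith

/-- Integration of a seminorm against a weight with bounded averages, over dyadic intervals. -/
lemma IsDualSeminorm.weighted_le {p : Linfty μ → ℝ} (hp : IsDualSeminorm p)
    (ha : BoundedAverages a κ) {F : ℝ → Linfty μ} {h : Linfty μ}
    (hF : ∀ g, ∫ v in Ioi 0, pairing (a v • F v) g = pairing h g) {τ : ℝ} (hτ : 0 < τ) {L : ℕ}
    (hsupp : ∀ v, 0 < v → a v ≠ 0 → v ≤ 2 ^ L * τ) {m : ℕ → ℝ} (hm : ∀ l, 0 ≤ m l)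
    (hle : ∀ l ≤ L, ∀ v ∈ dyadicPiece τ l, a v ≠ 0 → p (F v) ≤ m l) :
    p h ≤ ∑ l ∈ Finset.range (L + 1), κ * (2 ^ l * τ) * m l := by
  have hint : ∀ l, IntegrableOn (fun v => ‖a v‖ * m l) (dyadicPiece τ l) := fun l =>
    IntegrableOn.mono_set (t := Ioc 0 (2 ^ l * τ))
      ((ha.integrableOn (2 ^ l * τ)).norm.mul_const (m l)) (dyadicPiece_subset hτ l)
  have hint' : ∀ l, Integrable ((dyadicPiece τ l).indicator fun v => ‖a v‖ * m l)
      (volume.restrict (Ioi 0)) := fun l =>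
    ((integrable_indicator_iff (measurableSet_dyadicPiece τ l)).2 (hint l)).restrict
  have h1 := hp.le_integral (ν := volume.restrict (Ioi 0)) (F := fun v => a v • F v) hF
    (m := fun v => ∑ l ∈ Finset.range (L + 1),
      (dyadicPiece τ l).indicator (fun v => ‖a v‖ * m l) v)
    (integrable_finsetSum _ fun l _ => hint' l) ?_
  · refine h1.trans ?_
    rw [integral_finsetSum _ fun l _ => hint' l]
    refine Finset.sum_le_sum fun l _ => ?_
    rw [setIntegral_indicator (measurableSet_dyadicPiece τ l), inter_eq_right.2
      ((dyadicPiece_subset hτ l).trans Ioc_subset_Ioi_self), integral_mul_const]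
    refine mul_le_mul_of_nonneg_right ?_ (hm l)
    refine (setIntegral_mono_set (ha.integrableOn (2 ^ l * τ)).norm
      (ae_of_all _ fun _ => norm_nonneg _) (dyadicPiece_subset hτ l).eventuallyLE).trans
      (ha.integral_le _ (by positivity))
  · filter_upwards [ae_restrict_mem measurableSet_Ioi] with v hv
    have hnn : ∀ l ∈ Finset.range (L + 1),
        0 ≤ (dyadicPiece τ l).indicator (fun v => ‖a v‖ * m l) v := fun l _ =>
      indicator_nonneg (fun v _ => mul_nonneg (norm_nonneg _) (hm l)) v
    refine (hp.smul_le _ _).trans ?_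
    by_cases h0 : a v = 0
    · rw [h0, norm_zero, zero_mul]
      exact Finset.sum_nonneg hnn
    · obtain ⟨l, hl, hl'⟩ := exists_mem_dyadicPiece hv (hsupp v hv h0)
      refine le_trans ?_ (Finset.single_le_sum hnn (Finset.mem_range.2 (Nat.lt_succ_of_le hl)))
      rw [indicator_of_mem hl']
      exact mul_le_mul_of_nonneg_left (hle l hl v hl' h0) (norm_nonneg _)

lemma isDualSeminorm_norm_pairing (g : Lp ℂ 1 μ) : IsDualSeminorm fun x => ‖pairing x g‖ := by
  intro x
  refine ⟨((‖pairing x g‖⁻¹ : ℝ) : ℂ) • pairing x g • g, fun y => ?_, ?_⟩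
  · rw [pairing_smul_right, pairing_smul_right, ← mul_assoc, norm_mul, norm_mul, RCLike.norm_conj,
      RCLike.norm_conj, Complex.norm_real, norm_inv, norm_norm]
    exact mul_le_of_le_one_left (norm_nonneg _) inv_mul_le_one
  · rw [pairing_smul_right, pairing_smul_right, ← mul_assoc, ← map_mul, mul_comm]
    exact mul_conj_sign _

namespace SubordinatedSemigroup

variable (hP : SubordinatedSemigroup P Q β c)

include hP

lemma integrableOn_weight (ha : CompactWeight a κ) {x : ℝ} (hx : 0 ≤ x) (f : Linfty μ) :
    IntegrableOn (fun v => a v • Q (v + x) f) (Ioi 0) := by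
  obtain ⟨ε, R, hε, h⟩ := ha.support
  have hβ := hP.beta_pos
  have hc : ContinuousOn (fun v => Q (v + x) f) (Ioi 0) :=
    (hP.continuousOn_deriv f).comp (by fun_prop) fun v hv => by
      have hv' : 0 < v := hv
      exact mem_Ioi.2 (by linarith)
  refine (ha.integrableOn_Ioi.norm.mul_const (2 * β / ε * ‖f‖)).mono'
    (ha.integrableOn_Ioi.aestronglyMeasurable.smul
      (hc.aestronglyMeasurable measurableSet_Ioi)) ?_
  filter_upwards [ae_restrict_mem measurableSet_Ioi] with v hv
  rw [norm_smul]
  by_cases h0 : a v = 0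
  · simp [h0]
  · have hv' := (h v h0).1
    refine mul_le_mul_of_nonneg_left ((hP.norm_deriv_le (by linarith) f).trans ?_) (norm_nonneg _)
    gcongr
    linarith

omit hP in
/-- The integral `∫_0^∞ a(v) Q_{v+x} f dv` in `L^∞`. -/
def weightedDeriv (Q : ℝ → Linfty μ →L[ℂ] Linfty μ) (a : ℝ → ℂ) (x : ℝ) (f : Linfty μ) :
    Linfty μ := ∫ v in Ioi 0, a v • Q (v + x) f

lemma pairing_weightedDeriv (ha : CompactWeight a κ) {x : ℝ} (hx : 0 ≤ x) (f : Linfty μ)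
    (g : Lp ℂ 1 μ) :
    ∫ v in Ioi 0, pairing (a v • Q (v + x) f) g = pairing (weightedDeriv Q a x f) g :=
  (pairingLeft g).integral_comp_comm (hP.integrableOn_weight ha hx f)

lemma map_weightedDeriv (ha : CompactWeight a κ) {x : ℝ} (hx : 0 ≤ x) (f : Linfty μ) :
    P x (weightedDeriv Q a 0 f) = weightedDeriv Q a x f := by
  rw [weightedDeriv, ← (P x).integral_comp_comm (hP.integrableOn_weight ha le_rfl f)]
  refine setIntegral_congr_fun measurableSet_Ioi fun v hv => ?_
  have hv' : 0 < v := hv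
  rw [map_smul, add_zero, ← hP.deriv_add hx hv', add_comm]

lemma weightedDeriv_split (ha : CompactWeight a κ) {s : Set ℝ} (hs : MeasurableSet s)
    (f : Linfty μ) : weightedDeriv Q a 0 f =
      weightedDeriv Q (s.indicator a) 0 f + weightedDeriv Q (sᶜ.indicator a) 0 f := by
  rw [weightedDeriv, weightedDeriv, weightedDeriv,
    ← integral_add (hP.integrableOn_weight (ha.indicator hs) le_rfl f)
      (hP.integrableOn_weight (ha.indicator hs.compl) le_rfl f)]
  refine setIntegral_congr_fun measurableSet_Ioi fun v _ => ?_
  by_cases hv : v ∈ s <;> simp [hv]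

/-- `sq_defectNorm_deriv_le` on the dyadic interval of index `l`, with square roots taken. The gain
`2^{-l/2}` is weakened to `(3/4)^l` to avoid square roots of powers. -/
lemma defectNorm_deriv_le {τ w S A : ℝ} (hτ : 0 < τ) (l : ℕ) (hS : S = 2 ^ l * (τ / 8))
    (hw : 2 ^ l * τ / 2 ≤ w) (f : Linfty μ) {g : Lp ℂ 1 μ} (hg : L1.IsNonneg g)
    (hA : rePairing g (P (c * (w / 2) + τ + (w / 2 - 2 * S)) (schwarzDefect (P S) (P S f))) ≤ A) :
    defectNorm (P τ) g (Q w f) ≤ 24 * β / (2 ^ l * τ) * (3 / 4) ^ l * √A := by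
  have hβ := hP.beta_pos
  have hw0 : 0 < w := lt_of_lt_of_le (by positivity) hw
  have h1 := hP.sq_defectNorm_deriv_le (w := w) hτ l hS (by rw [hS]; linarith) f hg
  have hA0 : 0 ≤ A := (rePairing_nonneg hg
    ((hP.subMarkov _).positive _ (hP.isNonneg_defect S _))).trans hA
  refine abs_le_of_sq_le_sq' ?_ (by positivity) |>.2
  have h2 : (4 * β / w) ^ 2 ≤ (8 * β / (2 ^ l * τ)) ^ 2 := by
    refine pow_le_pow_left₀ (by positivity) ?_ 2
    rw [div_le_div_iff₀ hw0 (by positivity)]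
    nlinarith
  have h3 : (8 / 2 ^ l : ℝ) ≤ (3 * (3 / 4) ^ l) ^ 2 := by
    have e : (8 / 2 ^ l : ℝ) = 8 * (1 / 2) ^ l := by rw [one_div, inv_pow]; ring
    rw [e, mul_pow, ← pow_mul, mul_comm l 2, pow_mul]
    have : ((1 : ℝ) / 2) ^ l ≤ ((3 / 4) ^ 2) ^ l := by gcongr; norm_num
    nlinarith [show (0 : ℝ) ≤ (1 / 2) ^ l by positivity]
  calc defectNorm (P τ) g (Q w f) ^ 2 ≤ (4 * β / w) ^ 2 * (8 / 2 ^ l) * A :=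
        h1.trans (mul_le_mul_of_nonneg_left hA (by positivity))
    _ ≤ (8 * β / (2 ^ l * τ)) ^ 2 * (3 * (3 / 4) ^ l) ^ 2 * A := by gcongr
    _ = (24 * β / (2 ^ l * τ) * (3 / 4) ^ l * √A) ^ 2 := by
        rw [mul_pow _ (√A), Real.sq_sqrt hA0]
        ring

lemma norm_defect_shift_le {N : ℝ} {f : Linfty μ} {S : ℝ} (hS : 0 < S)
    (hN : ‖schwarzDefect (P S) f‖ ≤ N ^ 2) (y : ℝ) {g : Lp ℂ 1 μ} (hg : L1.IsNonneg g) :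
    rePairing g (P y (schwarzDefect (P S) (P S f))) ≤ N ^ 2 * ‖g‖ := by
  refine (((hP.weakLE_gammaTwo hS.le hS.le f).map (hP.subMarkov y)) g hg).trans
    ((rePairing_le_norm _ _).trans (mul_le_mul_of_nonneg_right ?_ (norm_nonneg _)))
  exact ((hP.subMarkov y).norm_apply_le _).trans (((hP.subMarkov S).norm_apply_le _).trans hN)

omit hP in
lemma sum_three_quarters_pow_le (L : ℕ) : ∑ l ∈ Finset.range L, (3 / 4 : ℝ) ^ l ≤ 4 := by
  rw [geom_sum_eq (by norm_num), div_le_iff_of_neg (by norm_num)]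
  have : (0 : ℝ) ≤ (3 / 4) ^ L := by positivity
  linarith

/-- The defect at scale `τ` of an integral over parameters at least `τ`. -/
lemma defectNorm_weightedDeriv_le (ha : CompactWeight a κ) {x τ : ℝ} (hx : 0 ≤ x) (hτ : 0 < τ)
    (hv : ∀ v, 0 < v → a v ≠ 0 → τ ≤ v + x) {N : ℝ} (hN0 : 0 ≤ N) {f : Linfty μ}
    (hN : ∀ t, 0 < t → ‖schwarzDefect (P t) f‖ ≤ N ^ 2) {g : Lp ℂ 1 μ} (hg : L1.IsNonneg g) :
    defectNorm (P τ) g (weightedDeriv Q a x f) ≤ 96 * κ * β * N * √‖g‖ := by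
  have hβ := hP.beta_pos
  have hκ := ha.nonneg
  obtain ⟨ε, R, hε, h⟩ := ha.support
  obtain ⟨L, hL⟩ := pow_unbounded_of_one_lt (R / τ) (one_lt_two : (1 : ℝ) < 2)
  rw [div_lt_iff₀ hτ] at hL
  have h1 := (hP.isDualSeminorm τ hg).weighted_le ha.toBoundedAverages
    (hP.pairing_weightedDeriv ha hx f) hτ (L := L) (fun v _ hv' => (h v hv').2.trans hL.le)
    (m := fun l => 24 * β / (2 ^ l * τ) * (3 / 4) ^ l * √(N ^ 2 * ‖g‖))
    (fun l => by positivity) fun l hl v hvl hv' => ?_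
  · refine h1.trans ?_
    have e : ∀ l : ℕ, κ * (2 ^ l * τ) * (24 * β / (2 ^ l * τ) * (3 / 4) ^ l * √(N ^ 2 * ‖g‖)) =
        24 * κ * β * N * √‖g‖ * (3 / 4) ^ l := fun l => by
      rw [Real.sqrt_mul (by positivity), Real.sqrt_sq hN0]
      field_simp
    simp_rw [e]
    rw [← Finset.mul_sum]
    refine (mul_le_mul_of_nonneg_left (sum_three_quarters_pow_le _) (by positivity)).trans_eq ?_
    ring
  · have hv0 : 0 < v := (dyadicPiece_subset hτ l hvl).1
    refine hP.defectNorm_deriv_le hτ l rfl ?_ f hg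
      (hP.norm_defect_shift_le (by positivity) (hN _ (by positivity)) _ hg)
    rcases Nat.eq_zero_or_pos l with rfl | hl0
    · have := hv v hv0 hv'
      rw [pow_zero, one_mul]
      linarith
    · have := hvl.1
      rw [if_neg hl0.ne'] at this
      linarith

end SubordinatedSemigroup

end Weights

section SquareFunction

variable {M : Type*} [MeasurableSpace M] {μ : Measure M} {P Q : ℝ → Linfty μ →L[ℂ] Linfty μ}
  {β c s t : ℝ} {a : ℝ → ℂ} {κ : ℝ}

/-! ### The `bmo` estimate -/

/-- Young's inequality for the convolution with a geometric sequence. -/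
lemma sum_geometric_convolution_le {u : ℕ → ℝ} (hu : ∀ j, 0 ≤ u j) (K : ℕ) :
    ∑ k ∈ Finset.range K, ∑ l ∈ Finset.range (k + 1), (3 / 4 : ℝ) ^ l * u (k - l) ≤
      4 * ∑ j ∈ Finset.range K, u j := by
  let w : ℕ → ℝ := fun k => ∑ l ∈ Finset.range (k + 1), (3 / 4 : ℝ) ^ l * u (k - l)
  have hw : ∀ k, w (k + 1) = u (k + 1) + 3 / 4 * w k := fun k => by
    simp only [w]
    rw [Finset.sum_range_succ', Finset.mul_sum, add_comm]
    simp only [pow_zero, one_mul, Nat.sub_zero]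
    congr 1
    refine Finset.sum_congr rfl fun l _ => ?_
    rw [Nat.add_sub_add_right, pow_succ]
    ring
  have hw0 : ∀ k, 0 ≤ w k := fun k =>
    Finset.sum_nonneg fun l _ => mul_nonneg (by positivity) (hu _)
  have key : ∀ K, ∑ k ∈ Finset.range (K + 1), w k + 3 * w K ≤
      4 * ∑ j ∈ Finset.range (K + 1), u j := fun K => by
    induction K with
    | zero => simp [w]; linarith
    | succ K ih =>
      rw [Finset.sum_range_succ, Finset.sum_range_succ (f := u), hw]
      linarith
  cases K with
  | zero => simp
  | succ K =>
    have h1 := key K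
    have h2 := hw0 K
    change ∑ k ∈ Finset.range (K + 1), w k ≤ _
    linarith

/-- The Cauchy–Schwarz inequality with the weights `(3/4)^l`. -/
lemma sq_sum_three_quarters_le (L : ℕ) {x : ℕ → ℝ} (hx : ∀ l, 0 ≤ x l) :
    (∑ l ∈ Finset.range L, (3 / 4 : ℝ) ^ l * √(x l)) ^ 2 ≤
      4 * ∑ l ∈ Finset.range L, (3 / 4 : ℝ) ^ l * x l := by
  have h1 := Finset.sum_sq_le_sum_mul_sum_of_sq_le_mul (Finset.range L)
    (r := fun l => (3 / 4 : ℝ) ^ l * √(x l)) (f := fun l => (3 / 4 : ℝ) ^ l)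
    (g := fun l => (3 / 4 : ℝ) ^ l * x l) (fun l _ => by positivity)
    (fun l _ => mul_nonneg (by positivity) (hx l)) fun l _ => by
      rw [mul_pow, Real.sq_sqrt (hx l)]
      exact (by ring : _ = _).le
  exact h1.trans (mul_le_mul_of_nonneg_right
    (SubordinatedSemigroup.sum_three_quarters_pow_le L)
    (Finset.sum_nonneg fun l _ => mul_nonneg (by positivity) (hx l)))

namespace SubordinatedSemigroup

variable (hP : SubordinatedSemigroup P Q β c)

include hP

/-- The defect at time `τ`, decomposed along the times `τ / 2, τ / 4, …`. -/
lemma defect_dyadic {τ : ℝ} (hτ : 0 ≤ τ) (K : ℕ) (F : Linfty μ) :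
    schwarzDefect (P τ) F = ∑ k ∈ Finset.range K, P (τ - 2 * (τ / 2 ^ (k + 1)))
      (schwarzDefect (P (τ / 2 ^ (k + 1))) (P (τ / 2 ^ (k + 1)) F)) +
        P (τ - τ / 2 ^ K) (schwarzDefect (P (τ / 2 ^ K)) F) := by
  induction K with
  | zero => simp [hP.zero]
  | succ K ih =>
    have hr : 0 ≤ τ / 2 ^ (K + 1) := by positivity
    have e : τ / 2 ^ K = τ / 2 ^ (K + 1) + τ / 2 ^ (K + 1) := by rw [pow_succ]; ring
    have hle : τ / 2 ^ K ≤ τ := div_le_self hτ (one_le_pow₀ (by norm_num))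
    have hd := hP.defect_add hr hr F
    rw [← e] at hd
    rw [ih, Finset.sum_range_succ, add_assoc, hd, map_add, ← hP.add (by linarith) hr,
      show τ - τ / 2 ^ K + τ / 2 ^ (K + 1) = τ - τ / 2 ^ (K + 1) by linarith,
      show τ - τ / 2 ^ K = τ - 2 * (τ / 2 ^ (K + 1)) by linarith]
    congr 1
    exact add_comm _ _

/-- Times that differ from `n τ` by a bounded multiple of `τ` have ratio `1 + O(1 / n)`, whose power
`β ≤ n / 4` is bounded. -/
lemma ratio_rpow_le {n : ℝ} (hn4 : 4 ≤ n) (hnβ : 4 * β ≤ n) {x y τ : ℝ} (hτ : 0 < τ)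
    (hx : x ≤ (n + 1) * τ) (hy : (n - 5 / 4) * τ ≤ y) (hx0 : 0 ≤ x) : (x / y) ^ β ≤ 4 := by
  have hβ := hP.beta_pos
  have hy0 : 0 < y := lt_of_lt_of_le (mul_pos (by linarith) hτ) hy
  have h1 : x / y ≤ 1 + 9 / 4 / (n - 5 / 4) := by
    rw [div_le_iff₀ hy0, one_add_div (by linarith), div_mul_eq_mul_div, le_div_iff₀ (by linarith)]
    nlinarith
  have h2 : x / y ≤ Real.exp (9 / 4 / (n - 5 / 4)) :=
    h1.trans (by rw [add_comm]; exact Real.add_one_le_exp _)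
  calc (x / y) ^ β ≤ (Real.exp (9 / 4 / (n - 5 / 4))) ^ β :=
        Real.rpow_le_rpow (by positivity) h2 hβ.le
    _ = Real.exp (9 / 4 / (n - 5 / 4) * β) := by rw [← Real.exp_mul]
    _ ≤ Real.exp 1 := by
        refine Real.exp_le_exp.2 ?_
        rw [div_mul_eq_mul_div, div_le_one (by linarith)]
        linarith
    _ ≤ 4 := by linarith [Real.exp_one_lt_d9]

lemma rePairing_adjoint {r : ℝ} {g : Lp ℂ 1 μ} (hg : L1.IsNonneg g) :
    ∃ g', L1.IsNonneg g' ∧ ‖g'‖ ≤ ‖g‖ ∧ ∀ F, rePairing g (P r F) = rePairing g' F := by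
  obtain ⟨g', h1, h2, h3⟩ := (hP.subMarkov r).exists_adjoint hg
  exact ⟨g', h1, h2, fun F => by rw [rePairing, rePairing, h3]⟩

/-- The contribution of small parameters. The outer times are all comparable to `n τ`, within a
factor `1 + O(1 / n)`, so that for `n ≥ 4 β` quasi-monotonicity only costs a constant. -/
lemma rePairing_defect_small_le (ha : CompactWeight a κ) {n τ : ℝ} (hτ : 0 < τ) (hn4 : 4 ≤ n)
    (hnβ : 4 * β ≤ n) (hsupp : ∀ v, a v ≠ 0 → v ≤ τ) {N : ℝ} (hN0 : 0 ≤ N) {f : Linfty μ}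
    (hN : ∀ t, 0 < t → ‖schwarzDefect (P t) f‖ ≤ N ^ 2) {g : Lp ℂ 1 μ} (hg : L1.IsNonneg g) :
    rePairing g (P ((n - 1) * τ) (schwarzDefect (P τ) (weightedDeriv Q a 0 f))) ≤
      2 * (192 * κ * β * N) ^ 2 * ‖g‖ := by
  have hβ := hP.beta_pos
  have hκ := ha.nonneg
  have hc2 := hP.half_le
  have hc1 := hP.le_one
  obtain ⟨ε, R, hε, hsuppε⟩ := ha.support
  obtain ⟨K, hK⟩ := pow_unbounded_of_one_lt (τ / ε) (one_lt_two : (1 : ℝ) < 2)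
  rw [div_lt_iff₀ hε] at hK
  set h := weightedDeriv Q a 0 f with hh
  have hn1 : 0 ≤ (n - 1) * τ := mul_nonneg (by linarith) hτ.le
  have hn2 : 0 ≤ (n - 2) * τ := mul_nonneg (by linarith) hτ.le
  -- the pieces of the defect of `f` at time `τ`
  let r : ℕ → ℝ := fun k => τ / 2 ^ (k + 1)
  have hr : ∀ k, 0 < r k := fun k => by positivity
  have hr2 : ∀ k, 2 * r k ≤ τ := fun k => by
    simp only [r]
    rw [pow_succ, ← mul_div_assoc, div_le_iff₀ (by positivity)]
    have : (1 : ℝ) ≤ 2 ^ k := one_le_pow₀ (by norm_num)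
    nlinarith
  let A : ℕ → ℝ := fun m => rePairing g (P ((n - 2) * τ + (τ - 2 * r m))
    (schwarzDefect (P (r m)) (P (r m) f)))
  have hA0 : ∀ m, 0 ≤ A m := fun m =>
    rePairing_nonneg hg ((hP.subMarkov _).positive _ (hP.isNonneg_defect _ _))
  have hAsum : ∀ L, ∑ m ∈ Finset.range L, A m ≤ N ^ 2 * ‖g‖ := fun L => by
    have e1 : rePairing g (P ((n - 2) * τ) (schwarzDefect (P τ) f)) =
        ∑ m ∈ Finset.range L, A m + rePairing g (P ((n - 2) * τ)
          (P (τ - τ / 2 ^ L) (schwarzDefect (P (τ / 2 ^ L)) f))) := by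
      conv_lhs => rw [hP.defect_dyadic hτ.le L f]
      rw [map_add, map_sum, rePairing_add, rePairing_sum]
      congr 1
      refine Finset.sum_congr rfl fun m _ => ?_
      rw [← hP.add hn2 (sub_nonneg.2 (hr2 m))]
    have e2 := rePairing_nonneg hg ((hP.subMarkov ((n - 2) * τ)).positive _
      ((hP.subMarkov (τ - τ / 2 ^ L)).positive _ (hP.isNonneg_defect (τ / 2 ^ L) f)))
    have e3 : rePairing g (P ((n - 2) * τ) (schwarzDefect (P τ) f)) ≤ N ^ 2 * ‖g‖ :=
      (rePairing_le_norm _ _).trans (mul_le_mul_of_nonneg_right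
        (((hP.subMarkov _).norm_apply_le _).trans (hN τ hτ)) (norm_nonneg _))
    linarith
  -- one piece of the defect of `h`
  have hpiece : ∀ k, rePairing g (P ((n - 1) * τ + (τ - 2 * r k))
      (schwarzDefect (P (r k)) (P (r k) h))) ≤
        (48 * κ * β) ^ 2 *
          (4 * ∑ l ∈ Finset.range (k + 2), (3 / 4 : ℝ) ^ l * A (k + 1 - l + 2)) := by
    intro k
    obtain ⟨g', hg', -, hadj⟩ := hP.rePairing_adjoint (r := (n - 1) * τ + (τ - 2 * r k)) hg
    rw [hadj, ← hP.sq_defectNorm _ hg', hP.map_weightedDeriv ha (hr k).le]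
    have hτk : τ = 2 ^ (k + 1) * r k := by simp only [r]; field_simp
    have h1 := (hP.isDualSeminorm (r k) hg').weighted_le ha.toBoundedAverages
      (hP.pairing_weightedDeriv ha (hr k).le f) (hr k) (L := k + 1)
      (fun v _ hv' => (hsupp v hv').trans_eq hτk)
      (m := fun l => 24 * β / (2 ^ l * r k) * (3 / 4) ^ l * √(4 * A (k + 1 - l + 2)))
      (fun l => mul_nonneg (mul_nonneg (div_nonneg (by positivity)
        (mul_nonneg (by positivity) (hr k).le)) (by positivity)) (Real.sqrt_nonneg _))
      fun l hl v hvl hv' => ?_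
    · have e : ∀ l : ℕ, κ * (2 ^ l * r k) * (24 * β / (2 ^ l * r k) * (3 / 4) ^ l *
          √(4 * A (k + 1 - l + 2))) =
            48 * κ * β * ((3 / 4) ^ l * √(A (k + 1 - l + 2))) := fun l => by
        have e4 : √(4 * A (k + 1 - l + 2)) = 2 * √(A (k + 1 - l + 2)) := by
          rw [Real.sqrt_mul (by norm_num), show (4 : ℝ) = 2 ^ 2 by norm_num,
            Real.sqrt_sq (by norm_num)]
        have := (hr k).ne'
        rw [e4]
        field_simp
        ring
      simp_rw [e] at h1
      rw [← Finset.mul_sum] at h1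
      refine (pow_le_pow_left₀ (defectNorm_nonneg _ _ _) h1 2).trans ?_
      rw [mul_pow]
      exact mul_le_mul_of_nonneg_left (sq_sum_three_quarters_le (k + 1 + 1)
        (x := fun l => A (k + 1 - l + 2)) fun l => hA0 _) (by positivity)
    · have hv0 : 0 < v := (dyadicPiece_subset (hr k) l hvl).1
      have hvτ := hsupp v hv'
      -- the inner time `2^l r_k / 8` is again one of the times `r_m`
      have hS : r (k + 1 - l + 2) = 2 ^ l * (r k / 8) := by
        obtain ⟨j, hj⟩ : ∃ j, k + 1 = l + j := ⟨k + 1 - l, by omega⟩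
        have hj' : k + 1 - l = j := by omega
        simp only [r]
        rw [hj', hj, show j + 2 + 1 = j + 3 by ring, pow_add, pow_add]
        field_simp
        norm_num
      have hSle : 8 * r (k + 1 - l + 2) ≤ τ := by
        rw [hS, hτk]
        have : (2 : ℝ) ^ l ≤ 2 ^ (k + 1) := pow_le_pow_right₀ (by norm_num) hl
        nlinarith [hr k]
      have hw : 2 ^ l * r k / 2 ≤ v + r k := by
        rcases Nat.eq_zero_or_pos l with rfl | hl0
        · rw [pow_zero, one_mul]
          linarith [hr k]
        · have := hvl.1
          rw [if_neg hl0.ne'] at this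
          linarith [hr k]
      refine hP.defectNorm_deriv_le (hr k) l hS hw f hg' ?_
      set S := r (k + 1 - l + 2) with hSdef
      have hS0 : 0 < S := hr _
      have hwS : 4 * S ≤ v + r k := by rw [hS]; linarith
      have hrk := hr k
      have hrk2 := hr2 k
      have hcw0 : 0 ≤ c * ((v + r k) / 2) := mul_nonneg (by linarith) (by linarith)
      have hcw : c * ((v + r k) / 2) ≤ (v + r k) / 2 := mul_le_of_le_one_left (by linarith) hc1
      rw [← hadj, ← hP.add (add_nonneg hn1 (by linarith)) (by linarith)]
      have hbase : 0 < (n - 2) * τ + (τ - 2 * S) := by nlinarith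
      refine (hP.rePairing_le hbase (by nlinarith) (hP.isNonneg_defect S (P S f)) hg).trans ?_
      refine mul_le_mul_of_nonneg_right ?_ (hA0 _)
      refine hP.ratio_rpow_le hn4 hnβ hτ ?_ ?_ ?_
      · linarith
      · linarith
      · nlinarith
  -- the remainder only sees parameters larger than the time
  have hrem : rePairing g (P ((n - 1) * τ + (τ - τ / 2 ^ K)) (schwarzDefect (P (τ / 2 ^ K)) h)) ≤
      (192 * κ * β * N) ^ 2 * ‖g‖ := by
    obtain ⟨g', hg', hgn, hadj⟩ := hP.rePairing_adjoint (r := (n - 1) * τ + (τ - τ / 2 ^ K)) hg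
    rw [hadj, ← hP.sq_defectNorm _ hg']
    have h1 := hP.defectNorm_weightedDeriv_le ha le_rfl (show 0 < τ / 2 ^ K by positivity)
      (fun v _ hv' => by
        rw [add_zero]
        refine le_trans ?_ (hsuppε v hv').1
        rw [div_le_iff₀ (by positivity), mul_comm]
        exact hK.le) hN0 hN hg'
    refine (pow_le_pow_left₀ (defectNorm_nonneg _ _ _) h1 2).trans ?_
    rw [mul_pow, Real.sq_sqrt (norm_nonneg _)]
    refine mul_le_mul ?_ hgn (norm_nonneg _) (by positivity)
    refine pow_le_pow_left₀ (by positivity) ?_ 2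
    have : 0 ≤ κ * β * N := by positivity
    linarith
  have hτK : τ / 2 ^ K ≤ τ := div_le_self hτ.le (one_le_pow₀ (by norm_num))
  rw [hP.defect_dyadic hτ.le K h, map_add, map_sum, rePairing_add, rePairing_sum,
    ← hP.add hn1 (sub_nonneg.2 hτK)]
  have hsum : ∑ k ∈ Finset.range K, rePairing g (P ((n - 1) * τ) (P (τ - 2 * r k)
      (schwarzDefect (P (r k)) (P (r k) h)))) ≤ (192 * κ * β * N) ^ 2 * ‖g‖ := by
    have h1 : ∀ k ∈ Finset.range K, rePairing g (P ((n - 1) * τ) (P (τ - 2 * r k)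
        (schwarzDefect (P (r k)) (P (r k) h)))) ≤ (48 * κ * β) ^ 2 *
          (4 * ∑ l ∈ Finset.range (k + 2), (3 / 4 : ℝ) ^ l * A (k + 1 - l + 2)) := fun k _ => by
      rw [← hP.add hn1 (sub_nonneg.2 (hr2 k))]
      exact hpiece k
    refine (Finset.sum_le_sum h1).trans ?_
    rw [← Finset.mul_sum, ← Finset.mul_sum]
    have h2 := sum_geometric_convolution_le (u := fun j => A (j + 2)) (fun j => hA0 _) (K + 1)
    rw [Finset.sum_range_succ'] at h2
    have h3 : 0 ≤ ∑ l ∈ Finset.range (0 + 1), (3 / 4 : ℝ) ^ l * A (0 - l + 2) :=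
      Finset.sum_nonneg fun l _ => mul_nonneg (by positivity) (hA0 _)
    have h4 : ∑ j ∈ Finset.range (K + 1), A (j + 2) ≤ N ^ 2 * ‖g‖ := by
      refine le_trans ?_ (hAsum (K + 1 + 2))
      rw [Finset.sum_range_succ' _ (K + 1 + 1), Finset.sum_range_succ' _ (K + 1)]
      linarith [hA0 0, hA0 (0 + 1)]
    have h5 : ∑ k ∈ Finset.range K, ∑ l ∈ Finset.range (k + 2),
        (3 / 4 : ℝ) ^ l * A (k + 1 - l + 2) ≤ 4 * (N ^ 2 * ‖g‖) :=
      le_trans (by linarith) (h2.trans (mul_le_mul_of_nonneg_left h4 (by norm_num)))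
    refine (mul_le_mul_of_nonneg_left (mul_le_mul_of_nonneg_left h5 (by norm_num))
      (by positivity)).trans_eq ?_
    ring
  refine (add_le_add hsum hrem).trans_eq ?_
  ring

end SubordinatedSemigroup

end SquareFunction

section MeanOscillation

variable {M : Type*} [MeasurableSpace M] {μ : Measure M} [SigmaFinite μ]
  {P Q : ℝ → Linfty μ →L[ℂ] Linfty μ} {β c s t : ℝ} {a : ℝ → ℂ} {κ : ℝ}

/-- `‖SF‖² ≤ ‖S|F|²‖`. -/
lemma IsSubMarkov.norm_apply_sq_le {S : Linfty μ →L[ℂ] Linfty μ} (hS : IsSubMarkov S)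
    (F : Linfty μ) : ‖S F‖ ^ 2 ≤ ‖S (absSq F)‖ := by
  rw [← norm_absSq]
  exact norm_le_of_rePairing_le (isNonneg_absSq _) (norm_nonneg _) fun g hg =>
    (rePairing_absSq_le hS hg F).trans (rePairing_le_norm _ _)

namespace SubordinatedSemigroup

variable (hP : SubordinatedSemigroup P Q β c)

include hP

lemma norm_defect_le_of_forall {F : Linfty μ} {C : ℝ} (h : ∀ g, L1.IsNonneg g →
    defectNorm (P t) g F ≤ C * √‖g‖) : ‖schwarzDefect (P t) F‖ ≤ C ^ 2 := by
  refine norm_le_of_rePairing_le (hP.isNonneg_defect t F) (sq_nonneg C) fun g hg => ?_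
  rw [← hP.sq_defectNorm t hg]
  refine (pow_le_pow_left₀ (defectNorm_nonneg _ _ _) (h g hg) 2).trans_eq ?_
  rw [mul_pow, Real.sq_sqrt (norm_nonneg g)]

omit [SigmaFinite μ] in
lemma defectNorm_le_of_norm {F : Linfty μ} {C : ℝ} (hC : 0 ≤ C)
    (h : ‖schwarzDefect (P t) F‖ ≤ C ^ 2) {g : Lp ℂ 1 μ} (hg : L1.IsNonneg g) :
    defectNorm (P t) g F ≤ C * √‖g‖ := by
  refine (abs_le_of_sq_le_sq' ?_ (by positivity)).2
  rw [hP.sq_defectNorm t hg, mul_pow, Real.sq_sqrt (norm_nonneg g)]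
  exact (rePairing_le_norm _ _).trans (mul_le_mul_of_nonneg_right h (norm_nonneg g))

lemma norm_defect_le (t : ℝ) (F : Linfty μ) : ‖schwarzDefect (P t) F‖ ≤ ‖F‖ ^ 2 := by
  refine norm_le_of_rePairing_le (hP.isNonneg_defect t F) (by positivity) fun g hg => ?_
  refine (rePairing_schwarzDefect_le _ hg F).trans ((rePairing_le_norm _ _).trans ?_)
  rw [← norm_absSq]
  exact mul_le_mul_of_nonneg_right ((hP.subMarkov t).norm_apply_le _) (norm_nonneg g)

/-- The defect of `∫ a(v) Q_v f dv`: the time `t` is divided into about `4 β` equal steps, and only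
in the first step are there parameters smaller than the step. -/
theorem norm_defect_weightedDeriv_le (ha : CompactWeight a κ) {N : ℝ} (hN0 : 0 ≤ N)
    {f : Linfty μ} (hN : ∀ t, 0 < t → ‖schwarzDefect (P t) f‖ ≤ N ^ 2) (ht : 0 < t) :
    ‖schwarzDefect (P t) (weightedDeriv Q a 0 f)‖ ≤ (576 * κ * β ^ 2 * N) ^ 2 := by
  have hβ := hP.beta_pos
  have hβ1 := hP.one_le
  have hκ := ha.nonneg
  refine norm_le_of_rePairing_le (hP.isNonneg_defect t _) (by positivity) fun g hg => ?_
  set h := weightedDeriv Q a 0 f with hh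
  obtain ⟨n, hn⟩ : ∃ n : ℕ, n = ⌈4 * β⌉₊ := ⟨_, rfl⟩
  have hnβ : 4 * β ≤ n := hn ▸ Nat.le_ceil _
  have hnβ' : (n : ℝ) < 4 * β + 1 := hn ▸ Nat.ceil_lt_add_one (by positivity)
  have hn4 : (4 : ℝ) ≤ n := by linarith
  have hn0 : (0 : ℝ) < n := by linarith
  obtain ⟨m, rfl⟩ : ∃ m, n = m + 1 := Nat.exists_eq_succ_of_ne_zero (by
    rintro rfl
    simp at hn0)
  set τ := t / ((m + 1 : ℕ) : ℝ) with hτdef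
  have hτ : 0 < τ := div_pos ht hn0
  have htn : t = ((m + 1 : ℕ) : ℝ) * τ := by rw [hτdef]; field_simp
  have hκN : 0 ≤ κ * β * N := by positivity
  -- the first step
  have hfirst : rePairing g (P ((((m + 1 : ℕ) : ℝ) - 1) * τ) (schwarzDefect (P τ) h)) ≤
      5 * (192 * κ * β * N) ^ 2 * ‖g‖ := by
    obtain ⟨g', hg', hgn, hadj⟩ := hP.rePairing_adjoint (r := (((m + 1 : ℕ) : ℝ) - 1) * τ) hg
    have hsplit := hP.weightedDeriv_split ha (measurableSet_Iic (a := τ)) f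
    set h1 := weightedDeriv Q ((Iic τ).indicator a) 0 f
    set h2 := weightedDeriv Q ((Iic τ)ᶜ.indicator a) 0 f
    have hs1 := hP.rePairing_defect_small_le (ha.indicator (measurableSet_Iic (a := τ))) hτ hn4 hnβ
      (fun v hv => by
        by_contra hne
        exact hv (indicator_of_notMem (s := Iic τ) (fun h' => hne h') a)) hN0 hN hg
    rw [hadj, ← hP.sq_defectNorm τ hg'] at hs1
    have hs2 := hP.defectNorm_weightedDeriv_le (ha.indicator (measurableSet_Iic (a := τ)).compl)
      le_rfl hτ (fun v _ hv => by
        by_contra hne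
        rw [add_zero, not_le] at hne
        exact hv (indicator_of_notMem (s := (Iic τ)ᶜ) (fun h' => h' (mem_Iic.2 hne.le)) a))
      hN0 hN hg'
    rw [hadj, ← hP.sq_defectNorm τ hg', hh, hsplit]
    have hadd := (hP.isDualSeminorm τ hg').add_le h1 h2
    have hs3 : defectNorm (P τ) g' h2 ^ 2 ≤ (96 * κ * β * N) ^ 2 * ‖g‖ := by
      refine (pow_le_pow_left₀ (defectNorm_nonneg _ _ _) hs2 2).trans ?_
      rw [mul_pow, Real.sq_sqrt (norm_nonneg _)]
      exact mul_le_mul_of_nonneg_left hgn (by positivity)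
    have hsq := pow_le_pow_left₀ (defectNorm_nonneg (P τ) g' (h1 + h2)) hadd 2
    have := sq_nonneg (defectNorm (P τ) g' h1 - defectNorm (P τ) g' h2)
    have hKN : 0 ≤ (κ * β * N) ^ 2 * ‖g‖ := by positivity
    nlinarith
  -- the later steps
  have hlater : ∀ j : ℕ, rePairing g (P ((((m + 1 : ℕ) : ℝ) - 1 - ((j + 1 : ℕ) : ℝ)) * τ)
      (schwarzDefect (P τ) (P (((j + 1 : ℕ) : ℝ) * τ) h))) ≤ (192 * κ * β * N) ^ 2 * ‖g‖ := by
    intro j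
    obtain ⟨g', hg', hgn, hadj⟩ := hP.rePairing_adjoint
      (r := (((m + 1 : ℕ) : ℝ) - 1 - ((j + 1 : ℕ) : ℝ)) * τ) hg
    have hx : τ ≤ ((j + 1 : ℕ) : ℝ) * τ := by
      push_cast
      nlinarith [show (0 : ℝ) ≤ j by positivity]
    rw [hadj, ← hP.sq_defectNorm τ hg', hh, hP.map_weightedDeriv ha (hτ.le.trans hx)]
    have h1 := hP.defectNorm_weightedDeriv_le ha (hτ.le.trans hx) hτ
      (fun v hv _ => by linarith) hN0 hN hg'
    refine (pow_le_pow_left₀ (defectNorm_nonneg _ _ _) h1 2).trans ?_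
    rw [mul_pow, Real.sq_sqrt (norm_nonneg _)]
    refine mul_le_mul ?_ hgn (norm_nonneg _) (by positivity)
    exact pow_le_pow_left₀ (by positivity) (by linarith) 2
  rw [htn, hP.defect_nat_mul hτ.le, rePairing_sum, Finset.sum_range_succ']
  have h0 : rePairing g (P ((((m + 1 : ℕ) : ℝ) - 1 - ((0 : ℕ) : ℝ)) * τ)
      (schwarzDefect (P τ) (P (((0 : ℕ) : ℝ) * τ) h))) ≤ 5 * (192 * κ * β * N) ^ 2 * ‖g‖ := by
    rw [Nat.cast_zero, sub_zero, zero_mul, hP.zero]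
    exact hfirst
  refine (add_le_add (Finset.sum_le_sum fun j _ => hlater j) h0).trans ?_
  rw [Finset.sum_const, Finset.card_range, nsmul_eq_mul]
  have e1 : (m : ℝ) + 5 ≤ 9 * β ^ 2 := by
    push_cast at hnβ'
    nlinarith
  calc (m : ℝ) * ((192 * κ * β * N) ^ 2 * ‖g‖) + 5 * (192 * κ * β * N) ^ 2 * ‖g‖
      = ((m : ℝ) + 5) * ((192 * κ * β * N) ^ 2 * ‖g‖) := by ring
    _ ≤ 9 * β ^ 2 * ((192 * κ * β * N) ^ 2 * ‖g‖) := by gcongr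
    _ = (576 * κ * β ^ 2 * N) ^ 2 * ‖g‖ := by ring

/-! ### The two seminorms -/

lemma norm_sub_double_le {D : ℝ} (hD : 0 ≤ D) {F : Linfty μ}
    (hM : ‖P t (absSq (F - P t F))‖ ≤ D ^ 2) (ht : 0 ≤ t) : ‖P t F - P (2 * t) F‖ ≤ D := by
  have h1 := ((hP.subMarkov t).norm_apply_sq_le (F - P t F)).trans hM
  rw [map_sub, ← hP.add ht ht, ← two_mul] at h1
  exact (abs_le_of_sq_le_sq' h1 hD).2

/-- `BMO ≤ 2 bmo + sup ‖P_t h - P_{2t} h‖`. -/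
lemma norm_oscillation_le {N D : ℝ} (hN0 : 0 ≤ N) (hD0 : 0 ≤ D) {h : Linfty μ} (ht : 0 < t)
    (hN : ‖schwarzDefect (P t) h‖ ≤ N ^ 2) (hD : ‖P t h - P (2 * t) h‖ ≤ D) :
    ‖P t (absSq (h - P t h))‖ ≤ (2 * N + D) ^ 2 := by
  refine norm_le_of_rePairing_le ((hP.subMarkov t).positive _ (isNonneg_absSq _)) (sq_nonneg _)
    fun g hg => ?_
  set k := h - P t h
  have e : rePairing g (P t (absSq k)) =
      defectNorm (P t) g k ^ 2 + rePairing g (absSq (P t k)) := by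
    rw [hP.sq_defectNorm t hg, schwarzDefect, rePairing_sub]
    ring
  have h1 : defectNorm (P t) g h ≤ N * √‖g‖ := hP.defectNorm_le_of_norm hN0 hN hg
  have h2 : defectNorm (P t) g (P t h) ≤ N * √‖g‖ := by
    refine (abs_le_of_sq_le_sq' ?_ (by positivity)).2
    rw [hP.sq_defectNorm t hg, mul_pow, Real.sq_sqrt (norm_nonneg g)]
    exact (hP.gammaTwo ht.le ht.le h hg).trans ((rePairing_le_norm _ _).trans
      (mul_le_mul_of_nonneg_right (((hP.subMarkov t).norm_apply_le _).trans hN) (norm_nonneg g)))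
  have h3 : defectNorm (P t) g k ≤ 2 * N * √‖g‖ :=
    ((hP.isDualSeminorm t hg).sub_le h (P t h)).trans (by linarith)
  have h4 : defectNorm (P t) g k ^ 2 ≤ 4 * N ^ 2 * ‖g‖ := by
    refine (pow_le_pow_left₀ (defectNorm_nonneg _ _ _) h3 2).trans_eq ?_
    rw [mul_pow, Real.sq_sqrt (norm_nonneg g)]
    ring
  have h5 : rePairing g (absSq (P t k)) ≤ D ^ 2 * ‖g‖ := by
    refine (rePairing_le_norm _ _).trans (mul_le_mul_of_nonneg_right ?_ (norm_nonneg g))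
    rw [norm_absSq]
    refine pow_le_pow_left₀ (norm_nonneg _) ?_ 2
    simp only [k]
    rwa [map_sub, ← hP.add ht.le ht.le, ← two_mul]
  rw [e]
  nlinarith [mul_nonneg (mul_nonneg hN0 hD0) (norm_nonneg g)]

omit [SigmaFinite μ] in
lemma norm_oscillation_le_norm (t : ℝ) (F : Linfty μ) :
    ‖P t (absSq (F - P t F))‖ ≤ (2 * ‖F‖) ^ 2 := by
  refine ((hP.subMarkov t).norm_apply_le _).trans ?_
  rw [norm_absSq]
  refine pow_le_pow_left₀ (norm_nonneg _) ?_ 2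
  have := (norm_sub_le F (P t F)).trans (add_le_add_right ((hP.subMarkov t).norm_apply_le F) _)
  linarith

/-- `bmo ≤ 6 BMO`: as `F - P_{4t} F` is controlled by the `BMO` norm, and the defect of `P_{4t} F`
at time `t` is a quarter of the defect of `F` at time `4 t`, the inequality follows by absorption. -/
lemma norm_defect_le_of_oscillation {D : ℝ} (hD0 : 0 ≤ D) {F : Linfty μ}
    (hD : ∀ t, 0 < t → ‖P t (absSq (F - P t F))‖ ≤ D ^ 2) (ht : 0 < t) :
    ‖schwarzDefect (P t) F‖ ≤ (6 * D) ^ 2 := by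
  have hstep : ∀ N : ℝ, 0 ≤ N → (∀ t, 0 < t → ‖schwarzDefect (P t) F‖ ≤ N ^ 2) →
      ∀ t, 0 < t → ‖schwarzDefect (P t) F‖ ≤ (3 * D + N / 2) ^ 2 := by
    intro N hN0 hN t ht
    refine hP.norm_defect_le_of_forall fun g hg => ?_
    have hp := hP.isDualSeminorm t hg
    have e : F = (F - P t F) + (P t F - P (2 * t) F) + (P (2 * t) F - P (4 * t) F) +
        P (4 * t) F := by abel
    have h1 : defectNorm (P t) g (F - P t F) ≤ D * √‖g‖ := by
      refine (abs_le_of_sq_le_sq' ?_ (by positivity)).2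
      rw [hP.sq_defectNorm t hg, mul_pow, Real.sq_sqrt (norm_nonneg g)]
      exact (rePairing_schwarzDefect_le _ hg _).trans ((rePairing_le_norm _ _).trans
        (mul_le_mul_of_nonneg_right (hD t ht) (norm_nonneg g)))
    have hnorm : ∀ x : Linfty μ, ‖x‖ ≤ D → defectNorm (P t) g x ≤ D * √‖g‖ := fun x hx =>
      hP.defectNorm_le_of_norm hD0 ((hP.norm_defect_le t x).trans
        (pow_le_pow_left₀ (norm_nonneg _) hx 2)) hg
    have h2 := hnorm _ (hP.norm_sub_double_le hD0 (hD t ht) ht.le)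
    have h3 := hnorm _ (hP.norm_sub_double_le hD0 (hD (2 * t) (by positivity)) (by positivity))
    rw [show 2 * (2 * t) = 4 * t by ring] at h3
    have h4 : defectNorm (P t) g (P (4 * t) F) ≤ N / 2 * √‖g‖ := by
      refine (abs_le_of_sq_le_sq' ?_ (by positivity)).2
      rw [hP.sq_defectNorm t hg, mul_pow, Real.sq_sqrt (norm_nonneg g)]
      have h5 := hP.defect_average_le ht.le 1 4 F hg
      push_cast at h5
      rw [one_mul, one_mul] at h5
      have h6 : rePairing g (P t (schwarzDefect (P (4 * t)) F)) ≤ N ^ 2 * ‖g‖ :=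
        (rePairing_le_norm _ _).trans (mul_le_mul_of_nonneg_right
          (((hP.subMarkov t).norm_apply_le _).trans (hN _ (by positivity))) (norm_nonneg g))
      nlinarith
    have h7 := hp.add_le ((F - P t F) + (P t F - P (2 * t) F) + (P (2 * t) F - P (4 * t) F))
      (P (4 * t) F)
    have h8 := hp.add_le ((F - P t F) + (P t F - P (2 * t) F)) (P (2 * t) F - P (4 * t) F)
    have h9 := hp.add_le (F - P t F) (P t F - P (2 * t) F)
    rw [← e] at h7
    linarith
  have hiter : ∀ k : ℕ, ∀ t, 0 < t → ‖schwarzDefect (P t) F‖ ≤ (6 * D + ‖F‖ / 2 ^ k) ^ 2 := by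
    intro k
    induction k with
    | zero =>
      intro t _
      refine (hP.norm_defect_le t F).trans (pow_le_pow_left₀ (norm_nonneg _) ?_ 2)
      rw [pow_zero, div_one]
      linarith
    | succ k ih =>
      intro t ht
      refine (hstep _ (by positivity) ih t ht).trans_eq ?_
      rw [pow_succ]
      ring
  have hlim : Tendsto (fun k : ℕ => (6 * D + ‖F‖ / 2 ^ k) ^ 2) atTop (𝓝 ((6 * D + 0) ^ 2)) :=
    ((tendsto_const_nhds.div_atTop
      (tendsto_pow_atTop_atTop_of_one_lt one_lt_two)).const_add _).pow 2
  rw [add_zero] at hlim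
  exact ge_of_tendsto' hlim fun k => hiter k t ht

/-- `‖y Q_y F‖` is controlled by the `BMO` norm, since
`Q_y F = Q_{y/2} (P_{y/2} F - P_{3y/2} F) + Q_{2y} F`. -/
lemma norm_deriv_le_of_oscillation {D : ℝ} (hD0 : 0 ≤ D) {F : Linfty μ}
    (hD : ∀ t, 0 < t → ‖P t (absSq (F - P t F))‖ ≤ D ^ 2) {y : ℝ} (hy : 0 < y) :
    ‖Q y F‖ ≤ 16 * β * D / y := by
  have hβ := hP.beta_pos
  have hiter : ∀ k : ℕ, ∀ y, 0 < y → ‖Q y F‖ ≤ (16 * β * D + 2 * β * ‖F‖ / 2 ^ k) / y := by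
    intro k
    induction k with
    | zero =>
      intro y hy
      refine (hP.norm_deriv_le hy F).trans ?_
      rw [pow_zero, div_one, div_mul_eq_mul_div]
      gcongr
      linarith [show 0 ≤ 16 * β * D by positivity]
    | succ k ih =>
      intro y hy
      have hy2 : 0 < y / 2 := half_pos hy
      have e1 : Q y F = Q (y / 2) (P (y / 2) F) := by
        rw [← hP.deriv_add' hy2.le hy2, add_halves]
      have e2 : Q (2 * y) F = Q (y / 2) (P (y / 2) (P y F)) := by
        rw [← hP.add hy2.le hy.le, ← hP.deriv_add' (by positivity) hy2]
        congr 2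
        ring
      have e3 : Q y F = Q (y / 2) ((P (y / 2) F - P y F) + P (y / 2) (P (y / 2) F - P y F)) +
          Q (2 * y) F := by
        rw [e2, e1]
        simp only [map_add, map_sub]
        rw [← hP.add hy2.le hy2.le, add_halves]
        abel
      have h1 := hP.norm_sub_double_le hD0 (hD _ hy2) hy2.le
      rw [show 2 * (y / 2) = y by ring] at h1
      have h2 := ((hP.subMarkov (y / 2)).norm_apply_le (P (y / 2) F - P y F)).trans h1
      have h3 : ‖Q (y / 2) ((P (y / 2) F - P y F) + P (y / 2) (P (y / 2) F - P y F))‖ ≤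
          2 * β / (y / 2) * (D + D) :=
        (hP.norm_deriv_le hy2 _).trans (mul_le_mul_of_nonneg_left
          ((norm_add_le _ _).trans (add_le_add h1 h2)) (by positivity))
      have h4 := ih (2 * y) (by positivity)
      rw [e3]
      refine (norm_add_le _ _).trans ((add_le_add h3 h4).trans_eq ?_)
      rw [pow_succ]
      field_simp
      ring
  have hlim : Tendsto (fun k : ℕ => (16 * β * D + 2 * β * ‖F‖ / 2 ^ k) / y) atTop
      (𝓝 ((16 * β * D + 0) / y)) :=
    ((tendsto_const_nhds.div_atTop
      (tendsto_pow_atTop_atTop_of_one_lt one_lt_two)).const_add _).div_const y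
  rw [add_zero] at hlim
  exact ge_of_tendsto' hlim fun k => hiter k y hy

/-- Second order decay: `Q_w F - Q_{w+t} F` is `Q_{w/2}` applied to a difference of values of the
semigroup, which is estimated by `norm_deriv_le_of_oscillation` and the mean value inequality. -/
lemma norm_deriv_sub_le_of_oscillation {D : ℝ} (hD0 : 0 ≤ D) {F : Linfty μ}
    (hD : ∀ t, 0 < t → ‖P t (absSq (F - P t F))‖ ≤ D ^ 2) {w : ℝ} (hw : 0 < w) (ht : 0 ≤ t) :
    ‖Q w F - Q (w + t) F‖ ≤ 128 * β ^ 2 * D * t / w ^ 2 := by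
  have hβ := hP.beta_pos
  have hw2 : 0 < w / 2 := half_pos hw
  have h1 : ‖P (w / 2) F - P (w / 2 + t) F‖ ≤ 16 * β * D / (w / 2) * t := by
    refine Linfty.norm_le_of_forall_pairing (by positivity) fun g => ?_
    have h2 := (convex_Icc (w / 2) (w / 2 + t)).norm_image_sub_le_of_norm_hasDerivWithin_le
      (f := fun t => pairing (P t F) g) (f' := fun t => pairing (Q t F) g)
      (C := 16 * β * D / (w / 2) * ‖g‖)
      (fun x hx => (hP.hasDerivAt (hw2.trans_le hx.1) F g).hasDerivWithinAt)
      (fun x hx => ?_) (left_mem_Icc.2 (by linarith)) (right_mem_Icc.2 (by linarith))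
    · rw [add_sub_cancel_left, Real.norm_of_nonneg ht] at h2
      rw [← norm_neg, ← pairing_neg_left, neg_sub, pairing_sub_left]
      exact h2.trans_eq (by ring)
    · refine (norm_pairing_le _ _).trans (mul_le_mul_of_nonneg_right ?_ (norm_nonneg _))
      refine (hP.norm_deriv_le_of_oscillation hD0 hD (hw2.trans_le hx.1)).trans ?_
      have := hx.1
      gcongr
  have e : Q w F - Q (w + t) F = Q (w / 2) (P (w / 2) F - P (w / 2 + t) F) := by
    rw [map_sub, ← hP.deriv_add' hw2.le hw2, ← hP.deriv_add' (by linarith) hw2]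
    congr 3 <;> ring
  rw [e]
  refine (hP.norm_deriv_le hw2 _).trans
    ((mul_le_mul_of_nonneg_left h1 (by positivity)).trans_eq ?_)
  field_simp
  ring

/-- The integrand `Q_{v+t} f - Q_{v+2t} f` decays like `t / v²`, so that the dyadic pieces of the weight
contribute a geometric series. -/
lemma norm_sub_double_weightedDeriv_le (ha : CompactWeight a κ) {D : ℝ} (hD0 : 0 ≤ D)
    {f : Linfty μ} (hD : ∀ t, 0 < t → ‖P t (absSq (f - P t f))‖ ≤ D ^ 2) (ht : 0 < t) :
    ‖P t (weightedDeriv Q a 0 f) - P (2 * t) (weightedDeriv Q a 0 f)‖ ≤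
      1024 * κ * β ^ 2 * D := by
  have hβ := hP.beta_pos
  have hκ := ha.nonneg
  obtain ⟨ε, R, hε, h⟩ := ha.support
  obtain ⟨L, hL⟩ := pow_unbounded_of_one_lt (R / t) (one_lt_two : (1 : ℝ) < 2)
  rw [div_lt_iff₀ ht] at hL
  have ht2 : 0 ≤ 2 * t := by positivity
  refine Linfty.norm_le_of_forall_pairing (by positivity) fun g => ?_
  rw [hP.map_weightedDeriv ha ht.le, hP.map_weightedDeriv ha ht2]
  have hint : ∀ x, 0 ≤ x → ∀ g, Integrable (fun v => pairing (a v • Q (v + x) f) g)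
      (volume.restrict (Ioi 0)) := fun x hx g =>
    (pairingLeft g).integrable_comp (hP.integrableOn_weight ha hx f)
  have h1 := (isDualSeminorm_norm_pairing g).weighted_le ha.toBoundedAverages
    (F := fun v => Q (v + t) f - Q (v + 2 * t) f)
    (h := weightedDeriv Q a t f - weightedDeriv Q a (2 * t) f)
    (fun g => by
      rw [pairing_sub_left, ← hP.pairing_weightedDeriv ha ht.le,
        ← hP.pairing_weightedDeriv ha ht2, ← integral_sub (hint t ht.le g) (hint _ ht2 g)]
      simp_rw [smul_sub, pairing_sub_left])
    ht (L := L) (fun v _ hv => (h v hv).2.trans hL.le)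
    (m := fun l => 128 * β ^ 2 * D * t / (2 ^ l * t / 2) ^ 2 * ‖g‖) (fun l => by positivity)
    fun l hl v hvl hv => ?_
  · refine h1.trans ?_
    have e : ∀ l : ℕ, κ * (2 ^ l * t) * (128 * β ^ 2 * D * t / (2 ^ l * t / 2) ^ 2 * ‖g‖) =
        512 * κ * β ^ 2 * D * ‖g‖ * (1 / 2) ^ l := fun l => by
      rw [one_div, inv_pow]
      field_simp
      ring
    simp_rw [e]
    rw [← Finset.mul_sum]
    refine (mul_le_mul_of_nonneg_left (sum_geometric_two_le (L + 1)) (by positivity)).trans_eq ?_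
    ring
  · have hv0 : 0 < v := (dyadicPiece_subset ht l hvl).1
    have hw : 2 ^ l * t / 2 ≤ v + t := by
      rcases Nat.eq_zero_or_pos l with rfl | hl0
      · rw [pow_zero, one_mul]
        linarith
      · have := hvl.1
        rw [if_neg hl0.ne'] at this
        linarith
    refine (norm_pairing_le _ _).trans (mul_le_mul_of_nonneg_right ?_ (norm_nonneg g))
    have h2 := hP.norm_deriv_sub_le_of_oscillation hD0 hD (show 0 < v + t by linarith) ht.le
    rw [show v + t + t = v + 2 * t by ring] at h2
    refine h2.trans ?_
    gcongr

/-- The `BMO` estimate, from the `bmo` estimate and the control of `P_t h - P_{2t} h`. -/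
theorem norm_oscillation_weightedDeriv_le (ha : CompactWeight a κ) {D : ℝ} (hD0 : 0 ≤ D)
    {f : Linfty μ} (hD : ∀ t, 0 < t → ‖P t (absSq (f - P t f))‖ ≤ D ^ 2) (ht : 0 < t) :
    ‖P t (absSq (weightedDeriv Q a 0 f - P t (weightedDeriv Q a 0 f)))‖ ≤
      (8000 * κ * β ^ 2 * D) ^ 2 := by
  have hβ := hP.beta_pos
  have hκ := ha.nonneg
  have hD6 : 0 ≤ 6 * D := by positivity
  refine (hP.norm_oscillation_le (by positivity) (by positivity) ht
    (hP.norm_defect_weightedDeriv_le ha hD6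
      (fun t ht => hP.norm_defect_le_of_oscillation hD0 hD ht) ht)
    (hP.norm_sub_double_weightedDeriv_le ha hD0 hD ht)).trans ?_
  refine pow_le_pow_left₀ (by positivity) ?_ 2
  have : 0 ≤ κ * β ^ 2 * D := by positivity
  linarith

end SubordinatedSemigroup

end MeanOscillation

section SteinWeights

variable {a : ℝ → ℂ} {κ ca : ℝ}

/-! ### Averages of weights satisfying Stein's condition -/

lemma SteinCondition.lintegral_sq_le (ha : SteinCondition a ca) {ρ : ℝ} (hρ : 0 < ρ) :
    ∫⁻ v in Ioc 0 ρ, ‖a v‖ₑ ^ 2 ≤ ENNReal.ofReal (4 * ρ * ca ^ 2) := by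
  have h1 : ∫⁻ v in Ioc ρ (ρ + ρ), ‖a (v - ρ)‖ₑ ^ 2 = ∫⁻ v in Ioc 0 ρ, ‖a v‖ₑ ^ 2 := by
    have h := (measurePreserving_sub_right (volume : Measure ℝ) ρ).setLIntegral_comp_preimage_emb
      (MeasurableEquiv.subRight ρ).measurableEmbedding (fun v => ‖a v‖ₑ ^ 2) (Ioc 0 ρ)
    rw [← h]
    congr 2
    ext v
    simp
  have h2 : ∫⁻ v in Ioc ρ (ρ + ρ), ‖a (v - ρ)‖ₑ ^ 2 ≤
      ENNReal.ofReal (4 * ρ ^ 2) * ∫⁻ v in Ioi ρ, ‖a (v - ρ)‖ₑ ^ 2 / ENNReal.ofReal (v ^ 2) := by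
    rw [← lintegral_const_mul' _ _ ENNReal.ofReal_ne_top]
    refine (setLIntegral_mono' measurableSet_Ioc fun v hv => ?_).trans
      (lintegral_mono_set Ioc_subset_Ioi_self)
    have hv0 : 0 < v := hρ.trans hv.1
    rw [← mul_div_assoc, ENNReal.le_div_iff_mul_le
      (Or.inl (ENNReal.ofReal_pos.2 (by positivity)).ne') (Or.inl ENNReal.ofReal_ne_top), mul_comm]
    gcongr
    nlinarith [hv.2]
  have h3 : ENNReal.ofReal (4 * ρ ^ 2) = ENNReal.ofReal (4 * ρ) * ENNReal.ofReal ρ := by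
    rw [← ENNReal.ofReal_mul (by positivity)]
    ring_nf
  rw [← h1, ENNReal.ofReal_mul (by positivity)]
  refine h2.trans ?_
  rw [h3, mul_assoc]
  gcongr
  exact ha ρ hρ

/-- The average of `|a|` over `(0, ρ]` is controlled by Stein's condition at `s = ρ`, since
`v⁻² ≥ (2ρ)⁻²` on `(ρ, 2ρ]`, together with the Cauchy–Schwarz inequality. -/
lemma SteinCondition.boundedAverages (ha : SteinCondition a ca)
    (hm : AEStronglyMeasurable a (volume.restrict (Ioi 0))) (hca : 0 ≤ ca) :
    BoundedAverages a (2 * ca) := by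
  have hm' : ∀ ρ, AEStronglyMeasurable a (volume.restrict (Ioc 0 ρ)) := fun ρ =>
    hm.mono_measure (Measure.restrict_mono Ioc_subset_Ioi_self le_rfl)
  have key : ∀ ρ, 0 < ρ → ∫⁻ v in Ioc 0 ρ, ‖a v‖ₑ ≤ ENNReal.ofReal (2 * ca * ρ) := fun ρ hρ => by
    have h := ENNReal.lintegral_mul_le_Lp_mul_Lq (volume.restrict (Ioc 0 ρ))
      Real.HolderConjugate.two_two (hm' ρ).enorm aemeasurable_const (g := fun _ => (1 : ℝ≥0∞))
    have e : (fun v => ‖a v‖ₑ) * (fun _ => (1 : ℝ≥0∞)) = fun v => ‖a v‖ₑ := by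
      ext v; simp
    rw [e] at h
    refine h.trans ?_
    have h1 : (∫⁻ v in Ioc 0 ρ, ‖a v‖ₑ ^ (2 : ℝ)) ≤ ENNReal.ofReal (4 * ρ * ca ^ 2) := by
      simpa using ha.lintegral_sq_le hρ
    have h2 : (∫⁻ _ in Ioc 0 ρ, (1 : ℝ≥0∞) ^ (2 : ℝ)) = ENNReal.ofReal ρ := by simp
    rw [h2, ← ENNReal.mul_rpow_of_nonneg _ _ (by norm_num)]
    calc _ ≤ (ENNReal.ofReal (4 * ρ * ca ^ 2) * ENNReal.ofReal ρ) ^ (1 / 2 : ℝ) := by gcongr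
      _ = ENNReal.ofReal ((2 * ca * ρ) ^ 2) ^ (1 / 2 : ℝ) := by
        rw [← ENNReal.ofReal_mul (by positivity)]
        ring_nf
      _ = ENNReal.ofReal (2 * ca * ρ) := by
        rw [ENNReal.ofReal_rpow_of_nonneg (by positivity) (by norm_num), ← Real.sqrt_eq_rpow,
          Real.sqrt_sq (by positivity)]
  refine ⟨fun ρ => ?_, fun ρ hρ => ?_⟩
  · rcases le_or_gt ρ 0 with h | h
    · rw [Ioc_eq_empty_of_le h]
      exact integrableOn_empty
    · exact ⟨hm' ρ, (key ρ h).trans_lt ENNReal.ofReal_lt_top⟩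
  · rw [integral_norm_eq_lintegral_enorm (hm' ρ)]
    exact ENNReal.toReal_le_of_le_ofReal (by positivity) (key ρ hρ)

lemma BoundedAverages.neg (ha : BoundedAverages a κ) : BoundedAverages (-a) κ :=
  ⟨fun ρ => (ha.integrableOn ρ).neg, fun ρ hρ => by simpa using ha.integral_le ρ hρ⟩

lemma BoundedAverages.aestronglyMeasurable (ha : BoundedAverages a κ) :
    AEStronglyMeasurable a (volume.restrict (Ioi 0)) := by
  have e : Ioi (0 : ℝ) = ⋃ n : ℕ, Ioc 0 (n : ℝ) := by
    ext v
    simp only [mem_Ioi, mem_iUnion, mem_Ioc, exists_and_left, iff_self_and]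
    exact fun _ => exists_nat_ge v
  rw [e]
  exact aestronglyMeasurable_iUnion_iff.2 fun n => (ha.integrableOn n).aestronglyMeasurable

lemma BoundedAverages.compactWeight_of_isCompact (ha : BoundedAverages a κ) {K : Set ℝ}
    (hK : IsCompact K) (hK0 : K ⊆ Ioi 0) (h : ∀ t, t ∉ K → a t = 0) : CompactWeight a κ := by
  refine ⟨ha, ?_⟩
  rcases K.eq_empty_or_nonempty with rfl | hne
  · exact ⟨1, 1, one_pos, fun v hv => (hv (h v (notMem_empty v))).elim⟩
  · refine ⟨sInf K, sSup K, hK0 (hK.sInf_mem hne), fun v hv => ?_⟩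
    have hv' : v ∈ K := by_contra fun hv' => hv (h v hv')
    exact ⟨csInf_le hK.bddBelow hv', le_csSup hK.bddAbove hv'⟩

lemma BoundedAverages.compactWeight_indicator (ha : BoundedAverages a κ) {ε R : ℝ} (hε : 0 < ε) :
    CompactWeight ((Icc ε R).indicator a) κ := by
  refine ⟨ha.mono (ha.aestronglyMeasurable.indicator measurableSet_Icc)
    fun _ => norm_indicator_le_norm_self _ _, ε, R, hε, fun v hv => ?_⟩
  exact mem_Icc.1 (mem_of_indicator_ne_zero hv)

lemma CompactWeight.conj (ha : CompactWeight a κ) : CompactWeight (fun v => conj (a v)) κ :=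
  ha.mono (Complex.continuous_conj.comp_aestronglyMeasurable
    ha.integrableOn_Ioi.aestronglyMeasurable) fun v => (RCLike.norm_conj (a v)).le

/-- The intervals `[ε, N]` exhaust `(0, ∞)` as `ε → 0+` and `N → ∞`. -/
lemma aecover_Icc_Ioi_zero : AECover (volume.restrict (Ioi (0 : ℝ))) (𝓝[>] 0 ×ˢ atTop)
    fun p : ℝ × ℝ => Icc p.1 p.2 where
  ae_eventually_mem := by
    filter_upwards [ae_restrict_mem measurableSet_Ioi] with v hv
    have h : ∀ᶠ x in 𝓝[>] (0 : ℝ), x < v := nhdsWithin_le_nhds (Iio_mem_nhds hv)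
    exact (h.prod_mk (eventually_ge_atTop v)).mono fun p hp => ⟨hp.1.le, hp.2⟩
  measurableSet _ := measurableSet_Icc

end SteinWeights

section Seminorms

variable {M : Type*} [MeasurableSpace M] {μ : Measure M}
  {P Q : ℝ → Linfty μ →L[ℂ] Linfty μ} {β c : ℝ} {a : ℝ → ℂ} {κ : ℝ}
  {S : ℝ → Linfty μ → Linfty μ}

/-! ### The bmo and BMO seminorms of a weighted integral -/

lemma enorm_rpow_half_le_iff {E : Type*} [SeminormedAddCommGroup E] {x : E} {C : ℝ} (hC : 0 ≤ C) :
    ‖x‖ₑ ^ (1 / 2 : ℝ) ≤ ENNReal.ofReal C ↔ ‖x‖ ≤ C ^ 2 := by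
  rw [← ofReal_norm, ENNReal.ofReal_rpow_of_nonneg (norm_nonneg _) (by norm_num),
    ENNReal.ofReal_le_ofReal_iff hC, ← Real.sqrt_eq_rpow, Real.sqrt_le_left hC]

lemma bmoNorm_le_iff (hS : ∀ t f, S t f = P t f) {f : Linfty μ} {C : ℝ} (hC : 0 ≤ C) :
    bmoNorm S f ≤ ENNReal.ofReal C ↔ ∀ t, 0 < t → ‖schwarzDefect (P t) f‖ ≤ C ^ 2 := by
  simp only [bmoNorm, iSup_le_iff, enorm_rpow_half_le_iff hC, hS, schwarzDefect]

lemma BMONorm_le_iff (hS : ∀ t f, S t f = P t f) {f : Linfty μ} {C : ℝ} (hC : 0 ≤ C) :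
    BMONorm S f ≤ ENNReal.ofReal C ↔ ∀ t, 0 < t → ‖P t (absSq (f - P t f))‖ ≤ C ^ 2 := by
  simp only [BMONorm, iSup_le_iff, enorm_rpow_half_le_iff hC, hS]

lemma BMONorm_smul_le (hS : ∀ t f, S t f = P t f) (z : ℂ) {f : Linfty μ} {C : ℝ} (hC : 0 ≤ C)
    (h : BMONorm S f ≤ ENNReal.ofReal C) : BMONorm S (z • f) ≤ ENNReal.ofReal (‖z‖ * C) := by
  rw [BMONorm_le_iff hS (by positivity)]
  intro t ht
  rw [map_smul, ← smul_sub, absSq_smul, map_smul, norm_smul, Complex.norm_real, norm_pow, norm_norm,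
    mul_pow]
  exact mul_le_mul_of_nonneg_left ((BMONorm_le_iff hS hC).1 h t ht) (by positivity)

lemma pairing_star_eq_conj (f : Linfty μ) (g : Lp ℂ 1 μ) :
    pairing (star f) g = conj (pairing f (star g)) := by
  rw [← pairing_star, star_star]

namespace SubordinatedSemigroup

variable (hP : SubordinatedSemigroup P Q β c)

include hP

lemma BMONorm_le (hS : ∀ t f, S t f = P t f) (f : Linfty μ) :
    BMONorm S f ≤ ENNReal.ofReal (2 * ‖f‖) :=
  (BMONorm_le_iff hS (by positivity)).2 fun t _ => hP.norm_oscillation_le_norm t f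

variable [SigmaFinite μ]

lemma bmoNorm_le (hS : ∀ t f, S t f = P t f) (f : Linfty μ) :
    bmoNorm S f ≤ ENNReal.ofReal ‖f‖ :=
  (bmoNorm_le_iff hS (norm_nonneg _)).2 fun t _ => hP.norm_defect_le t f

lemma bmoNorm_weightedDeriv_le (hS : ∀ t f, S t f = P t f) (ha : CompactWeight a κ)
    (f : Linfty μ) :
    bmoNorm S (weightedDeriv Q a 0 f) ≤ ENNReal.ofReal (576 * κ * β ^ 2) * bmoNorm S f := by
  have hκ := ha.nonneg
  have hfin : bmoNorm S f ≠ ∞ := ((hP.bmoNorm_le hS f).trans_lt ENNReal.ofReal_lt_top).ne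
  rw [← ENNReal.ofReal_toReal hfin, ← ENNReal.ofReal_mul (by positivity),
    bmoNorm_le_iff hS (mul_nonneg (by positivity) ENNReal.toReal_nonneg)]
  exact fun t ht => hP.norm_defect_weightedDeriv_le ha ENNReal.toReal_nonneg
    ((bmoNorm_le_iff hS ENNReal.toReal_nonneg).1 (ENNReal.ofReal_toReal hfin).ge) ht

lemma BMONorm_weightedDeriv_le (hS : ∀ t f, S t f = P t f) (ha : CompactWeight a κ)
    {f : Linfty μ} {D : ℝ} (hD : 0 ≤ D) (h : BMONorm S f ≤ ENNReal.ofReal D) :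
    BMONorm S (weightedDeriv Q a 0 f) ≤ ENNReal.ofReal (8000 * κ * β ^ 2 * D) := by
  have hκ := ha.nonneg
  rw [BMONorm_le_iff hS (by positivity)]
  exact fun t ht => hP.norm_oscillation_weightedDeriv_le ha hD ((BMONorm_le_iff hS hD).1 h) ht

lemma deriv_star {t : ℝ} (ht : 0 < t) (f : Linfty μ) : Q t (star f) = star (Q t f) := by
  refine Linfty.ext_pairing fun g => ?_
  have h1 := hP.hasDerivAt ht (star f) g
  have h2 := (hP.hasDerivAt ht f (star g)).star
  have e : (fun t => pairing (P t (star f)) g) = fun t => star (pairing (P t f) (star g)) := by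
    ext s
    rw [(hP.subMarkov s).positive.map_star, pairing_star_eq_conj]
    rfl
  rw [e] at h1
  rw [pairing_star_eq_conj]
  exact h1.unique h2

lemma star_weightedDeriv (ha : CompactWeight a κ) (f : Linfty μ) :
    star (weightedDeriv Q a 0 f) = weightedDeriv Q (fun v => conj (a v)) 0 (star f) := by
  refine Linfty.ext_pairing fun g => ?_
  rw [pairing_star_eq_conj, ← hP.pairing_weightedDeriv ha le_rfl,
    ← hP.pairing_weightedDeriv ha.conj le_rfl, ← integral_conj]
  refine setIntegral_congr_fun measurableSet_Ioi fun v hv => ?_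
  have hv' : 0 < v + 0 := by simpa using hv
  rw [pairing_smul_left, pairing_smul_left, hP.deriv_star hv', pairing_star_eq_conj, map_mul]

end SubordinatedSemigroup

end Seminorms

section Duality

variable {M : Type*} [MeasurableSpace M] {μ : Measure M}
  {P Q : ℝ → Linfty μ →L[ℂ] Linfty μ} {β c : ℝ} {a : ℝ → ℂ} {κ : ℝ}
  {S : ℝ → Linfty μ → Linfty μ}

/-! ### Duality with the Hardy space and the predual operator -/

/-- Duality between `BMO` and `H^1`. The case `C = 0` is included because the bound holds for all
larger `C`. -/
lemma norm_pairing_toL1_le (hS : ∀ t f, S t f = P t f) {f : Linfty μ} {C : ℝ} (hC : 0 ≤ C)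
    (h : BMONorm S f ≤ ENNReal.ofReal C) (h' : BMONorm S (star f) ≤ ENNReal.ofReal C) (g : H1 S) :
    ‖pairing f (H1.toL1 g)‖ ≤ C * ‖g‖ := by
  have key : ∀ r, C < r → ‖pairing f (H1.toL1 g)‖ ≤ r * ‖g‖ := fun r hr => by
    have hr0 : 0 < r := hC.trans_lt hr
    have hle : ‖((r⁻¹ : ℝ) : ℂ)‖ * C ≤ 1 := by
      rw [Complex.norm_real, norm_inv, Real.norm_of_nonneg hr0.le, inv_mul_le_one₀ hr0]
      exact hr.le
    have h1 : BMONorm S (((r⁻¹ : ℝ) : ℂ) • f) ≤ 1 :=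
      (BMONorm_smul_le hS _ hC h).trans (ENNReal.ofReal_le_one.2 hle)
    have h2 : BMONorm S (star (((r⁻¹ : ℝ) : ℂ) • f)) ≤ 1 := by
      rw [star_smul, RCLike.star_def, Complex.conj_ofReal]
      exact (BMONorm_smul_le hS _ hC h').trans (ENNReal.ofReal_le_one.2 hle)
    have h3 : ‖pairing (((r⁻¹ : ℝ) : ℂ) • f) (H1.toL1 g)‖ₑ ≤ H1Norm S (H1.toL1 g) :=
      le_iSup₂ (f := fun f (_ : BMONorm S f ≤ 1 ∧ BMONorm S (star f) ≤ 1) =>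
        ‖pairing f (H1.toL1 g)‖ₑ) _ ⟨h1, h2⟩
    have h4 := ENNReal.toReal_mono g.norm_lt_top.ne h3
    rw [toReal_enorm, pairing_smul_left, norm_mul, Complex.norm_real, norm_inv,
      Real.norm_of_nonneg hr0.le, inv_mul_le_iff₀ hr0] at h4
    exact h4
  refine le_of_forall_gt_imp_ge_of_dense fun y hy => ?_
  rcases eq_or_lt_of_le (norm_nonneg g) with h0 | h0
  · have := key (C + 1) (lt_add_one C)
    rw [← h0, mul_zero] at this hy
    exact this.trans hy.le
  · have := key (y / ‖g‖) ((lt_div_iff₀ h0).2 hy)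
    rwa [div_mul_cancel₀ _ h0.ne'] at this

/-- Continuity for topologies of pointwise convergence of a map that acts by reindexing. -/
lemma continuous_induced_of_reindex {X Y ι ι' : Type*} (e : X → ι → ℂ) (e' : Y → ι' → ℂ)
    (φ : X → Y) (r : ι' → ι) (h : ∀ x i, e' (φ x) i = e x (r i)) :
    Continuous[TopologicalSpace.induced e Pi.topologicalSpace,
      TopologicalSpace.induced e' Pi.topologicalSpace] φ := by
  let : TopologicalSpace X := TopologicalSpace.induced e Pi.topologicalSpace
  refine continuous_induced_rng.2 (continuous_pi fun i => ?_)
  simp only [Function.comp_apply, h]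
  exact (continuous_apply (r i)).comp continuous_induced_dom

lemma H1Norm_le_of_forall {k : Lp ℂ 1 μ} {C : ℝ}
    (h : ∀ f, BMONorm S f ≤ 1 → BMONorm S (star f) ≤ 1 → ‖pairing f k‖ ≤ C) :
    H1Norm S k ≤ ENNReal.ofReal C :=
  iSup₂_le fun f hf => by
    rw [← ofReal_norm]
    exact ENNReal.ofReal_le_ofReal (h f hf.1 hf.2)

lemma H1.ext_pairing {g g' : H1 S} (h : ∀ f, pairing f (H1.toL1 g) = pairing f (H1.toL1 g')) :
    g = g' := Subtype.ext (L1.ext_pairing h)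

namespace SubordinatedSemigroup

variable (hP : SubordinatedSemigroup P Q β c)

include hP

lemma norm_pairing_toL1_le_two_norm (hS : ∀ t f, S t f = P t f) (f : Linfty μ) (g : H1 S) :
    ‖pairing f (H1.toL1 g)‖ ≤ 2 * ‖f‖ * ‖g‖ := by
  refine norm_pairing_toL1_le hS (by positivity) (hP.BMONorm_le hS f) ?_ g
  rw [← Linfty.norm_star f]
  exact hP.BMONorm_le hS (star f)

/-- Every element of `L^∞` defines an element of `BMO`. -/
lemma exists_represents (hS : ∀ t f, S t f = P t f) (f : Linfty μ) :
    ∃ F : H1Dual S, Represents F f := by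
  refine ⟨LinearMap.mkContinuous
    ⟨⟨fun g => pairing f (H1.toL1 g), fun g g' => ?_⟩, fun z g => ?_⟩ (2 * ‖f‖)
    (hP.norm_pairing_toL1_le_two_norm hS f), fun _ => rfl⟩
  · rw [map_add, pairing_add_right]
  · simp [pairing_smul_right]

omit hP in
lemma mem_BMO_of_represents {F : H1Dual S} {f : Linfty μ} (h : Represents F f) : F ∈ BMO S :=
  (mem_BMO_iff F).2 (@subset_closure _ (H1Dual.weakStar S) _ _ ⟨f, h⟩)

omit hP in
/-- The functional `∫_0^∞ a(v) ⟨Q_v f, g⟩ dv`. -/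
def derivPairing (Q : ℝ → Linfty μ →L[ℂ] Linfty μ) (a : ℝ → ℂ) (f : Linfty μ) (g : Lp ℂ 1 μ) : ℂ :=
  ∫ v in Ioi 0, a v * pairing (Q v f) g

lemma pairing_weightedDeriv_indicator (ha : BoundedAverages a κ) {ε R : ℝ} (hε : 0 < ε)
    (f : Linfty μ) (g : Lp ℂ 1 μ) :
    pairing (weightedDeriv Q ((Icc ε R).indicator a) 0 f) g =
      ∫ v in Icc ε R, a v * pairing (Q v f) g ∂(volume.restrict (Ioi 0)) := by
  rw [← hP.pairing_weightedDeriv (ha.compactWeight_indicator hε) le_rfl,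
    ← integral_indicator measurableSet_Icc]
  congr 1
  ext v
  rw [pairing_smul_left, add_zero]
  by_cases hv : v ∈ Icc ε R <;> simp [hv]

variable [SigmaFinite μ]

lemma norm_pairing_weightedDeriv_le (hS : ∀ t f, S t f = P t f) (ha : CompactWeight a κ)
    {f : Linfty μ} {D : ℝ} (hD : 0 ≤ D) (h : BMONorm S f ≤ ENNReal.ofReal D)
    (h' : BMONorm S (star f) ≤ ENNReal.ofReal D) (g : H1 S) :
    ‖pairing (weightedDeriv Q a 0 f) (H1.toL1 g)‖ ≤ 8000 * κ * β ^ 2 * D * ‖g‖ := by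
  have hκ := ha.nonneg
  refine norm_pairing_toL1_le hS (by positivity) (hP.BMONorm_weightedDeriv_le hS ha hD h) ?_ g
  rw [hP.star_weightedDeriv ha]
  exact hP.BMONorm_weightedDeriv_le hS ha.conj hD h'

/-- An integral over a weight with compact support is the adjoint of an operator on `L^1`. -/
lemma exists_pairing_weightedDeriv (ha : CompactWeight a κ) (g : Lp ℂ 1 μ) :
    ∃ k, ∀ f, pairing (weightedDeriv Q a 0 f) g = pairing f k := by
  obtain ⟨ε, R, hε, h⟩ := ha.support
  have hβ := hP.beta_pos
  have hbound : ∀ (f : Linfty μ) (v : ℝ), v ∈ Ioi (0 : ℝ) →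
      ‖pairing (a v • Q (v + 0) f) g‖ ≤ ‖a v‖ * (2 * β / ε * ‖g‖) * ‖f‖ := fun f v hv => by
    rw [pairing_smul_left, norm_mul, mul_assoc]
    by_cases h0 : a v = 0
    · simp [h0]
    · have hv' : 0 < v + 0 := by simpa using hv
      have hv1 := (h v h0).1
      refine mul_le_mul_of_nonneg_left ((norm_pairing_le _ _).trans ?_) (norm_nonneg _)
      calc ‖Q (v + 0) f‖ * ‖g‖ ≤ 2 * β / (v + 0) * ‖f‖ * ‖g‖ := by
            gcongr
            exact hP.norm_deriv_le hv' f
        _ ≤ 2 * β / ε * ‖f‖ * ‖g‖ := by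
            gcongr
            linarith
        _ = _ := by ring
  have hint : Integrable (fun v => ‖a v‖ * (2 * β / ε * ‖g‖)) (volume.restrict (Ioi 0)) :=
    ha.integrableOn_Ioi.norm.mul_const _
  let Λ : Linfty μ →L[ℂ] ℂ := LinearMap.mkContinuous
    { toFun := fun f => pairing (weightedDeriv Q a 0 f) g
      map_add' := fun f f' => by
        rw [← pairing_add_left, weightedDeriv, weightedDeriv, weightedDeriv,
          ← integral_add (hP.integrableOn_weight ha le_rfl f)
            (hP.integrableOn_weight ha le_rfl f')]
        simp only [map_add, smul_add]
      map_smul' := fun z f => by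
        rw [RingHom.id_apply, smul_eq_mul, ← pairing_smul_left, weightedDeriv, weightedDeriv,
          ← integral_smul]
        simp only [map_smul, smul_comm z] }
    (∫ v in Ioi 0, ‖a v‖ * (2 * β / ε * ‖g‖)) fun f => by
      change ‖pairing (weightedDeriv Q a 0 f) g‖ ≤ _
      rw [← hP.pairing_weightedDeriv ha le_rfl, ← integral_mul_const]
      exact norm_integral_le_of_norm_le (hint.mul_const _)
        ((ae_restrict_iff' measurableSet_Ioi).2 (ae_of_all _ (hbound f)))
  have hΛ : SequentiallyNormal Λ := by
    intro A hA hanti hinter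
    change Tendsto (fun n => pairing (weightedDeriv Q a 0 (indicatorTop μ (hA n))) g) atTop (𝓝 0)
    simp_rw [← hP.pairing_weightedDeriv ha le_rfl]
    have h0 : (0 : ℂ) = ∫ v in Ioi (0 : ℝ), (0 : ℂ) := by simp
    rw [h0]
    refine tendsto_integral_of_dominated_convergence _ (fun n => ?_) hint (fun n => ?_) ?_
    · exact ((pairingLeft g).integrable_comp
        (hP.integrableOn_weight ha le_rfl (indicatorTop μ (hA n)))).aestronglyMeasurable
    · filter_upwards [ae_restrict_mem measurableSet_Ioi] with v hv
      exact (hbound _ v hv).trans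
        (mul_le_of_le_one_right (by positivity) (norm_indicatorTop_le _))
    · filter_upwards [ae_restrict_mem measurableSet_Ioi] with v hv
      have hv' : 0 < v + 0 := by simpa using hv
      obtain ⟨k, hk⟩ := hP.normal_deriv hv' g
      have := (sequentiallyNormal_pairingLeft k A hA hanti hinter).const_mul (a v)
      simpa only [pairing_smul_left, hk, pairingLeft_apply, mul_zero] using this
  exact hΛ.exists_pairing

/-- The integrand of `derivPairing` is absolutely integrable for `g ∈ H^1`: the uniform bounds also
hold for the weights `v ↦ θ(v) a(v)` with `θ` unimodular, and `θ` can be chosen so that all values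
`θ(v) a(v) ⟨Q_v f, g⟩` are nonnegative. -/
lemma integrableOn_derivPairing (hS : ∀ t f, S t f = P t f) (ha : BoundedAverages a κ)
    (f : Linfty μ) (g : H1 S) :
    IntegrableOn (fun v => a v * pairing (Q v f) (H1.toL1 g)) (Ioi 0) := by
  set G := H1.toL1 g
  set h : ℝ → ℂ := fun v => a v * pairing (Q v f) G
  have hq : AEStronglyMeasurable (fun v => pairing (Q v f) G) (volume.restrict (Ioi 0)) :=
    ((pairingLeft G).continuous.comp_continuousOn
      (hP.continuousOn_deriv f)).aestronglyMeasurable measurableSet_Ioi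
  have hm : AEStronglyMeasurable h (volume.restrict (Ioi 0)) := ha.aestronglyMeasurable.mul hq
  set θ : ℝ → ℂ := fun v => conj (((‖h v‖⁻¹ : ℝ) : ℂ) * h v)
  have hθm : AEStronglyMeasurable θ (volume.restrict (Ioi 0)) :=
    Complex.continuous_conj.comp_aestronglyMeasurable
      ((Complex.continuous_ofReal.comp_aestronglyMeasurable
        hm.norm.aemeasurable.inv.aestronglyMeasurable).mul hm)
  have hθ1 : ∀ v, ‖θ v‖ ≤ 1 := fun v => by
    rw [RCLike.norm_conj, norm_mul, Complex.norm_real, norm_inv, norm_norm]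
    exact inv_mul_le_one
  have hb : BoundedAverages (fun v => θ v * a v) κ :=
    ha.mono (hθm.mul ha.aestronglyMeasurable) fun v => by
      rw [norm_mul]
      exact mul_le_of_le_one_left (norm_nonneg _) (hθ1 v)
  have hpos : ∀ᶠ p : ℝ × ℝ in 𝓝[>] 0 ×ˢ atTop, 0 < p.1 :=
    tendsto_fst.eventually (self_mem_nhdsWithin : Ioi (0 : ℝ) ∈ 𝓝[>] 0)
  have hiff : ∀ p : ℝ × ℝ, 0 < p.1 → IntegrableOn h (Icc p.1 p.2) (volume.restrict (Ioi 0)) :=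
    fun p hp => by
      have := (pairingLeft G).integrable_comp
        (hP.integrableOn_weight (ha.compactWeight_indicator (R := p.2) hp) le_rfl f)
      rw [← integrable_indicator_iff measurableSet_Icc]
      refine this.congr (ae_of_all _ fun v => ?_)
      simp only [pairingLeft_apply, pairing_smul_left, add_zero]
      by_cases hv : v ∈ Icc p.1 p.2 <;> simp [hv, h]
  have hκ := ha.nonneg
  refine aecover_Icc_Ioi_zero.integrable_of_lintegral_enorm_bounded
    (8000 * κ * β ^ 2 * (2 * ‖f‖) * ‖g‖) hm (hpos.mono fun p hp => ?_)
  rw [← ofReal_integral_norm_eq_lintegral_enorm (hiff p hp)]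
  refine ENNReal.ofReal_le_ofReal ?_
  have h1 := hP.norm_pairing_weightedDeriv_le hS (hb.compactWeight_indicator (R := p.2) hp)
    (by positivity) (hP.BMONorm_le hS f)
    (by rw [← Linfty.norm_star f]; exact hP.BMONorm_le hS (star f)) g
  refine le_trans (le_of_eq ?_) h1
  have e : ∀ v, θ v * a v * pairing (Q v f) G = ((‖h v‖ : ℝ) : ℂ) := fun v => by
    rw [← mul_conj_sign (h v)]
    simp only [θ, h]
    ring
  rw [hP.pairing_weightedDeriv_indicator hb hp]
  simp only [G] at e
  simp_rw [e]
  rw [integral_complex_ofReal, Complex.norm_real,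
    Real.norm_of_nonneg (integral_nonneg fun _ => norm_nonneg _)]

lemma tendsto_pairing_weightedDeriv (hS : ∀ t f, S t f = P t f) (ha : BoundedAverages a κ)
    (f : Linfty μ) (g : H1 S) :
    Tendsto (fun p : ℝ × ℝ =>
        pairing (weightedDeriv Q ((Icc p.1 p.2).indicator a) 0 f) (H1.toL1 g))
      (𝓝[>] 0 ×ˢ atTop) (𝓝 (derivPairing Q a f (H1.toL1 g))) := by
  have hpos : ∀ᶠ p : ℝ × ℝ in 𝓝[>] 0 ×ˢ atTop, 0 < p.1 :=
    tendsto_fst.eventually (self_mem_nhdsWithin : Ioi (0 : ℝ) ∈ 𝓝[>] 0)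
  refine (aecover_Icc_Ioi_zero.integral_tendsto_of_countably_generated
    (hP.integrableOn_derivPairing hS ha f g)).congr' (hpos.mono fun p hp => ?_)
  exact (hP.pairing_weightedDeriv_indicator ha hp f _).symm

lemma norm_derivPairing_le (hS : ∀ t f, S t f = P t f) (ha : BoundedAverages a κ)
    {f : Linfty μ} {D : ℝ} (hD : 0 ≤ D) (h : BMONorm S f ≤ ENNReal.ofReal D)
    (h' : BMONorm S (star f) ≤ ENNReal.ofReal D) (g : H1 S) :
    ‖derivPairing Q a f (H1.toL1 g)‖ ≤ 8000 * κ * β ^ 2 * D * ‖g‖ := by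
  refine le_of_tendsto (hP.tendsto_pairing_weightedDeriv hS ha f g).norm ?_
  filter_upwards [tendsto_fst.eventually (self_mem_nhdsWithin : Ioi (0 : ℝ) ∈ 𝓝[>] 0)] with p hp
  exact hP.norm_pairing_weightedDeriv_le hS (ha.compactWeight_indicator hp) hD h h' g

/-- The predual of the multiplier preserves `H^1`. -/
lemma exists_predual_apply (hS : ∀ t f, S t f = P t f) (ha : BoundedAverages a κ) (g : H1 S) :
    ∃ k : H1 S, (∀ f, derivPairing Q a f (H1.toL1 g) = pairing f (H1.toL1 k)) ∧
      ‖k‖ ≤ 8000 * κ * β ^ 2 * ‖g‖ := by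
  have hκ := ha.nonneg
  have hn : ∀ n : ℕ, (0 : ℝ) < 1 / ((n : ℝ) + 1) := fun n => Nat.one_div_pos_of_nat
  choose k hk using fun n : ℕ => hP.exists_pairing_weightedDeriv
    (ha.compactWeight_indicator (R := n) (hn n)) (H1.toL1 g)
  have hp : Tendsto (fun n : ℕ => (1 / ((n : ℝ) + 1), (n : ℝ))) atTop (𝓝[>] 0 ×ˢ atTop) :=
    (tendsto_nhdsWithin_iff.2 ⟨tendsto_one_div_add_atTop_nhds_zero_nat,
      Eventually.of_forall hn⟩).prodMk tendsto_natCast_atTop_atTop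
  obtain ⟨K, hK⟩ := exists_pairing_of_tendsto (g := k)
    (Λ := fun f => derivPairing Q a f (H1.toL1 g)) fun f =>
      ((hP.tendsto_pairing_weightedDeriv hS ha f g).comp hp).congr fun n => hk n f
  have hle : H1Norm S K ≤ ENNReal.ofReal (8000 * κ * β ^ 2 * ‖g‖) :=
    H1Norm_le_of_forall fun f hf hf' => by
      rw [← hK]
      have := hP.norm_derivPairing_le hS ha zero_le_one (hf.trans ENNReal.ofReal_one.ge)
        (hf'.trans ENNReal.ofReal_one.ge) g
      rwa [mul_one] at this
  exact ⟨⟨K, hle.trans_lt ENNReal.ofReal_lt_top⟩, hK,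
    ENNReal.toReal_le_of_le_ofReal (by positivity) hle⟩

/-- The predual of the multiplier as a bounded operator on `H^1`. -/
lemma exists_predual (hS : ∀ t f, S t f = P t f) (ha : BoundedAverages a κ) :
    ∃ R : H1 S →L[ℂ] H1 S, ‖R‖ ≤ 8000 * κ * β ^ 2 ∧
      ∀ f g, derivPairing Q a f (H1.toL1 g) = pairing f (H1.toL1 (R g)) := by
  have hκ := ha.nonneg
  choose R hR hR' using fun g => hP.exists_predual_apply hS ha g
  have hadd : ∀ g g', R (g + g') = R g + R g' := fun g g' => H1.ext_pairing fun f => by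
    rw [map_add, pairing_add_right, ← hR, ← hR, ← hR, map_add, derivPairing, derivPairing,
      derivPairing, ← integral_add (hP.integrableOn_derivPairing hS ha f g)
        (hP.integrableOn_derivPairing hS ha f g')]
    simp only [pairing_add_right, mul_add]
  have hsmul : ∀ (z : ℂ) g, R (z • g) = z • R g := fun z g => H1.ext_pairing fun f => by
    rw [map_smul, pairing_smul_right, ← hR, ← hR, map_smul, derivPairing, derivPairing,
      ← integral_const_mul]
    simp only [pairing_smul_right, mul_left_comm]
  exact ⟨LinearMap.mkContinuous ⟨⟨R, hadd⟩, hsmul⟩ _ hR',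
    LinearMap.mkContinuous_norm_le _ (by positivity) _, fun f g => hR g f⟩

/-- The transpose of the predual is the weak* continuous extension of the multiplier to `BMO`. -/
lemma exists_extension (hS : ∀ t f, S t f = P t f) (ha : BoundedAverages a κ) :
    ∃ E : BMO S →L[ℂ] BMO S, Continuous[BMO.weakStar S, BMO.weakStar S] E ∧
      ‖E‖ ≤ 8000 * κ * β ^ 2 ∧
      ∀ (f : Linfty μ) (F : BMO S), Represents (F : H1Dual S) f →
        ∀ g, (E F : H1Dual S) g = derivPairing Q a f (H1.toL1 g) := by
  have hκ := ha.nonneg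
  obtain ⟨R, hR, hR'⟩ := hP.exists_predual hS ha
  have hcont : Continuous[H1Dual.weakStar S, H1Dual.weakStar S] fun F : H1Dual S => F.comp R :=
    continuous_induced_of_reindex H1Dual.eval H1Dual.eval _ R fun _ _ => rfl
  have hlim : ∀ F : H1Dual S, (∃ f, Represents F f) → F.comp R ∈ BMO S := by
    rintro F ⟨f, hf⟩
    choose G hG using hP.exists_represents hS
    refine (mem_BMO_iff _).2 (@mem_closure_of_tendsto _ (H1Dual.weakStar S) _ _ _
      (fun p : ℝ × ℝ => G (weightedDeriv Q ((Icc p.1 p.2).indicator a) 0 f)) (𝓝[>] 0 ×ˢ atTop)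
      inferInstance ?_ (Eventually.of_forall fun p => ⟨_, hG _⟩))
    rw [nhds_induced, tendsto_comap_iff, tendsto_pi_nhds]
    intro g
    have h1 := hP.tendsto_pairing_weightedDeriv hS ha f g
    rw [hR', ← hf (R g)] at h1
    exact h1.congr fun p => (hG _ g).symm
  have hmaps : ∀ F : BMO S, (F : H1Dual S).comp R ∈ BMO S := fun F => by
    have h1 := @map_mem_closure _ _ (H1Dual.weakStar S) (H1Dual.weakStar S) _ _ _ _ hcont
      ((mem_BMO_iff _).1 F.2) hlim
    exact (@IsClosed.closure_eq _ (H1Dual.weakStar S) _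
      (@isClosed_closure _ (H1Dual.weakStar S) _)).subset h1
  refine ⟨LinearMap.mkContinuous
    { toFun := fun F => ⟨(F : H1Dual S).comp R, hmaps F⟩
      map_add' := fun _ _ => rfl
      map_smul' := fun _ _ => rfl } (8000 * κ * β ^ 2) fun F => ?_, ?_,
    LinearMap.mkContinuous_norm_le _ (by positivity) _, fun f F hf g => ?_⟩
  · rw [mul_comm]
    exact ((F : H1Dual S).opNorm_comp_le R).trans (mul_le_mul_of_nonneg_left hR (norm_nonneg _))
  · exact continuous_induced_of_reindex (fun F : BMO S => fun g => (F : H1Dual S) g) _ _ R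
      fun _ _ => rfl
  · exact (hf (R g)).trans (hR' f g).symm

end SubordinatedSemigroup

end Duality

section Multiplier

variable {M : Type*} [MeasurableSpace M] {μ : Measure M} [SigmaFinite μ]
  {T : ℝ → Linfty μ →L[ℂ] Linfty μ} {α : ℝ}

/-! ### The spectral multiplier of the subordinated semigroup -/

namespace IsPositiveContractionSemigroup

variable (hT : IsPositiveContractionSemigroup T) (h0 : 0 < α) (h1 : α < 1)

include hT h0 h1

lemma smul_fracGenSubord (a : ℝ → ℂ) (f : Linfty μ) {t : ℝ} (ht : t ∈ Ioi (0 : ℝ)) :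
    a t • fracGenSubord T α t f = (-a) t • subordDerivOp T α (t + 0) f := by
  rw [hT.fracGenSubord_eq h0 h1 ht, add_zero, Pi.neg_apply, neg_smul, smul_neg]

/-- `L^α T_{t,α} f = -∂_t T_{t,α} f`, so the multiplier has weight `-a` against the derivative. -/
lemma steinMult_eq (a : ℝ → ℂ) (f : Linfty μ) :
    steinMult T α a f =
      SubordinatedSemigroup.weightedDeriv (subordDerivOp T α) (-a) 0 f :=
  setIntegral_congr_fun measurableSet_Ioi fun _ ht => hT.smul_fracGenSubord h0 h1 a f ht

end IsPositiveContractionSemigroup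

end Multiplier

end

theorem lemma3 :
    ∃ c : ℝ, 0 < c ∧
      ∀ {M : Type*} [MeasurableSpace M] (μ : Measure M) [SigmaFinite μ]
        (T : ℝ → Linfty μ →L[ℂ] Linfty μ),
        IsPositiveContractionSemigroup T → GammaTwoNonneg T →
      ∀ α : ℝ, 0 < α → α < 1 →
        -- the semigroup `T_{t,α}` is well defined and maps into the domain of `L^α`
        (∀ t : ℝ, 0 < t → ∀ f : Linfty μ,
          HasWeakStarIntegral (subordIntegrand T α t f) (subord T α t f) ∧
          HasNegGenerator (subord T α) (subord T α t f) (fracGenSubord T α t f)) ∧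
      ∀ (a : ℝ → ℂ) (ca : ℝ), AEStronglyMeasurable a (volume.restrict (Ioi 0)) → 0 ≤ ca →
        SteinCondition a ca →
        -- estimates for compactly supported `a`
        ((∃ K : Set ℝ, IsCompact K ∧ K ⊆ Ioi 0 ∧ ∀ t, t ∉ K → a t = 0) →
          ∀ f : Linfty μ,
            IntegrableOn (fun t => a t • fracGenSubord T α t f) (Ioi 0) ∧
            bmoNorm (subord T α) (steinMult T α a f) ≤
              ENNReal.ofReal (c * ca / (1 - α) ^ 2) * bmoNorm (subord T α) f ∧
            BMONorm (subord T α) (steinMult T α a f) ≤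
              ENNReal.ofReal (c * ca / (1 - α) ^ 2) * ‖f‖ₑ) ∧
        -- for general `a`, the bounded weak* continuous extension of `M_a` to `BMO(L^α)`
        ∃ E : BMO (subord T α) →L[ℂ] BMO (subord T α),
          Continuous[BMO.weakStar (subord T α), BMO.weakStar (subord T α)] E ∧
          ‖E‖ ≤ c * ca / (1 - α) ^ 2 ∧
          ∀ f : Linfty μ, ∃ F : BMO (subord T α), Represents (F : H1Dual (subord T α)) f ∧
            (∀ g : H1 (subord T α),
              Tendsto
                (fun p : ℝ × ℝ =>
                  pairing (steinMult T α (indicator (Icc p.1 p.2) a) f) (H1.toL1 g))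
                (𝓝[>] 0 ×ˢ atTop) (𝓝 ((E F : H1Dual (subord T α)) g))) ∧
            ‖E F‖ ≤ c * ca / (1 - α) ^ 2 * ‖f‖ := by
  refine ⟨32000, by norm_num, ?_⟩
  intro M _ μ _ T hT hΓ α h0 h1
  refine ⟨fun t ht f => ⟨?_, hT.hasNegGenerator_fracGenSubord h0 h1 ht f⟩, ?_⟩
  · rw [hT.subord_eq h0 h1]
    exact hT.hasWeakStarIntegral_subordOp h0 h1 ht f
  intro a ca ham hca ha
  have hP := hT.subordinatedSemigroup hΓ h0 h1
  have hS := hT.subord_eq h0 h1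
  have hα : 0 < 1 - α := sub_pos.2 h1
  have hw : BoundedAverages (-a) (2 * ca) := (ha.boundedAverages ham hca).neg
  -- The constants come from `κ = 2 c_a` and `β = 1 / (1 - α)`; the bounds in terms of `‖f‖` carry
  -- a further factor `2`, since `‖f‖_BMO ≤ 2 ‖f‖`.
  have e1 : ∀ x : ℝ, 8000 * (2 * ca) * (1 / (1 - α)) ^ 2 * (2 * x) =
      32000 * ca / (1 - α) ^ 2 * x := fun x => by
    rw [one_div, inv_pow]
    ring
  have e2 : ∀ C : ℝ, C ≤ 16000 → C * ca * (1 / (1 - α)) ^ 2 ≤ 32000 * ca / (1 - α) ^ 2 :=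
    fun C hC => by
      rw [one_div, inv_pow, ← div_eq_mul_inv]
      gcongr
      linarith
  refine ⟨?_, ?_⟩
  · rintro ⟨K, hK, hK0, hKa⟩ f
    have hc : CompactWeight (-a) (2 * ca) :=
      hw.compactWeight_of_isCompact hK hK0 fun t ht => by simp [hKa t ht]
    refine ⟨(integrableOn_congr_fun (fun t ht => hT.smul_fracGenSubord h0 h1 a f ht)
      measurableSet_Ioi).2 (hP.integrableOn_weight hc le_rfl f), ?_, ?_⟩
    · rw [hT.steinMult_eq h0 h1]
      refine (hP.bmoNorm_weightedDeriv_le hS hc f).trans ?_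
      gcongr
      refine le_trans (le_of_eq ?_) (e2 1152 (by norm_num))
      ring
    · rw [hT.steinMult_eq h0 h1, ← ofReal_norm, ← ENNReal.ofReal_mul (by positivity), ← e1]
      exact hP.BMONorm_weightedDeriv_le hS hc (by positivity) (hP.BMONorm_le hS f)
  · obtain ⟨E, hE, hE', hEf⟩ := hP.exists_extension hS hw
    refine ⟨E, hE, hE'.trans (le_trans (le_of_eq (by ring)) (e2 16000 le_rfl)), fun f => ?_⟩
    obtain ⟨F, hF⟩ := hP.exists_represents hS f
    refine ⟨⟨F, SubordinatedSemigroup.mem_BMO_of_represents hF⟩, hF, fun g => ?_, ?_⟩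
    · rw [hEf f _ hF g]
      refine (hP.tendsto_pairing_weightedDeriv hS hw f g).congr fun p => ?_
      rw [hT.steinMult_eq h0 h1, indicator_neg']
    · rw [← e1]
      refine ContinuousLinearMap.opNorm_le_bound _ (by positivity) fun g => ?_
      have hg := hEf f ⟨F, SubordinatedSemigroup.mem_BMO_of_represents hF⟩ hF g
      refine (congrArg norm hg).le.trans ?_
      refine hP.norm_derivPairing_le hS hw (by positivity) (hP.BMONorm_le hS f) ?_ g
      rw [← Linfty.norm_star f]
      exact hP.BMONorm_le hS (star f)
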